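/- Let $k\ge 2$ and $\varepsilon\in\{1,-1\}$. Use coordinates $(x,\xi)$ on $\mathbb R^2$; all germs are taken at the origin $O$, and a diffeomorphism germ is a germ fixing $O$. A real-analytic function germ $H$ has an $A_{k-1}$ singularity with sign $\varepsilon$ at $O$ if $H=\xi^2+\varepsilon x^k$ in suitable real-analytic local coordinates centred at $O$. Consider pairs $(H,\omega)$ of such a germ $H$ and a germ $\omega$ of a real-analytic symplectic form. Call $(H_0,\omega_0)$ and $(H_1,\omega_1)$ equivalent if there is a real-analytic diffeomorphism germ $\psi$ with $\psi^*H_1=H_0$ and $\psi^*\omega_1=\omega_0$, and oriented equivalent if $\psi$ can moreover be chosen with $\det D\psi(O)>0$. Let $\mathcal F$ be the set of families $f=(f_1,\dots,f_{k-1})$ of germs at $0\in\mathbb R$ of real-analytic functions with $f_1(0)\neq 0$. For $f\in\mathcal F$ let $$N_f=\Big(\xi^2+\varepsilon x^k,\ d\Big(\sum_{i=1}^{k-1}x^i f_i(x^k)\,d\xi\Big)\Big),\qquad -f=(-f_1,\dots,-f_{k-1}).$$ Write $f\sim g$ if $g=f$ or, when $k$ is even, if $g_i=f_i$ for all odd $i$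 and $g_i=-f_i$ for all even $i$. (So for odd $k$, $f\sim g$ means $f=g$; for $k=2\ell$ it means equality up to changing the sign of $\sum_{i=1}^{\ell-1}x^{2i}f_{2i}(x^{2\ell})$.) Then: 1. (Normal form.) Every pair $(H,\omega)$ is oriented equivalent to $N_f$ for some $f\in\mathcal F$. For every $g\in\mathcal F$, the pair $(H,\omega)$ is oriented equivalent to $N_g$ if and only if $f\sim g$, and it is equivalent to $N_g$ if and only if $f\sim g$ or $-f\sim g$. 2. (Complete invariants.) If $(H_0,\omega_0)$ is oriented equivalent to $N_f$ and $(H_1,\omega_1)$ is oriented equivalent to $N_g$, with $f,g\in\mathcal F$, then $(H_0,\omega_0)$ and $(H_1,\omega_1)$ are oriented equivalent if and only if $f\sim g$, and equivalent if and only if $f\sim g$ or $-f\sim g$. 3. (Minimality.) For every $f\in\mathcal F$, $N_f$ is such a pair: $\xi^2+\varepsilon x^k$ has an $A_{k-1}$ singularity with sign $\varepsilon$ at $O$, and its 2-form is a real-analytic symplectic form near $O$. -/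

import Mathlib

open Filter Topology

namespace ASing

/-- The plane with coordinates `(x, ξ)`: `p.1` is `x` and `p.2` is `ξ`. -/
abbrev Plane : Type := ℝ × ℝ

/-- `ψ` represents the germ at the origin of a real-analytic diffeomorphism fixing the origin:
it is analytic and has an analytic inverse germ. -/
def IsDiffeoGerm (ψ : Plane → Plane) : Prop :=
  AnalyticAt ℝ ψ 0 ∧ ψ 0 = 0 ∧
    ∃ θ : Plane → Plane, AnalyticAt ℝ θ 0 ∧ θ 0 = 0 ∧
      (∀ᶠ p in 𝓝 (0 : Plane), θ (ψ p) = p) ∧ (∀ᶠ p in 𝓝 (0 : Plane), ψ (θ p) = p)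

/-- The Jacobian determinant of `ψ` at the origin is positive. -/
def PreservesOrientation (ψ : Plane → Plane) : Prop :=
  0 < (fderiv ℝ ψ 0).det

/-- Differential 2-forms on the plane. -/
abbrev TwoForm : Type := Plane → Plane [⋀^Fin 2]→L[ℝ] ℝ

/-- The pull-back `ψ^* ω`, that is `(ψ^* ω)_p (v, w) = ω_{ψ p} (Dψ_p v, Dψ_p w)`. -/
noncomputable def pullback (ψ : Plane → Plane) (ω : TwoForm) : TwoForm :=
  fun p => (ω (ψ p)).compContinuousLinearMap (fderiv ℝ ψ p)

/-- `ω` is a real-analytic symplectic form near the origin. -/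
def IsSymplecticGerm (ω : TwoForm) : Prop :=
  AnalyticAt ℝ ω 0 ∧
    (∀ᶠ p in 𝓝 (0 : Plane), extDeriv ω p = 0) ∧
    (∀ᶠ p in 𝓝 (0 : Plane), ∀ v : Plane, (∀ w : Plane, ω p ![v, w] = 0) → v = 0)

/-- The model Hamiltonian `ξ² + ε x^k`, where `ε` is a sign. -/
def model (k : ℕ) (ε : ℝ) (p : Plane) : ℝ :=
  p.2 ^ 2 + ε * p.1 ^ k

/-- The real-analytic Hamiltonian `H` has an `A_{k-1}` singularity with sign `ε` at the origin:
in suitable real-analytic local coordinates `H = ξ² + ε x^k`. -/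
def HasASingularity (k : ℕ) (ε : ℝ) (H : Plane → ℝ) : Prop :=
  AnalyticAt ℝ H 0 ∧
    ∃ φ : Plane → Plane, IsDiffeoGerm φ ∧ ∀ᶠ p in 𝓝 (0 : Plane), H (φ p) = model k ε p

/-- `(H, ω)` is a real-analytic Hamiltonian with an `A_{k-1}` singularity together with a
real-analytic symplectic form, near the origin. -/
def IsASingularPair (k : ℕ) (ε : ℝ) (H : Plane → ℝ) (ω : TwoForm) : Prop :=
  HasASingularity k ε H ∧ IsSymplecticGerm ω

/-- `ψ^* (H₁, ω₁) = (H₀, ω₀)` as germs at the origin. -/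
def PullsBack (ψ : Plane → Plane) (H₁ : Plane → ℝ) (ω₁ : TwoForm)
    (H₀ : Plane → ℝ) (ω₀ : TwoForm) : Prop :=
  (∀ᶠ p in 𝓝 (0 : Plane), H₁ (ψ p) = H₀ p) ∧
    (∀ᶠ p in 𝓝 (0 : Plane), pullback ψ ω₁ p = ω₀ p)

/-- The two pairs lie in one orbit of the group of real-analytic diffeomorphism germs. -/
def Equivalent (H₀ : Plane → ℝ) (ω₀ : TwoForm) (H₁ : Plane → ℝ) (ω₁ : TwoForm) : Prop :=
  ∃ ψ : Plane → Plane, IsDiffeoGerm ψ ∧ PullsBack ψ H₁ ω₁ H₀ ω₀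

/-- The two pairs lie in one orbit of the group of orientation-preserving real-analytic
diffeomorphism germs. -/
def OrientedEquivalent (H₀ : Plane → ℝ) (ω₀ : TwoForm) (H₁ : Plane → ℝ) (ω₁ : TwoForm) : Prop :=
  ∃ ψ : Plane → Plane, IsDiffeoGerm ψ ∧ PreservesOrientation ψ ∧ PullsBack ψ H₁ ω₁ H₀ ω₀

/-- The function `f(x) = ∑_{i=1}^{k-1} x^i f_i(x^k)`. Only the indices `1, …, k - 1` of the
family `f` are ever used. -/
def potential (k : ℕ) (f : ℕ → ℝ → ℝ) (x : ℝ) : ℝ :=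
  ∑ i ∈ Finset.Ico 1 k, x ^ i * f i (x ^ k)

/-- The constant 1-form `dξ`. -/
noncomputable def dXi : Plane [⋀^Fin 1]→L[ℝ] ℝ :=
  ContinuousAlternatingMap.ofSubsingleton ℝ Plane ℝ (0 : Fin 1) (ContinuousLinearMap.snd ℝ ℝ ℝ)

/-- The 2-form `d(f dξ)` with `f = ∑_{i=1}^{k-1} x^i f_i(x^k)`. -/
noncomputable def normalForm (k : ℕ) (f : ℕ → ℝ → ℝ) : TwoForm :=
  extDeriv (fun p : Plane => potential k f p.1 • dXi)

/-- The functions `f_1, …, f_{k-1}` are real-analytic at `0` and `f_1(0) ≠ 0`. -/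
def Admissible (k : ℕ) (f : ℕ → ℝ → ℝ) : Prop :=
  (∀ i ∈ Finset.Ico 1 k, AnalyticAt ℝ (f i) 0) ∧ f 1 0 ≠ 0

/-- `f_i = g_i` as germs at `0`, for `i = 1, …, k - 1`. -/
def SameGerms (k : ℕ) (f g : ℕ → ℝ → ℝ) : Prop :=
  ∀ i ∈ Finset.Ico 1 k, ∀ᶠ t in 𝓝 (0 : ℝ), f i t = g i t

/-- Changes the sign of the `f_i` of even index. -/
def flipEven (f : ℕ → ℝ → ℝ) : ℕ → ℝ → ℝ :=
  fun i t => if Even i then -f i t else f i t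

/-- The relation on the invariants: for odd `k`, equality of germs; for even `k`, equality of germs
up to a simultaneous sign change of all the even-indexed functions. -/
def Related (k : ℕ) (f g : ℕ → ℝ → ℝ) : Prop :=
  SameGerms k f g ∨ (Even k ∧ SameGerms k (flipEven f) g)

end ASing

namespace ASing

/-! In coordinates where `H = ξ² + ε x^k`, all that is left of `ω = h dx ∧ dξ` is its density `h`,
and the remaining freedom is the group of symmetries of the model. Since `dH ∧ dη = bracket η · dx ∧
dξ`, the object to study is the quotient of the germs `h` by brackets, the Brieskorn module of the
singularity. Every class in it contains exactly one power series in `x` with no exponent `n` such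
that `k ∣ n + 1`, and these series are exactly the derivatives of the functions `∑ x^i f_i(x^k)`.

Existence rests on two facts. First, `h = dx (potential f) + bracket η` can be solved with
convergent series (`exists_potential`): the equation decouples into chains of monomials of constant
weight `2a + kj`, and the recursion on a chain grows only like `L^q / q! ≤ e^L` with `L` linear in
the indices. Second, subtracting a bracket from a density with `h(0) ≠ 0` is realised by a symmetry
of `H` (`exists_symmetry`). This uses no differential equation: an explicit implicit scheme gives
analytic maps that preserve `H` and move points along its level curves. They change `h dx ∧ dξ` by
`dT ∧ dH`, and replacing the time by a suitable function of the point makes `T` any prescribed germ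
up to a constant.

Uniqueness rests on the functionals `residue k ε n`, for `n` with `k ∤ n + 1`, which read off the
coefficient of `x^n` in the reduced form and vanish on brackets. A symmetry `Ψ` of `H` is
compatible, modulo forms killed by the residues, with the Lie derivative along the weighted Euler
field `E = 2x ∂_x + kξ ∂_ξ` (`residue_transport_euler`). As the `x^n` have distinct weights, `Ψ`
acts diagonally on the reduced forms. Compatibility with multiplication by `H` makes the eigenvalue
depend only on `n mod k`, and for `n < k` it is read off from the linear part of `Ψ`: it is
`X_x(0)^n · det DΨ(0)`.

Finally the linear part satisfies `det DΨ(0) = ±1`, and for `k ≥ 3` also `X_x(0)^k = 1`, so `f_i =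
a^(i-1) (±1) g_i` with `a = 1`, or `a = -1` when `k` is even. The half-turn and the reflection in
`ξ` realise these signs. -/

/-! ### Convergent power series in two variables -/

/-- The power series in two variables with coefficients `c`. -/
noncomputable def psum (c : ℕ → ℕ → ℝ) (p : Plane) : ℝ :=
  ∑' n : ℕ × ℕ, c n.1 n.2 * (p.1 ^ n.1 * p.2 ^ n.2)

/-- The coefficients grow at most geometrically. -/
def GeomBdd (c : ℕ → ℕ → ℝ) : Prop :=
  ∃ C R : ℝ, 0 ≤ C ∧ 1 ≤ R ∧ ∀ a b, |c a b| ≤ C * R ^ (a + b)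

/-- `f` is, near the origin, the sum of the power series with coefficients `c`. -/
def HasCoef (f : Plane → ℝ) (c : ℕ → ℕ → ℝ) : Prop :=
  GeomBdd c ∧ f =ᶠ[𝓝 0] psum c

theorem GeomBdd.add {c d : ℕ → ℕ → ℝ} (hc : GeomBdd c) (hd : GeomBdd d) :
    GeomBdd (fun a b => c a b + d a b) := by
  obtain ⟨C, R, hC, hR, h⟩ := hc
  obtain ⟨C', R', hC', hR', h'⟩ := hd
  refine ⟨C + C', max R R', by positivity, le_max_of_le_left hR, fun a b => ?_⟩
  calc |c a b + d a b| ≤ |c a b| + |d a b| := abs_add_le _ _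
    _ ≤ C * R ^ (a + b) + C' * R' ^ (a + b) := add_le_add (h a b) (h' a b)
    _ ≤ C * (max R R') ^ (a + b) + C' * (max R R') ^ (a + b) := by
        gcongr
        · exact le_max_left _ _
        · exact le_max_right _ _
    _ = _ := by ring

theorem GeomBdd.const_mul {c : ℕ → ℕ → ℝ} (hc : GeomBdd c) (t : ℝ) :
    GeomBdd (fun a b => t * c a b) := by
  obtain ⟨C, R, hC, hR, h⟩ := hc
  refine ⟨|t| * C, R, by positivity, hR, fun a b => ?_⟩
  rw [abs_mul, mul_assoc]
  gcongr
  exact h a b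

/-- On the square of half-width `1/(4R)` a term with coefficient at most `C R^(a+b)` is at most `C
4^(-a-b)`. The factor 4 leaves room for the polynomial factors produced by differentiation and by
counting the monomials of degree `n`. -/
theorem exists_radius {R : ℝ} (hR : 1 ≤ R) {P : Plane → Prop}
    (h : ∀ p : Plane, |p.1| < (4 * R)⁻¹ → |p.2| < (4 * R)⁻¹ → P p) : ∀ᶠ p in 𝓝 (0 : Plane), P p := by
  have hR0 : 0 < (4 * R)⁻¹ := by positivity
  filter_upwards [Metric.ball_mem_nhds (0 : Plane) hR0] with p hp
  rw [mem_ball_zero_iff, Prod.norm_def, max_lt_iff] at hp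
  exact h p hp.1 hp.2

theorem summable_quarter : Summable fun n : ℕ × ℕ => (1 / 2 : ℝ) ^ n.1 * (1 / 2 : ℝ) ^ n.2 :=
  (summable_geometric_of_lt_one (by norm_num) (by norm_num)).mul_of_nonneg
    (summable_geometric_of_lt_one (by norm_num) (by norm_num))
    (fun _ => by positivity) (fun _ => by positivity)

theorem term_bound {c : ℕ → ℕ → ℝ} {C R : ℝ} (hC : 0 ≤ C) (hR : 1 ≤ R)
    (h : ∀ a b, |c a b| ≤ C * R ^ (a + b)) {p : Plane} (h1 : |p.1| < (4 * R)⁻¹)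
    (h2 : |p.2| < (4 * R)⁻¹) (n : ℕ × ℕ) :
    ‖c n.1 n.2 * (p.1 ^ n.1 * p.2 ^ n.2)‖ ≤ C * ((1 / 4) ^ n.1 * (1 / 4) ^ n.2) := by
  have hR0 : 0 < R := by linarith
  rw [Real.norm_eq_abs, abs_mul, abs_mul, abs_pow, abs_pow]
  calc |c n.1 n.2| * (|p.1| ^ n.1 * |p.2| ^ n.2)
      ≤ C * R ^ (n.1 + n.2) * ((4 * R)⁻¹ ^ n.1 * (4 * R)⁻¹ ^ n.2) := by
        gcongr
        exact h _ _
    _ = C * (((R * (4 * R)⁻¹) ^ n.1) * ((R * (4 * R)⁻¹) ^ n.2)) := by ring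
    _ = _ := by
        have : R * (4 * R)⁻¹ = 1 / 4 := by field_simp
        rw [this]

theorem summable_term {c : ℕ → ℕ → ℝ} {C R : ℝ} (hC : 0 ≤ C) (hR : 1 ≤ R)
    (h : ∀ a b, |c a b| ≤ C * R ^ (a + b)) {p : Plane} (h1 : |p.1| < (4 * R)⁻¹)
    (h2 : |p.2| < (4 * R)⁻¹) :
    Summable fun n : ℕ × ℕ => c n.1 n.2 * (p.1 ^ n.1 * p.2 ^ n.2) := by
  refine Summable.of_norm_bounded (summable_quarter.mul_left C) fun n => ?_
  refine (term_bound hC hR h h1 h2 n).trans ?_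
  gcongr <;> norm_num

theorem GeomBdd.hasSum {c : ℕ → ℕ → ℝ} (hc : GeomBdd c) :
    ∀ᶠ p in 𝓝 (0 : Plane),
      HasSum (fun n : ℕ × ℕ => c n.1 n.2 * (p.1 ^ n.1 * p.2 ^ n.2)) (psum c p) := by
  obtain ⟨C, R, hC, hR, h⟩ := hc
  exact exists_radius hR fun p h1 h2 => (summable_term hC hR h h1 h2).hasSum

theorem HasCoef.hasSum {f : Plane → ℝ} {c : ℕ → ℕ → ℝ} (hc : HasCoef f c) :
    ∀ᶠ p in 𝓝 (0 : Plane),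
      HasSum (fun n : ℕ × ℕ => c n.1 n.2 * (p.1 ^ n.1 * p.2 ^ n.2)) (f p) := by
  filter_upwards [hc.1.hasSum, hc.2] with p h1 h2
  rwa [h2]

theorem HasCoef.of_hasSum {f : Plane → ℝ} {c : ℕ → ℕ → ℝ} (hc : GeomBdd c)
    (h : ∀ᶠ p in 𝓝 (0 : Plane),
      HasSum (fun n : ℕ × ℕ => c n.1 n.2 * (p.1 ^ n.1 * p.2 ^ n.2)) (f p)) : HasCoef f c :=
  ⟨hc, h.mono fun _ hp => hp.tsum_eq.symm⟩

theorem HasCoef.congr {f g : Plane → ℝ} {c : ℕ → ℕ → ℝ} (hc : HasCoef f c)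
    (h : f =ᶠ[𝓝 0] g) : HasCoef g c := ⟨hc.1, h.symm.trans hc.2⟩

theorem HasCoef.congr_coef {f : Plane → ℝ} {c d : ℕ → ℕ → ℝ} (hc : HasCoef f c)
    (h : ∀ a b, c a b = d a b) : HasCoef f d := by
  have : c = d := by ext a b; exact h a b
  rwa [← this]

theorem HasCoef.add {f g : Plane → ℝ} {c d : ℕ → ℕ → ℝ} (hf : HasCoef f c) (hg : HasCoef g d) :
    HasCoef (fun p => f p + g p) (fun a b => c a b + d a b) := by
  refine .of_hasSum (hf.1.add hg.1) ?_
  filter_upwards [hf.hasSum, hg.hasSum] with p h1 h2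
  simpa only [add_mul] using h1.add h2

theorem HasCoef.const_mul {f : Plane → ℝ} {c : ℕ → ℕ → ℝ} (hf : HasCoef f c) (t : ℝ) :
    HasCoef (fun p => t * f p) (fun a b => t * c a b) := by
  refine .of_hasSum (hf.1.const_mul t) ?_
  filter_upwards [hf.hasSum] with p h1
  simpa only [mul_assoc] using h1.mul_left t

/-- The coefficients of `x f`. -/
def shiftX (c : ℕ → ℕ → ℝ) (a b : ℕ) : ℝ := if a = 0 then 0 else c (a - 1) b

/-- The coefficients of `ξ f`. -/
def shiftY (c : ℕ → ℕ → ℝ) (a b : ℕ) : ℝ := if b = 0 then 0 else c a (b - 1)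

theorem HasCoef.mulX {f : Plane → ℝ} {c : ℕ → ℕ → ℝ} (hf : HasCoef f c) :
    HasCoef (fun p => p.1 * f p) (shiftX c) := by
  obtain ⟨C, R, hC, hR, h⟩ := hf.1
  refine .of_hasSum ⟨C, R, hC, hR, fun a b => ?_⟩ ?_
  · rcases a with _ | a
    · simp only [shiftX, if_true, abs_zero]; positivity
    · simp only [shiftX, Nat.add_eq_zero_iff, one_ne_zero, and_false, if_false,
        Nat.add_sub_cancel]
      refine (h a b).trans ?_
      exact mul_le_mul_of_nonneg_left (pow_le_pow_right₀ hR (by omega)) hC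
  · filter_upwards [hf.hasSum] with p h1
    have hinj : Function.Injective fun n : ℕ × ℕ => (n.1 + 1, n.2) := by
      rintro ⟨a, b⟩ ⟨a', b'⟩ h; simpa using h
    refine (hinj.hasSum_iff ?_).1 ?_
    · rintro ⟨a, b⟩ hab
      rcases a with _ | a
      · simp [shiftX]
      · exact absurd ⟨(a, b), rfl⟩ hab
    · convert! h1.mul_left p.1 using 2 with n
      simp only [Function.comp, shiftX, Nat.add_eq_zero_iff, one_ne_zero, and_false, if_false,
        Nat.add_sub_cancel]
      ring

theorem HasCoef.mulY {f : Plane → ℝ} {c : ℕ → ℕ → ℝ} (hf : HasCoef f c) :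
    HasCoef (fun p => p.2 * f p) (shiftY c) := by
  obtain ⟨C, R, hC, hR, h⟩ := hf.1
  refine .of_hasSum ⟨C, R, hC, hR, fun a b => ?_⟩ ?_
  · rcases b with _ | b
    · simp only [shiftY, if_true, abs_zero]; positivity
    · simp only [shiftY, Nat.add_eq_zero_iff, one_ne_zero, and_false, if_false,
        Nat.add_sub_cancel]
      refine (h a b).trans ?_
      exact mul_le_mul_of_nonneg_left (pow_le_pow_right₀ hR (by omega)) hC
  · filter_upwards [hf.hasSum] with p h1
    have hinj : Function.Injective fun n : ℕ × ℕ => (n.1, n.2 + 1) := by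
      rintro ⟨a, b⟩ ⟨a', b'⟩ h; simpa using h
    refine (hinj.hasSum_iff ?_).1 ?_
    · rintro ⟨a, b⟩ hab
      rcases b with _ | b
      · simp [shiftY]
      · exact absurd ⟨(a, b), rfl⟩ hab
    · convert! h1.mul_left p.2 using 2 with n
      simp only [Function.comp, shiftY, Nat.add_eq_zero_iff, one_ne_zero, and_false, if_false,
        Nat.add_sub_cancel]
      ring

theorem HasCoef.mulX_pow {f : Plane → ℝ} {c : ℕ → ℕ → ℝ} (hf : HasCoef f c) (m : ℕ) :
    HasCoef (fun p => p.1 ^ m * f p) (fun a b => if a < m then 0 else c (a - m) b) := by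
  induction m with
  | zero => simpa using hf
  | succ m ih =>
    refine (ih.mulX.congr (.of_forall fun p => by ring)).congr_coef fun a b => ?_
    rcases a with _ | a
    · simp [shiftX]
    · simp [shiftX]

/-- The polynomial `n`-th term of a double power series, as a multilinear map. -/
noncomputable def homTerm (c : ℕ → ℕ → ℝ) : FormalMultilinearSeries ℝ Plane ℝ := fun n =>
  ∑ q ∈ Finset.HasAntidiagonal.antidiagonal n, c q.1 q.2 •
    (ContinuousMultilinearMap.mkPiAlgebra ℝ (Fin n) ℝ).compContinuousLinearMap
      (fun i : Fin n => if (i : ℕ) < q.1 then ContinuousLinearMap.fst ℝ ℝ ℝ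
        else ContinuousLinearMap.snd ℝ ℝ ℝ)

theorem homTerm_diag (c : ℕ → ℕ → ℝ) (n : ℕ) (p : Plane) :
    homTerm c n (fun _ => p) =
      ∑ q ∈ Finset.HasAntidiagonal.antidiagonal n, c q.1 q.2 * (p.1 ^ q.1 * p.2 ^ q.2) := by
  simp only [homTerm, sum_apply, smul_apply,
    ContinuousMultilinearMap.compContinuousLinearMap_apply,
    ContinuousMultilinearMap.mkPiAlgebra_apply, smul_eq_mul]
  refine Finset.sum_congr rfl fun q hq => ?_
  rw [Finset.HasAntidiagonal.mem_antidiagonal] at hq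
  congr 1
  subst hq
  rw [Fin.prod_univ_add]
  simp

theorem norm_homTerm_le {c : ℕ → ℕ → ℝ} {C R : ℝ}
    (h : ∀ a b, |c a b| ≤ C * R ^ (a + b)) (n : ℕ) : ‖homTerm c n‖ ≤ (n + 1) * (C * R ^ n) := by
  unfold homTerm
  calc _ ≤ ∑ q ∈ Finset.HasAntidiagonal.antidiagonal n, C * R ^ n := by
        refine norm_sum_le_of_le _ fun q hq => ?_
        rw [Finset.HasAntidiagonal.mem_antidiagonal] at hq
        rw [norm_smul, ← hq, Real.norm_eq_abs]
        have := (ContinuousMultilinearMap.mkPiAlgebra ℝ (Fin (q.1 + q.2)) ℝ).norm_compContinuousLinearMap_le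
          (fun i : Fin (q.1 + q.2) => if (i : ℕ) < q.1 then ContinuousLinearMap.fst ℝ ℝ ℝ
            else ContinuousLinearMap.snd ℝ ℝ ℝ)
        rw [ContinuousMultilinearMap.norm_mkPiAlgebra, one_mul] at this
        have h1 := this.trans (Finset.prod_le_one (fun _ _ => norm_nonneg _) fun i _ => by
          split_ifs
          · exact ContinuousLinearMap.norm_fst_le ℝ ℝ ℝ
          · exact ContinuousLinearMap.norm_snd_le ℝ ℝ ℝ)
        have h0 := h q.1 q.2
        calc _ ≤ |c q.1 q.2| * 1 := by gcongr
          _ ≤ _ := by linarith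
    _ = _ := by simp

theorem GeomBdd.analyticAt {c : ℕ → ℕ → ℝ} (hc : GeomBdd c) : AnalyticAt ℝ (psum c) 0 := by
  obtain ⟨C, R, hC, hR, h⟩ := hc
  have hR0 : 0 < R := by linarith
  set r : NNReal := ⟨(4 * R)⁻¹, by positivity⟩ with hr
  refine ⟨homTerm c, r, ?_, ?_, ?_⟩
  · refine FormalMultilinearSeries.le_radius_of_bound _ C fun n => ?_
    calc ‖homTerm c n‖ * (r : ℝ) ^ n ≤ ((n + 1) * (C * R ^ n)) * ((4 * R)⁻¹) ^ n := by
          gcongr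
          · exact norm_homTerm_le h n
          · exact le_rfl
      _ = C * ((n + 1) * (R * (4 * R)⁻¹) ^ n) := by ring
      _ = C * ((n + 1) * (1 / 4) ^ n) := by
          have : R * (4 * R)⁻¹ = 1 / 4 := by field_simp
          rw [this]
      _ ≤ C * 1 := by
          gcongr
          have : (n + 1 : ℝ) ≤ 4 ^ n := by
            have := one_add_mul_le_pow (a := (3 : ℝ)) (by norm_num) n
            norm_num at this
            have h0 : (0 : ℝ) ≤ n := n.cast_nonneg
            linarith
          rw [one_div, inv_pow]
          field_simp
          exact this
      _ = C := mul_one C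
  · simp only [ENNReal.coe_pos]
    rw [← NNReal.coe_pos]
    change 0 < (4 * R)⁻¹
    positivity
  · intro y hy
    have hy' : ‖y‖ < (4 * R)⁻¹ := by
      have := hy
      rw [Metric.mem_eball, edist_zero_right] at this
      rwa [← ofReal_norm, ENNReal.ofReal_lt_coe_iff (norm_nonneg _)] at this
    rw [Prod.norm_def, max_lt_iff] at hy'
    have hs := (summable_term hC hR h hy'.1 hy'.2).hasSum
    rw [zero_add]
    simp only [homTerm_diag]
    rw [← Finset.HasAntidiagonal.sigmaAntidiagonalEquivProd.hasSum_iff] at hs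
    convert! hs.sigma fun n => hasSum_fintype _ using 2 with n
    exact (Finset.sum_coe_sort (Finset.HasAntidiagonal.antidiagonal n)
      fun q => c q.1 q.2 * (y.1 ^ q.1 * y.2 ^ q.2)).symm

theorem HasCoef.analyticAt {f : Plane → ℝ} {c : ℕ → ℕ → ℝ} (hf : HasCoef f c) :
    AnalyticAt ℝ f 0 := hf.1.analyticAt.congr hf.2.symm

/-- Expand `y = y.1 e₁ + y.2 e₂` in every slot. The set `s` records the slots that receive `e₁`, and
the terms are grouped by its cardinality. -/
theorem multilinear_diag_eq {n : ℕ} (q : ContinuousMultilinearMap ℝ (fun _ : Fin n => Plane) ℝ)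
    (y : Plane) :
    q (fun _ => y) = ∑ m ∈ Finset.HasAntidiagonal.antidiagonal n,
      (∑ s ∈ Finset.powersetCard m.1 (Finset.univ : Finset (Fin n)),
        q (s.piecewise (fun _ => ((1, 0) : Plane)) (fun _ => (0, 1)))) *
        (y.1 ^ m.1 * y.2 ^ m.2) := by
  have h1 : (fun _ : Fin n => y) = (fun _ => y.1 • ((1, 0) : Plane)) + fun _ => y.2 • (0, 1) := by
    ext i <;> simp
  rw [h1, q.map_add_univ, ← Finset.powerset_univ, Finset.sum_powerset,
    Finset.Nat.sum_antidiagonal_eq_sum_range_succ_mk, Finset.card_univ, Fintype.card_fin]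
  refine Finset.sum_congr rfl fun a _ => ?_
  rw [Finset.sum_mul]
  refine Finset.sum_congr rfl fun s hs => ?_
  rw [Finset.mem_powersetCard] at hs
  have h2 : s.piecewise (fun _ => y.1 • ((1, 0) : Plane)) (fun _ => y.2 • (0, 1)) =
      fun i => (s.piecewise (fun _ => y.1) (fun _ => y.2) i) •
        s.piecewise (fun _ => ((1, 0) : Plane)) (fun _ => (0, 1)) i := by
    ext i <;> by_cases hi : i ∈ s <;> simp [hi]
  rw [h2, q.map_smul_univ, smul_eq_mul, mul_comm, Finset.prod_piecewise]
  simp [hs.2, Finset.card_sdiff]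

/-- The coefficient of `x^a ξ^b` is a sum of at most `2^(a+b)` values of the Taylor multilinear map
on basis vectors, so the geometric bound on the norms of these maps passes to the double series. -/
theorem exists_hasCoef {f : Plane → ℝ} (hf : AnalyticAt ℝ f 0) : ∃ c, HasCoef f c := by
  obtain ⟨p, r, hp⟩ := hf
  obtain ⟨r', hr', hlt⟩ := ENNReal.lt_iff_exists_nnreal_btwn.1 (lt_of_lt_of_le hp.r_pos hp.r_le)
  have hr0 : (0 : ℝ) < r' := by exact_mod_cast hr'
  obtain ⟨C, hC, hb⟩ := p.norm_le_div_pow_of_pos_of_lt_radius (by exact_mod_cast hr') hlt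
  let d : ℕ → ℕ → ℝ := fun n a =>
    ∑ s ∈ Finset.powersetCard a (Finset.univ : Finset (Fin n)),
      p n (s.piecewise (fun _ => ((1, 0) : Plane)) (fun _ => (0, 1)))
  have hbd : ∀ n a, |d n a| ≤ C * (max 1 (2 / r')) ^ n := by
    intro n a
    have h1 : ∀ s : Finset (Fin n),
        |p n (s.piecewise (fun _ => ((1, 0) : Plane)) (fun _ => (0, 1)))| ≤ C / r' ^ n := by
      intro s
      refine ((p n).le_opNorm _).trans ?_
      have : ∏ i, ‖s.piecewise (fun _ => ((1, 0) : Plane)) (fun _ => (0, 1)) i‖ ≤ 1 := by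
        refine Finset.prod_le_one (fun _ _ => norm_nonneg _) fun i _ => ?_
        by_cases hi : i ∈ s <;> simp [hi, Prod.norm_def]
      calc _ ≤ C / r' ^ n * 1 := mul_le_mul (hb n) this (by positivity) (by positivity)
        _ = _ := mul_one _
    calc |d n a| ≤ ∑ s ∈ Finset.powersetCard a (Finset.univ : Finset (Fin n)), C / r' ^ n :=
          (Finset.abs_sum_le_sum_abs _ _).trans (Finset.sum_le_sum fun s _ => h1 s)
      _ = (n.choose a : ℝ) * (C / r' ^ n) := by simp
      _ ≤ 2 ^ n * (C / r' ^ n) := by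
          gcongr
          exact_mod_cast Nat.choose_le_two_pow n a
      _ = C * (2 / r') ^ n := by rw [div_pow]; ring
      _ ≤ _ := by gcongr; exact le_max_right _ _
  have hg : GeomBdd fun a b => d (a + b) a := ⟨C, _, hC.le, le_max_left _ _, fun a b => hbd _ _⟩
  refine ⟨_, HasCoef.of_hasSum hg ?_⟩
  filter_upwards [hg.hasSum, hp.eventually_hasSum] with y h1 h2
  suffices h : psum (fun a b => d (a + b) a) y = f y by rwa [← h]
  rw [zero_add] at h2
  rw [← Finset.HasAntidiagonal.sigmaAntidiagonalEquivProd.hasSum_iff] at h1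
  refine ((h1.sigma fun n => hasSum_fintype _).unique ?_)
  convert! h2 using 2 with n
  rw [multilinear_diag_eq]
  refine (Finset.sum_coe_sort (Finset.HasAntidiagonal.antidiagonal n)
    fun q => d (q.1 + q.2) q.1 * (y.1 ^ q.1 * y.2 ^ q.2)).trans
      (Finset.sum_congr rfl fun q hq => ?_)
  rw [Finset.HasAntidiagonal.mem_antidiagonal.1 hq]

/-! ### Directional derivatives and termwise differentiation -/

section pd
variable {E : Type*} [NormedAddCommGroup E] [NormedSpace ℝ E]

/-- The derivative of `f` in the direction `v`. -/
noncomputable def pd (v : E) (f : E → ℝ) (p : E) : ℝ := fderiv ℝ f p v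

theorem AnalyticAt.pd {f : E → ℝ} {p : E} (hf : AnalyticAt ℝ f p) (v : E) :
    AnalyticAt ℝ (pd v f) p :=
  ((ContinuousLinearMap.apply ℝ ℝ v).analyticAt _).comp hf.fderiv

theorem pd_congr {f g : E → ℝ} {p : E} (h : f =ᶠ[𝓝 p] g) (v : E) : pd v f =ᶠ[𝓝 p] pd v g :=
  h.fderiv.mono fun q hq => by simp only [ASing.pd]; rw [hq]

theorem pd_add {f g : E → ℝ} {p : E} (hf : DifferentiableAt ℝ f p) (hg : DifferentiableAt ℝ g p)
    (v : E) : pd v (fun q => f q + g q) p = pd v f p + pd v g p := by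
  simp [ASing.pd, fderiv_fun_add hf hg]

theorem pd_sub {f g : E → ℝ} {p : E} (hf : DifferentiableAt ℝ f p) (hg : DifferentiableAt ℝ g p)
    (v : E) : pd v (fun q => f q - g q) p = pd v f p - pd v g p := by
  simp [ASing.pd, fderiv_fun_sub hf hg]

theorem pd_mul {f g : E → ℝ} {p : E} (hf : DifferentiableAt ℝ f p) (hg : DifferentiableAt ℝ g p)
    (v : E) : pd v (fun q => f q * g q) p = pd v f p * g p + f p * pd v g p := by
  simp [ASing.pd, fderiv_fun_mul hf hg]; ring

theorem pd_const_mul {f : E → ℝ} {p : E} (hf : DifferentiableAt ℝ f p) (t : ℝ) (v : E) :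
    pd v (fun q => t * f q) p = t * pd v f p := by
  simp [ASing.pd, fderiv_const_mul hf]

theorem pd_pow {f : E → ℝ} {p : E} (hf : DifferentiableAt ℝ f p) (n : ℕ) (v : E) :
    pd v (fun q => f q ^ n) p = n * f p ^ (n - 1) * pd v f p := by
  simp [ASing.pd, fderiv_fun_pow n hf]

theorem pd_comm {f : E → ℝ} {p : E} (hf : AnalyticAt ℝ f p) (v w : E) :
    pd v (pd w f) p = pd w (pd v f) p := by
  have h : ∀ u z : E, pd u (pd z f) p = fderiv ℝ (fderiv ℝ f) p u z := by
    intro u z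
    have : pd z f = fun q => (ContinuousLinearMap.apply ℝ ℝ z) (fderiv ℝ f q) := rfl
    rw [this, ASing.pd, fderiv_fun_comp, ContinuousLinearMap.fderiv]
    · rfl
    · exact (ContinuousLinearMap.apply ℝ ℝ z).differentiableAt
    · exact hf.fderiv.differentiableAt
  rw [h, h]
  exact (hf.contDiffAt (n := ⊤)).isSymmSndFDerivAt (by simp) v w

/-- The chain rule for a function of two variables. -/
theorem pd_comp {f : Plane → ℝ} {X Y : E → ℝ} {p : E}
    (hf : DifferentiableAt ℝ f (X p, Y p)) (hX : DifferentiableAt ℝ X p)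
    (hY : DifferentiableAt ℝ Y p) (v : E) :
    pd v (fun q => f (X q, Y q)) p =
      pd (1, 0) f (X p, Y p) * pd v X p + pd (0, 1) f (X p, Y p) * pd v Y p := by
  have h1 := (hf.hasFDerivAt.comp p (hX.hasFDerivAt.prodMk hY.hasFDerivAt)).fderiv
  have h2 : pd v (fun q => f (X q, Y q)) p = fderiv ℝ f (X p, Y p) (pd v X p, pd v Y p) := by
    simp only [ASing.pd]
    erw [h1]; rfl
  have h3 : ((pd v X p, pd v Y p) : Plane) = pd v X p • ((1, 0) : Plane) + pd v Y p • (0, 1) := by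
    ext <;> simp
  rw [h2, h3, map_add, map_smul, map_smul]
  simp only [ASing.pd, smul_eq_mul]
  ring

end pd

/-- `∂f/∂x` -/
noncomputable abbrev dx (f : Plane → ℝ) : Plane → ℝ := pd (1, 0) f

/-- `∂f/∂ξ` -/
noncomputable abbrev dy (f : Plane → ℝ) : Plane → ℝ := pd (0, 1) f

theorem pd_fst (p v : Plane) : pd v (fun q : Plane => q.1) p = v.1 := by
  simp only [ASing.pd]; erw [fderiv_fst]; rfl

theorem pd_snd (p v : Plane) : pd v (fun q : Plane => q.2) p = v.2 := by
  simp only [ASing.pd]; erw [fderiv_snd]; rfl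

theorem GeomBdd.derivX {c : ℕ → ℕ → ℝ} (hc : GeomBdd c) :
    GeomBdd (fun a b => (a + 1) * c (a + 1) b) := by
  obtain ⟨C, R, hC, hR, h⟩ := hc
  refine ⟨C * R, 2 * R, by positivity, by linarith, fun a b => ?_⟩
  have h1 : ((a : ℝ) + 1) ≤ 2 ^ (a + b) := by
    have : a + 1 ≤ 2 ^ a := Nat.lt_two_pow_self
    have h2 : 2 ^ a ≤ 2 ^ (a + b) := Nat.pow_le_pow_right (by norm_num) (by omega)
    exact_mod_cast this.trans h2
  rw [abs_mul, abs_of_nonneg (by positivity : (0 : ℝ) ≤ (a : ℝ) + 1)]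
  calc _ ≤ 2 ^ (a + b) * (C * R ^ (a + 1 + b)) := mul_le_mul h1 (h _ _) (abs_nonneg _) (by positivity)
    _ = _ := by rw [mul_pow]; ring

/-- Exchange of the two variables. -/
theorem psum_swap (c : ℕ → ℕ → ℝ) (p : Plane) :
    psum c p = psum (fun a b => c b a) p.swap := by
  unfold psum
  rw [← (Equiv.prodComm ℕ ℕ).tsum_eq]
  refine tsum_congr fun n => ?_
  simp; left; ring

theorem GeomBdd.swap {c : ℕ → ℕ → ℝ} (hc : GeomBdd c) : GeomBdd (fun a b => c b a) := by
  obtain ⟨C, R, hC, hR, h⟩ := hc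
  exact ⟨C, R, hC, hR, fun a b => by rw [add_comm]; exact h b a⟩

/-- The series is differentiated term by term on the horizontal line through `p`. The factor `a + 1
≤ 2^a` coming from `x^(a+1)` turns the ratio `1/4` into `1/2`, which leaves a summable majorant. -/
theorem GeomBdd.dx_psum {c : ℕ → ℕ → ℝ} (hc : GeomBdd c) :
    dx (psum c) =ᶠ[𝓝 0] psum (fun a b => (a + 1) * c (a + 1) b) := by
  have han := hc.analyticAt.eventually_analyticAt
  have hsum := hc.derivX.hasSum
  obtain ⟨C, R, hC, hR, h⟩ := hc
  have hR0 : 0 < R := by linarith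
  filter_upwards [han, hsum, exists_radius (R := R) hR (P := fun p =>
    |p.1| < (4 * R)⁻¹ ∧ |p.2| < (4 * R)⁻¹) fun p h1 h2 => ⟨h1, h2⟩] with p hp hs ⟨h1, h2⟩
  have hline : HasDerivAt (fun t : ℝ => psum c (t, p.2)) (dx (psum c) p) p.1 := by
    have h3 : HasDerivAt (fun t : ℝ => ((t, p.2) : Plane)) (1, 0) p.1 :=
      (hasDerivAt_id _).prodMk (hasDerivAt_const _ _)
    exact (hp.differentiableAt.hasFDerivAt).comp_hasDerivAt_of_eq p.1 h3 rfl
  have hder := hasDerivAt_tsum_of_isPreconnected (𝕜 := ℝ) (F := ℝ)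
    (g := fun (n : ℕ × ℕ) (t : ℝ) => c n.1 n.2 * (t ^ n.1 * p.2 ^ n.2))
    (g' := fun (n : ℕ × ℕ) (t : ℝ) => c n.1 n.2 * (n.1 * t ^ (n.1 - 1) * p.2 ^ n.2))
    (u := fun n => (4 * C * R) * ((1 / 2) ^ n.1 * (1 / 2) ^ n.2)) (t := Metric.ball 0 (4 * R)⁻¹)
    (y := p.1) (y₀ := p.1) (summable_quarter.mul_left _) Metric.isOpen_ball
    (convex_ball _ _).isPreconnected
    (fun n t _ => (((hasDerivAt_pow _ _).mul_const _).const_mul _)) ?_ (by simpa using h1)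
    (summable_term hC hR h h1 h2) (by simpa using h1)
  · have he := hline.unique hder
    rw [he]
    have hinj : Function.Injective fun n : ℕ × ℕ => (n.1 + 1, n.2) := by
      rintro ⟨a, b⟩ ⟨a', b'⟩ h; simpa using h
    rw [← hs.tsum_eq, ← hinj.tsum_eq]
    · refine tsum_congr fun n => ?_
      simp; ring
    · rintro ⟨a, b⟩ hab
      rcases a with _ | a
      · simp at hab
      · exact ⟨(a, b), rfl⟩
  · rintro ⟨a, b⟩ t ht
    have ht' : |t| < (4 * R)⁻¹ := by simpa using ht
    rcases a with _ | a
    · simp; positivity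
    · have hb := term_bound (c := c) hC hR h (p := (t, p.2)) ht' h2
      simp only [Nat.add_sub_cancel, Real.norm_eq_abs, abs_mul, abs_pow]
      have e1 : |((a + 1 : ℕ) : ℝ)| ≤ 2 ^ a := by
        rw [abs_of_nonneg (by positivity)]
        exact_mod_cast (Nat.lt_two_pow_self : a < 2 ^ a)
      calc |c (a + 1) b| * (|((a + 1 : ℕ) : ℝ)| * |t| ^ a * |p.2| ^ b)
          ≤ (C * R ^ (a + 1 + b)) * (2 ^ a * (4 * R)⁻¹ ^ a * (4 * R)⁻¹ ^ b) := by
            gcongr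
            exact h _ _
        _ = C * R * ((2 * (R * (4 * R)⁻¹)) ^ a * ((R * (4 * R)⁻¹) ^ b)) := by
            generalize (4 * R)⁻¹ = z; ring
        _ = C * R * ((1 / 2) ^ a * ((1 / 4) ^ b)) := by
            have : R * (4 * R)⁻¹ = 1 / 4 := by field_simp
            rw [this, show (2 * (1 / 4) : ℝ) = 1 / 2 by norm_num]
        _ ≤ C * R * ((1 / 2) ^ a * ((1 / 2) ^ b)) := by gcongr; norm_num
        _ ≤ 4 * C * R * ((1 / 2) ^ (a + 1) * ((1 / 2) ^ b)) := by
            rw [pow_succ]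
            have : 0 ≤ C * R * ((1 / 2) ^ a * ((1 / 2) ^ b)) := by positivity
            nlinarith

theorem dy_swap (f : Plane → ℝ) (p : Plane) : dy (fun q => f q.swap) p = dx f p.swap := by
  have := (ContinuousLinearEquiv.prodComm ℝ ℝ ℝ).comp_right_fderiv (f := f) (x := p)
  simp only [ASing.pd]
  change fderiv ℝ (f ∘ (ContinuousLinearEquiv.prodComm ℝ ℝ ℝ)) p (0, 1) = _
  rw [this]; rfl

theorem GeomBdd.dy_psum {c : ℕ → ℕ → ℝ} (hc : GeomBdd c) :
    dy (psum c) =ᶠ[𝓝 0] psum (fun a b => (b + 1) * c a (b + 1)) := by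
  have h : psum c = fun p => psum (fun a b => c b a) p.swap := funext (psum_swap c)
  have h1 := hc.swap.dx_psum
  have h2 : Tendsto (Prod.swap : Plane → Plane) (𝓝 0) (𝓝 0) := continuous_swap.tendsto' _ _ rfl
  filter_upwards [h2.eventually h1] with p hp
  rw [h, dy_swap, hp, psum_swap (fun a b => (b + 1) * c a (b + 1))]

theorem GeomBdd.derivY {c : ℕ → ℕ → ℝ} (hc : GeomBdd c) :
    GeomBdd (fun a b => (b + 1) * c a (b + 1)) := hc.swap.derivX.swap

theorem HasCoef.dx {f : Plane → ℝ} {c : ℕ → ℕ → ℝ} (hf : HasCoef f c) :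
    HasCoef (dx f) (fun a b => (a + 1) * c (a + 1) b) :=
  ⟨hf.1.derivX, (pd_congr hf.2 _).trans hf.1.dx_psum⟩

theorem HasCoef.dy {f : Plane → ℝ} {c : ℕ → ℕ → ℝ} (hf : HasCoef f c) :
    HasCoef (dy f) (fun a b => (b + 1) * c a (b + 1)) :=
  ⟨hf.1.derivY, (pd_congr hf.2 _).trans hf.1.dy_psum⟩

theorem psum_zero (c : ℕ → ℕ → ℝ) : psum c 0 = c 0 0 := by
  unfold psum
  rw [tsum_eq_single (0, 0)]
  · simp
  · rintro ⟨a, b⟩ h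
    rcases a with _ | a <;> rcases b with _ | b <;> simp_all

theorem HasCoef.apply_zero {f : Plane → ℝ} {c : ℕ → ℕ → ℝ} (hf : HasCoef f c) :
    f 0 = c 0 0 := by rw [hf.2.eq_of_nhds, psum_zero]

/-! ### Taylor coefficients and potentials -/

/-- The coefficient of `x^i ξ^j` in the Taylor series of `f` at the origin. -/
noncomputable def coef (i j : ℕ) (f : Plane → ℝ) : ℝ :=
  (dx^[i] (dy^[j] f)) 0 / (i.factorial * j.factorial)

/-- The expansion is therefore unique, so identities between germs become identities between
coefficients. -/
theorem HasCoef.coef_eq {f : Plane → ℝ} {c : ℕ → ℕ → ℝ} (hf : HasCoef f c) (i j : ℕ) :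
    coef i j f = c i j := by
  have hy : ∀ j, HasCoef (ASing.dy^[j] f)
      (fun a b => ((b + j).factorial : ℝ) / b.factorial * c a (b + j)) := by
    intro j
    induction j with
    | zero =>
      refine hf.congr_coef fun a b => ?_
      simp [div_self, Nat.factorial_ne_zero]
    | succ j ih =>
      rw [Function.iterate_succ_apply']
      refine ih.dy.congr_coef fun a b => ?_
      have hb : (b.factorial : ℝ) ≠ 0 := by exact_mod_cast b.factorial_ne_zero
      rw [show b + 1 + j = b + (j + 1) by ring, Nat.factorial_succ b]
      push_cast
      field_simp
  have hx : ∀ i, HasCoef (ASing.dx^[i] (ASing.dy^[j] f))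
      (fun a b => ((a + i).factorial : ℝ) / a.factorial *
        (((b + j).factorial : ℝ) / b.factorial * c (a + i) (b + j))) := by
    intro i
    induction i with
    | zero =>
      refine (hy j).congr_coef fun a b => ?_
      simp [div_self, Nat.factorial_ne_zero]
    | succ i ih =>
      rw [Function.iterate_succ_apply']
      refine ih.dx.congr_coef fun a b => ?_
      have hb : (a.factorial : ℝ) ≠ 0 := by exact_mod_cast a.factorial_ne_zero
      rw [show a + 1 + i = a + (i + 1) by ring, Nat.factorial_succ a]
      push_cast
      field_simp
  have hi : (i.factorial : ℝ) ≠ 0 := by exact_mod_cast i.factorial_ne_zero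
  have hj : (j.factorial : ℝ) ≠ 0 := by exact_mod_cast j.factorial_ne_zero
  rw [coef, (hx i).apply_zero]
  simp
  field_simp

theorem AnalyticAt.hasCoef {f : Plane → ℝ} (hf : AnalyticAt ℝ f 0) :
    HasCoef f (fun i j => coef i j f) := by
  obtain ⟨c, hc⟩ := exists_hasCoef hf
  exact hc.congr_coef fun a b => (hc.coef_eq a b).symm

theorem HasCoef.zero : HasCoef (fun _ => 0) (fun _ _ => 0) :=
  .of_hasSum ⟨0, 1, le_rfl, le_rfl, by simp⟩ (.of_forall fun p => by simp)

theorem HasCoef.sub {f g : Plane → ℝ} {c d : ℕ → ℕ → ℝ} (hf : HasCoef f c) (hg : HasCoef g d) :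
    HasCoef (fun p => f p - g p) (fun a b => c a b - d a b) := by
  simpa [sub_eq_add_neg] using hf.add (hg.const_mul (-1))

theorem HasCoef.sum {ι : Type*} (s : Finset ι) {f : ι → Plane → ℝ} {c : ι → ℕ → ℕ → ℝ}
    (h : ∀ i ∈ s, HasCoef (f i) (c i)) :
    HasCoef (fun p => ∑ i ∈ s, f i p) (fun a b => ∑ i ∈ s, c i a b) := by
  classical
  induction s using Finset.induction_on with
  | empty => simpa using HasCoef.zero
  | insert i s hi ih =>
    simp only [Finset.sum_insert hi]
    exact (h i (Finset.mem_insert_self i s)).add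
      (ih fun j hj => h j (Finset.mem_insert_of_mem hj))

theorem HasCoef.eventuallyEq {f g : Plane → ℝ} {c : ℕ → ℕ → ℝ} (hf : HasCoef f c)
    (hg : HasCoef g c) : f =ᶠ[𝓝 0] g := hf.2.trans hg.2.symm

/-- The `m`-th Taylor coefficient at `0` of a function of one variable. -/
noncomputable def coef1 (m : ℕ) (f : ℝ → ℝ) : ℝ := coef m 0 (fun p => f p.1)

theorem analyticAt_comp_fst {f : ℝ → ℝ} (hf : AnalyticAt ℝ f 0) :
    AnalyticAt ℝ (fun p : Plane => f p.1) 0 :=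
  AnalyticAt.fun_comp (f := fun p : Plane => p.1) (by simpa using hf) analyticAt_fst

theorem hasCoef_fst {f : ℝ → ℝ} (hf : AnalyticAt ℝ f 0) :
    HasCoef (fun p => f p.1) (fun a b => if b = 0 then coef1 a f else 0) := by
  have ha := analyticAt_comp_fst hf
  have hc := AnalyticAt.hasCoef ha
  refine hc.congr_coef fun a b => ?_
  rcases b with _ | b
  · simp [coef1]
  · have h1 := hc.dy
    have h2 : dy (fun p : Plane => f p.1) =ᶠ[𝓝 0] fun _ => 0 := by
      have h3 : Tendsto (fun p : Plane => p.1) (𝓝 0) (𝓝 0) := continuous_fst.tendsto' _ _ rfl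
      filter_upwards [h3.eventually hf.eventually_analyticAt] with p hp
      have := (hp.differentiableAt.hasFDerivAt.comp p (hasFDerivAt_fst (p := p) (𝕜 := ℝ))).fderiv
      simp only [ASing.pd]
      erw [this]
      simp
    have h4 := (h1.congr h2).coef_eq a b
    rw [HasCoef.zero.coef_eq] at h4
    have h5 : ((b : ℝ) + 1) ≠ 0 := by positivity
    simpa [h5] using h4.symm

theorem hasSum_coef1 {f : ℝ → ℝ} (hf : AnalyticAt ℝ f 0) :
    ∀ᶠ t in 𝓝 (0 : ℝ), HasSum (fun m => coef1 m f * t ^ m) (f t) := by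
  have h := (hasCoef_fst hf).hasSum
  have h3 : Tendsto (fun t : ℝ => ((t, 0) : Plane)) (𝓝 0) (𝓝 0) :=
    (by fun_prop : Continuous fun t : ℝ => ((t, 0) : Plane)).tendsto' _ _ rfl
  filter_upwards [h3.eventually h] with t ht
  have hinj : Function.Injective fun m : ℕ => (m, 0) := fun a b h => by simpa using h
  rw [← hinj.hasSum_iff] at ht
  · convert! ht using 2 with m
    simp
  · rintro ⟨a, b⟩ hab
    have : b ≠ 0 := by rintro rfl; exact hab ⟨a, rfl⟩
    simp [this]

theorem eventuallyEq_of_coef1 {f g : ℝ → ℝ} (hf : AnalyticAt ℝ f 0) (hg : AnalyticAt ℝ g 0)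
    (h : ∀ m, coef1 m f = coef1 m g) : f =ᶠ[𝓝 0] g := by
  filter_upwards [hasSum_coef1 hf, hasSum_coef1 hg] with t h1 h2
  simp only [h] at h1
  exact h1.unique h2

/-- The function of one variable with Taylor coefficients `a`. -/
noncomputable def psum1 (a : ℕ → ℝ) (t : ℝ) : ℝ := psum (fun m b => if b = 0 then a m else 0) (t, 0)

theorem hasCoef_psum1 {a : ℕ → ℝ} (ha : GeomBdd (fun m b => if b = 0 then a m else 0)) :
    HasCoef (fun p => psum1 a p.1) (fun m b => if b = 0 then a m else 0) := by
  refine ⟨ha, .of_forall fun p => ?_⟩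
  simp only [psum1, psum]
  refine tsum_congr fun n => ?_
  rcases n with ⟨m, _ | b⟩ <;> simp

theorem analyticAt_psum1 {a : ℕ → ℝ} (ha : GeomBdd (fun m b => if b = 0 then a m else 0)) :
    AnalyticAt ℝ (psum1 a) 0 :=
  AnalyticAt.fun_comp (g := psum _) (f := fun t : ℝ => ((t, 0) : Plane))
    ha.analyticAt (analyticAt_id.prod analyticAt_const)

theorem coef1_psum1 {a : ℕ → ℝ} (ha : GeomBdd (fun m b => if b = 0 then a m else 0)) (m : ℕ) :
    coef1 m (psum1 a) = a m := by
  rw [coef1, (hasCoef_psum1 ha).coef_eq]; simp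

theorem hasCoef_comp_pow {f : ℝ → ℝ} (hf : AnalyticAt ℝ f 0) {k : ℕ} (hk : 0 < k) (i : ℕ) :
    HasCoef (fun p => p.1 ^ i * f (p.1 ^ k))
      (fun n b => if b = 0 ∧ i ≤ n ∧ k ∣ n - i then coef1 ((n - i) / k) f else 0) := by
  refine .of_hasSum ?_ ?_
  · obtain ⟨C, R, hC, hR, h⟩ := (hasCoef_fst hf).1
    refine ⟨C, R, hC, hR, fun n b => ?_⟩
    dsimp only
    split_ifs with hn
    · have h1 := h ((n - i) / k) 0
      simp only [if_true] at h1
      refine h1.trans (mul_le_mul_of_nonneg_left (pow_le_pow_right₀ hR ?_) hC)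
      have := Nat.div_le_self (n - i) k
      omega
    · simp; positivity
  · have h3 : Tendsto (fun p : Plane => p.1 ^ k) (𝓝 0) (𝓝 0) :=
      (by fun_prop : Continuous fun p : Plane => p.1 ^ k).tendsto' _ _ (by simp [hk.ne'])
    filter_upwards [h3.eventually (hasSum_coef1 hf)] with p hp
    have hinj : Function.Injective fun m : ℕ => (i + k * m, 0) := fun a b h => by
      simpa [hk.ne'] using h
    rw [← hinj.hasSum_iff]
    · convert! hp.mul_left (p.1 ^ i) using 2 with m
      simp [hk, pow_add, pow_mul]; ring
    · rintro ⟨n, b⟩ hn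
      have : ¬ (b = 0 ∧ i ≤ n ∧ k ∣ n - i) := by
        rintro ⟨rfl, h1, m, h2⟩
        exact hn ⟨m, by simp; omega⟩
      simp only [if_neg this, zero_mul]

/-- Division with remainder `n = i + k m` assigns to each exponent prime to the condition `k ∣ n`
exactly one coefficient of one `f_i`. A potential is thus an arbitrary series in `x` without
exponents divisible by `k`, and it determines the germs `f_i`. -/
theorem hasCoef_potential {k : ℕ} (hk : 0 < k) {f : ℕ → ℝ → ℝ}
    (hf : ∀ i ∈ Finset.Ico 1 k, AnalyticAt ℝ (f i) 0) :
    HasCoef (fun p => potential k f p.1)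
      (fun n b => if b = 0 ∧ n % k ≠ 0 then coef1 (n / k) (f (n % k)) else 0) := by
  refine (HasCoef.sum _ fun i hi => hasCoef_comp_pow (hf i hi) hk i).congr_coef fun n b => ?_
  have hmod : ∀ i ∈ Finset.Ico 1 k, (i ≤ n ∧ k ∣ n - i) ↔ i = n % k := by
    intro i hi
    rw [Finset.mem_Ico] at hi
    constructor
    · rintro ⟨h1, m, h2⟩
      have : n = i + k * m := by omega
      rw [this, Nat.add_mul_mod_self_left, Nat.mod_eq_of_lt hi.2]
    · rintro h
      have h1 := Nat.mod_add_div n k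
      refine ⟨by rw [h]; exact Nat.mod_le _ _, n / k, by rw [h]; omega⟩
  by_cases hb : b = 0 ∧ n % k ≠ 0
  · have hmem : n % k ∈ Finset.Ico 1 k :=
      Finset.mem_Ico.2 ⟨Nat.one_le_iff_ne_zero.2 hb.2, Nat.mod_lt _ hk⟩
    rw [if_pos hb, Finset.sum_eq_single_of_mem _ hmem]
    · rw [if_pos ⟨hb.1, (hmod _ hmem).2 rfl⟩]
      congr 1
      have h1 := Nat.mod_add_div n k
      have h2 : n - n % k = k * (n / k) := by omega
      rw [h2, Nat.mul_div_cancel_left _ hk]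
    · intro i hi hne
      rw [if_neg]
      rintro ⟨_, h⟩
      exact hne ((hmod i hi).1 h)
  · rw [if_neg hb]
    refine Finset.sum_eq_zero fun i hi => ?_
    rw [if_neg]
    rintro ⟨h0, h⟩
    have := (hmod i hi).1 h
    rw [Finset.mem_Ico] at hi
    exact hb ⟨h0, by omega⟩

/-! ### Solving the bracket equation with convergent series -/

/-- The bracket `H_x η_ξ - H_ξ η_x` with the model Hamiltonian `H = ξ² + ε x^k`. -/
noncomputable def bracket (k : ℕ) (ε : ℝ) (η : Plane → ℝ) (p : Plane) : ℝ :=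
  ε * k * p.1 ^ (k - 1) * dy η p - 2 * p.2 * dx η p

theorem HasCoef.bracket {η : Plane → ℝ} {c : ℕ → ℕ → ℝ} (h : HasCoef η c) (k : ℕ) (ε : ℝ) :
    HasCoef (bracket k ε η) (fun a b =>
      ε * k * (if a < k - 1 then 0 else (b + 1) * c (a - (k - 1)) (b + 1)) -
        2 * (if b = 0 then 0 else (a + 1) * c (a + 1) (b - 1))) := by
  refine (((h.dy.mulX_pow (k - 1)).const_mul (ε * k)).sub (h.dx.mulY.const_mul 2)).congr
    (.of_forall fun p => ?_)
  simp only [ASing.bracket]; ring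

section solve
variable (k : ℕ) (ε : ℝ) (h : ℕ → ℕ → ℝ)

/-- Solution of the bracket equation by recursion on the power of `x`. -/
noncomputable def solveX (a j : ℕ) : ℝ :=
  -- When reached from `solveCoef`, the index `a = 0` occurs only with `j` even. These coefficients
  -- are free because the bracket kills functions of `H`; they are normalised to zero.
  if a = 0 then 0 else
    ((if 0 < k ∧ k ≤ a then ε * k * (j + 2) * solveX (a - k) (j + 2) else 0) - h (a - 1) (j + 1)) /
      (2 * a)
termination_by a

/-- Solution of the bracket equation by recursion on the power of `ξ`, which is `2 q + 1`. -/
noncomputable def solveY (a : ℕ) : ℕ → ℝ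
  | 0 => h (a + k - 1) 0 / (ε * k)
  | q + 1 => (h (a + k - 1) (2 * q + 2) + 2 * (a + k) * solveY (a + k) q) / (ε * k * (2 * q + 3))

/-- Coefficients of a solution of the bracket equation. -/
noncomputable def solveCoef (a j : ℕ) : ℝ :=
  -- The equation at `(a, b)` links the unknowns at `(a + 1, b - 1)` and `(a + 1 - k, b + 1)`, so
  -- the unknowns split into chains under `(a, j) ↦ (a - k, j + 2)`. If `j` is odd and `k ∣ a`, the
  -- equation at `b = 0` has to hold, and it fixes the member of the chain with `j = 1`; the chain
  -- is solved upwards in `j = 2q + 1`. Every other chain is solved upwards in `a`.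
  if Odd j ∧ k ∣ a then solveY k ε h a (j / 2) else solveX k ε h a j

variable {k ε h}

/-- One step of either recursion multiplies by at most `L`, adds a term of size at most `A` and
divides by at least `q + 1`. After `q` steps this gives `L^q / q!`, the extra factor `q + 1`
accounting for the accumulated source terms. -/
theorem ratio_bound {A L x u v M : ℝ} {q : ℕ} (hA : 0 ≤ A) (hL : (q + 1 : ℝ) ≤ L)
    (hx : |x| ≤ A * (q + 1) * (L ^ q / q.factorial)) (hv : |v| ≤ L) (hu : |u| ≤ A)
    (hM : (q + 1 : ℝ) ≤ M) :
    (|u| + |v| * |x|) / M ≤ A * ((q + 1 : ℕ) + 1) * (L ^ (q + 1) / (q + 1).factorial) := by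
  have hq : (0 : ℝ) < q + 1 := by positivity
  have hf : (0 : ℝ) < q.factorial := by exact_mod_cast q.factorial_pos
  have h1 : (1 : ℝ) ≤ L ^ q / q.factorial := by
    rw [le_div_iff₀ hf, one_mul]
    have h2 : (q.factorial : ℝ) ≤ (q : ℝ) ^ q := by exact_mod_cast q.factorial_le_pow
    refine h2.trans (pow_le_pow_left₀ (by positivity) (by linarith) _)
  set B := L ^ q / q.factorial with hB
  have hL0 : 0 < L := by linarith
  calc (|u| + |v| * |x|) / M ≤ (|u| + |v| * |x|) / (q + 1) := by gcongr
    _ ≤ (A + L * (A * (q + 1) * B)) / (q + 1) := by gcongr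
    _ = A / (q + 1) * 1 + L * A * B := by field_simp
    _ ≤ A / (q + 1) * (L * B) + L * A * B := by
        gcongr
        nlinarith
    _ = A * ((q + 1 : ℕ) + 1) * (L / (q + 1) * B) := by push_cast; field_simp; ring
    _ = _ := by
        rw [hB, Nat.factorial_succ, pow_succ]
        push_cast
        field_simp

/-- The weight `2a + kj` is constant along a chain, so one `L` bounds every index met by the
recursion and also the multipliers `k (j + 2)`. The number of steps is `a / k`. -/
theorem abs_solveX_le (hk : 2 ≤ k) (hε : |ε| = 1) {A : ℝ} {L : ℕ}
    (hA : 0 ≤ A) (hh : ∀ a b, a + b ≤ L → |h a b| ≤ A) (q : ℕ) :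
    ∀ a j : ℕ, a / k = q → 2 * a + k * j + 2 * k ≤ L →
      |solveX k ε h a j| ≤ A * (q + 1) * ((L : ℝ) ^ q / q.factorial) := by
  induction q with
  | zero =>
    intro a j ha hL
    have hak : ¬ k ≤ a := by
      intro h'; have := Nat.div_pos h' (by omega); omega
    rw [solveX]
    split_ifs with h0 h1
    · simp [hA]
    · omega
    · have ha1 : (1 : ℝ) ≤ 2 * a := by
        have : 1 ≤ 2 * a := by omega
        exact_mod_cast this
      have hb : |h (a - 1) (j + 1)| ≤ A := hh _ _ (by nlinarith [Nat.sub_le a 1])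
      rw [zero_sub, abs_div, abs_neg, abs_of_pos (by linarith : (0 : ℝ) < 2 * a)]
      simp
      exact (div_le_self (abs_nonneg _) ha1).trans hb
  | succ q ih =>
    intro a j ha hL
    have hak : k ≤ a := by
      by_contra h'
      rw [Nat.div_eq_of_lt (by omega)] at ha; omega
    have hq : (q + 1) * k ≤ a := by rw [← ha]; exact Nat.div_mul_le_self a k
    have e1 : (a - k) / k = q := by
      obtain ⟨b, rfl⟩ := Nat.exists_eq_add_of_le hak
      rw [add_comm, Nat.add_div_right _ (by omega)] at ha
      rw [Nat.add_sub_cancel_left]; omega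
    have h1 := ih (a - k) (j + 2) e1 (by
      obtain ⟨b, rfl⟩ := Nat.exists_eq_add_of_le hak
      rw [Nat.add_sub_cancel_left]; nlinarith)
    rw [solveX, if_neg (by omega), if_pos ⟨by omega, hak⟩]
    have hb : |h (a - 1) (j + 1)| ≤ A := hh _ _ (by nlinarith [Nat.sub_le a 1])
    have ha0 : (0 : ℝ) < 2 * a := by
      have : 0 < 2 * a := by omega
      exact_mod_cast this
    have hqa : q + 1 ≤ a := by nlinarith
    have hqL : ((q : ℝ) + 1) ≤ L := by
      have : q + 1 ≤ L := by nlinarith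
      exact_mod_cast this
    have hqM : ((q : ℝ) + 1) ≤ 2 * a := by
      have : q + 1 ≤ 2 * a := by omega
      exact_mod_cast this
    refine le_trans ?_ (ratio_bound hA hqL h1 (v := ε * k * (j + 2)) ?_ hb hqM)
    · rw [abs_div, abs_of_pos ha0]
      gcongr
      refine (abs_sub _ _).trans ?_
      rw [abs_mul, add_comm]
    · rw [abs_mul, abs_mul, hε, one_mul, abs_of_nonneg (by positivity : (0:ℝ) ≤ k),
        abs_of_nonneg (by positivity : (0:ℝ) ≤ (j : ℝ) + 2)]
      have : k * (j + 2) ≤ L := by nlinarith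
      exact_mod_cast this

theorem abs_solveY_le (hk : 2 ≤ k) (hε : |ε| = 1) {A : ℝ} {L : ℕ}
    (hA : 0 ≤ A) (hh : ∀ a b, a + b ≤ L → |h a b| ≤ A) (q : ℕ) :
    ∀ a : ℕ, 2 * a + k * (2 * q + 1) + 2 * k ≤ L →
      |solveY k ε h a q| ≤ A * (q + 1) * ((L : ℝ) ^ q / q.factorial) := by
  have hk1 : (1 : ℝ) ≤ k := by
    have : 1 ≤ k := by omega
    exact_mod_cast this
  induction q with
  | zero =>
    intro a hL
    have hb : |h (a + k - 1) 0| ≤ A := hh _ _ (by omega)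
    rw [solveY, abs_div, abs_mul, hε, one_mul, abs_of_nonneg (by positivity : (0:ℝ) ≤ k)]
    simp
    exact (div_le_self (abs_nonneg _) hk1).trans hb
  | succ q ih =>
    intro a hL
    have h1 := ih (a + k) (by nlinarith)
    rw [solveY]
    have hb : |h (a + k - 1) (2 * q + 2)| ≤ A := hh _ _ (by
      have : a + k - 1 ≤ a + k := Nat.sub_le _ _
      nlinarith)
    have hqL : ((q : ℝ) + 1) ≤ L := by
      have : q + 1 ≤ L := by nlinarith
      exact_mod_cast this
    have hqM : ((q : ℝ) + 1) ≤ k * (2 * q + 3) := by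
      have : q + 1 ≤ k * (2 * q + 3) := by nlinarith
      exact_mod_cast this
    refine le_trans ?_ (ratio_bound hA hqL h1 (v := 2 * (a + k)) ?_ hb hqM)
    · rw [abs_div, abs_mul, abs_mul ε, hε, one_mul, abs_of_nonneg (by positivity : (0:ℝ) ≤ k),
        abs_of_nonneg (by positivity : (0:ℝ) ≤ 2 * (q : ℝ) + 3)]
      gcongr
      refine (abs_add_le _ _).trans ?_
      rw [abs_mul]
    · rw [abs_of_nonneg (by positivity)]
      have : 2 * (a + k) ≤ L := by nlinarith
      exact_mod_cast this

/-- Both `L^q / q!` and `q + 1` are at most `e^L`, so the solution is bounded by `C ρ^L` with `ρ = R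
e²`. As `k ≥ 2`, the weight satisfies `L ≤ 2k + k (a + j)`, and the bound is geometric in `a + j`.
-/
theorem GeomBdd.solveCoef (hk : 2 ≤ k) (hε : |ε| = 1) (hh : GeomBdd h) :
    GeomBdd (solveCoef k ε h) := by
  obtain ⟨C, R, hC, hR, hb⟩ := hh
  have he : (1 : ℝ) ≤ Real.exp 1 := Real.one_le_exp zero_le_one
  set ρ := R * (Real.exp 1 * Real.exp 1) with hρ
  have hρ1 : 1 ≤ ρ := by nlinarith
  refine ⟨C * ρ ^ (2 * k), ρ ^ k, by positivity, one_le_pow₀ hρ1, fun a j => ?_⟩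
  set L := 2 * a + k * j + 2 * k with hL
  have hA : 0 ≤ C * R ^ L := by positivity
  have hbA : ∀ a b, a + b ≤ L → |h a b| ≤ C * R ^ L := fun a b hab =>
    (hb a b).trans (mul_le_mul_of_nonneg_left (pow_le_pow_right₀ hR hab) hC)
  obtain ⟨q, hq, hle⟩ : ∃ q : ℕ, q ≤ L ∧ |ASing.solveCoef k ε h a j| ≤
      C * R ^ L * (q + 1) * ((L : ℝ) ^ q / q.factorial) := by
    unfold ASing.solveCoef
    split_ifs with hc
    · obtain ⟨m, hm⟩ := hc.1
      refine ⟨j / 2, ?_, abs_solveY_le hk hε hA hbA _ a ?_⟩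
      · have := Nat.div_le_self j 2
        nlinarith
      · have : 2 * (j / 2) + 1 = j := by omega
        rw [this]
    · refine ⟨a / k, ?_, abs_solveX_le hk hε hA hbA _ a j rfl le_rfl⟩
      have := Nat.div_le_self a k
      nlinarith
  have e1 : (L : ℝ) ^ q / q.factorial ≤ Real.exp 1 ^ L := by
    rw [← Real.exp_nat_mul, mul_one]
    exact Real.pow_div_factorial_le_exp _ (by positivity) _
  have e2 : (q + 1 : ℝ) ≤ Real.exp 1 ^ L := by
    rw [← Real.exp_nat_mul, mul_one]
    have : (q : ℝ) ≤ L := by exact_mod_cast hq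
    have := Real.add_one_le_exp (L : ℝ)
    linarith
  calc _ ≤ C * R ^ L * (q + 1) * ((L : ℝ) ^ q / q.factorial) := hle
    _ ≤ C * R ^ L * Real.exp 1 ^ L * Real.exp 1 ^ L := by gcongr
    _ = C * ρ ^ L := by rw [hρ, mul_pow, mul_pow]; ring
    _ ≤ C * ρ ^ (2 * k + k * (a + j)) := by gcongr; nlinarith
    _ = _ := by rw [pow_add, pow_mul]; ring

/-- The only equations left out are those at `x^a` with `k ∤ a + 1`: there the chain is already
determined from its other end. These monomials are the ones that survive in the normal form. -/
theorem bracket_solveCoef (hk : 2 ≤ k) (hε : ε ≠ 0) (a b : ℕ) (hab : b ≠ 0 ∨ k ∣ a + 1) :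
    ε * k * (if a < k - 1 then 0 else (b + 1) * solveCoef k ε h (a - (k - 1)) (b + 1)) -
        2 * (if b = 0 then 0 else (a + 1) * solveCoef k ε h (a + 1) (b - 1)) = h a b := by
  have hk0 : (k : ℝ) ≠ 0 := by
    have : k ≠ 0 := by omega
    exact_mod_cast this
  have ha0 : (a + 1 : ℝ) ≠ 0 := by positivity
  by_cases hc : k ∣ a + 1 ∧ ¬ Odd b
  · have hle : k ≤ a + 1 := Nat.le_of_dvd (by omega) hc.1
    obtain ⟨c, hc'⟩ := Nat.exists_eq_add_of_le hle
    have ha : a = c + k - 1 := by omega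
    have hkc : k ∣ c := by
      have := hc.1; rw [hc'] at this; exact (Nat.dvd_add_right (dvd_refl k)).1 this
    obtain ⟨q, rfl⟩ := Nat.not_odd_iff_even.1 hc.2
    have e1 : a - (k - 1) = c := by omega
    have e2 : a + 1 = c + k := by omega
    have e3 : (a + 1 : ℝ) = c + k := by exact_mod_cast e2
    rw [if_neg (by omega), e1, e2, e3, solveCoef, if_pos ⟨by use q; ring, hkc⟩]
    rcases q with _ | q
    · simp [solveY]
      rw [← ha]; field_simp
    · have e4 : (q + 1 + (q + 1) + 1) / 2 = q + 1 := by omega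
      have e5 : (q + 1 + (q + 1) - 1) = 2 * q + 1 := by omega
      have e6 : (2 * q + 1) / 2 = q := by omega
      have e7 : solveCoef k ε h (c + k) (2 * q + 1) = solveY k ε h (c + k) q := by
        rw [solveCoef, if_pos ⟨⟨q, rfl⟩, hkc.add (dvd_refl k)⟩, e6]
      have e8 : ¬ (q + 1 + (q + 1) = 0) := by omega
      rw [e4, e5, e7, solveY, if_neg e8, ← ha, show q + 1 + (q + 1) = 2 * q + 2 by ring]
      have : (2 * q + 3 : ℝ) ≠ 0 := by positivity
      push_cast
      field_simp
      ring
  · have hb : b ≠ 0 := by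
      rcases hab with hb | hb
      · exact hb
      · rintro rfl; exact hc ⟨hb, by simp⟩
    have h1 : ¬ (Odd (b - 1) ∧ k ∣ a + 1) := by
      rintro ⟨h1, h2⟩
      refine hc ⟨h2, ?_⟩
      rw [Nat.odd_iff] at *; omega
    have e1 : solveCoef k ε h (a + 1) (b - 1) = solveX k ε h (a + 1) (b - 1) := if_neg h1
    have e2 : k ≤ a + 1 → solveCoef k ε h (a - (k - 1)) (b + 1) = solveX k ε h (a + 1 - k) (b + 1) := by
      intro hle
      rw [solveCoef, if_neg, show a - (k - 1) = a + 1 - k by omega]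
      rintro ⟨h2, h3⟩
      refine h1 ⟨by rw [Nat.odd_iff] at *; omega, ?_⟩
      have := h3.add (dvd_refl k)
      rwa [show a - (k - 1) + k = a + 1 by omega] at this
    have e3 : ((b - 1 : ℕ) : ℝ) + 2 = b + 1 := by
      have : b - 1 + 2 = b + 1 := by omega
      exact_mod_cast this
    have e4 : solveX k ε h (a + 1) (b - 1) = ((if 0 < k ∧ k ≤ a + 1 then
        ε * k * (b + 1) * solveX k ε h (a + 1 - k) (b + 1) else 0) - h a b) / (2 * (a + 1)) := by
      rw [solveX, if_neg (Nat.succ_ne_zero a), e3, show b - 1 + 2 = b + 1 by omega,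
        show b - 1 + 1 = b by omega, Nat.add_sub_cancel]
      push_cast
      rfl
    rw [if_neg hb, e1, e4]
    by_cases hle : k ≤ a + 1
    · have e5 : ¬ a < k - 1 := by omega
      have e6 : 0 < k ∧ k ≤ a + 1 := ⟨by omega, hle⟩
      rw [if_neg e5, if_pos e6, e2 hle]
      field_simp; ring
    · have e5 : a < k - 1 := by omega
      have e6 : ¬ (0 < k ∧ k ≤ a + 1) := fun h => hle h.2
      rw [if_pos e5, if_neg e6]
      field_simp; ring

end solve

/-- Every analytic function is the derivative of a potential up to a bracket. -/
theorem exists_potential {k : ℕ} (hk : 2 ≤ k) {ε : ℝ} (hε : |ε| = 1) {h : Plane → ℝ}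
    (hh : AnalyticAt ℝ h 0) :
    ∃ f : ℕ → ℝ → ℝ, (∀ i ∈ Finset.Ico 1 k, AnalyticAt ℝ (f i) 0) ∧
      ∃ η : Plane → ℝ, AnalyticAt ℝ η 0 ∧
        ∀ᶠ p in 𝓝 (0 : Plane), h p = dx (fun q => potential k f q.1) p + bracket k ε η p := by
  have hk0 : 0 < k := by omega
  have hε0 : ε ≠ 0 := by rintro rfl; simp at hε
  obtain ⟨c, hc⟩ := exists_hasCoef hh
  set η := psum (solveCoef k ε c) with hη
  have hηc : HasCoef η (solveCoef k ε c) := ⟨hc.1.solveCoef hk hε, .rfl⟩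
  have hw := hc.sub (hηc.bracket k ε)
  set w := fun a b => c a b - (ε * k * (if a < k - 1 then 0 else
    (b + 1) * solveCoef k ε c (a - (k - 1)) (b + 1)) -
        2 * (if b = 0 then 0 else (a + 1) * solveCoef k ε c (a + 1) (b - 1))) with hwdef
  -- The remainder `w` is a series in `x` alone without exponents `a` such that `k ∣ a + 1`. Its
  -- termwise primitive, with coefficient `w a 0 / (a + 1)` at `x^(a+1)`, is a potential; writing `a
  -- + 1 = i + k m` gives the `f_i`.
  have hw0 : ∀ a b, b ≠ 0 ∨ k ∣ a + 1 → w a b = 0 := fun a b hab => by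
    simp only [hwdef]
    rw [bracket_solveCoef hk hε0 a b hab, sub_self]
  have hgeom : ∀ i, 1 ≤ i → GeomBdd (fun m b => if b = 0 then w (i - 1 + k * m) 0 / (i + k * m) else 0) := by
    intro i hi
    obtain ⟨C, R, hC, hR, hb⟩ := hw.1
    refine ⟨C * R ^ i, R ^ k, by positivity, one_le_pow₀ hR, fun m b => ?_⟩
    dsimp only
    split_ifs with hb0
    · have h1 : (1 : ℝ) ≤ i + k * m := by
        have : 1 ≤ i + k * m := by omega
        exact_mod_cast this
      rw [abs_div, abs_of_pos (by linarith : (0 : ℝ) < i + k * m)]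
      refine (div_le_self (abs_nonneg _) h1).trans ((hb _ _).trans ?_)
      subst hb0
      rw [mul_assoc, ← pow_mul, ← pow_add]
      exact mul_le_mul_of_nonneg_left (pow_le_pow_right₀ hR (by simp)) hC
    · simp; positivity
  refine ⟨fun i => psum1 fun m => w (i - 1 + k * m) 0 / (i + k * m), fun i hi =>
    analyticAt_psum1 (hgeom i (Finset.mem_Ico.1 hi).1), η, hηc.analyticAt, ?_⟩
  have hp := (hasCoef_potential hk0 (f := fun i => psum1 fun m => w (i - 1 + k * m) 0 / (i + k * m))
    fun i hi => analyticAt_psum1 (hgeom i (Finset.mem_Ico.1 hi).1)).dx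
  have heq := hw.eventuallyEq (hp.congr_coef fun a b => ?_)
  · filter_upwards [heq] with p hp
    rw [← hp]; ring
  · by_cases hab : b ≠ 0 ∨ k ∣ a + 1
    · rw [hw0 a b hab, if_neg, mul_zero]
      rintro ⟨h1, h2⟩
      rcases hab with h | h
      · exact h h1
      · exact h2 (Nat.mod_eq_zero_of_dvd h)
    · push Not at hab
      obtain ⟨rfl, h2⟩ := hab
      have h3 : (a + 1) % k ≠ 0 := fun h' => h2 (Nat.dvd_of_mod_eq_zero h')
      have h4 := Nat.mod_add_div (a + 1) k
      rw [if_pos ⟨rfl, h3⟩, coef1_psum1 (hgeom _ (by omega)),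
        show (a + 1) % k - 1 + k * ((a + 1) / k) = a by omega]
      have h5 : (((a + 1) % k : ℕ) : ℝ) + k * ((a + 1) / k : ℕ) = a + 1 := by exact_mod_cast h4
      rw [h5]
      have : (a + 1 : ℝ) ≠ 0 := by positivity
      field_simp

theorem pd_const {E : Type*} [NormedAddCommGroup E] [NormedSpace ℝ E] (t : ℝ) (p v : E) :
    pd v (fun _ => t) p = 0 := by simp [ASing.pd]

/-! ### Residues: linear functionals vanishing on brackets -/

section residue
variable (k : ℕ) (ε : ℝ) (n : ℕ)

/-- The monomial `x^(n - k b) ξ^(2 b)` is congruent to `residueCoef k ε n b * x^n` modulo brackets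
with the model Hamiltonian. -/
noncomputable def residueCoef : ℕ → ℝ
  | 0 => 1
  | b + 1 => ε * k * (2 * b + 1) / (2 * (n - k * (b + 1) + 1)) * residueCoef b

/-- The coefficient of `x^n` in the reduction of `h` modulo brackets. -/
noncomputable def residue (h : Plane → ℝ) : ℝ :=
  ∑ b ∈ Finset.range (n / k + 1), residueCoef k ε n b * coef (n - k * b) (2 * b) h

variable {k ε n}

theorem HasCoef.residue_eq {h : Plane → ℝ} {c : ℕ → ℕ → ℝ} (hc : HasCoef h c) :
    residue k ε n h =
      ∑ b ∈ Finset.range (n / k + 1), residueCoef k ε n b * c (n - k * b) (2 * b) := by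
  simp only [residue, hc.coef_eq]

theorem residue_congr {f g : Plane → ℝ} (h : f =ᶠ[𝓝 0] g) (hf : AnalyticAt ℝ f 0) :
    residue k ε n f = residue k ε n g := by
  rw [(AnalyticAt.hasCoef hf).residue_eq, ((AnalyticAt.hasCoef hf).congr h).residue_eq]

theorem residue_add {f g : Plane → ℝ} (hf : AnalyticAt ℝ f 0) (hg : AnalyticAt ℝ g 0) :
    residue k ε n (fun p => f p + g p) = residue k ε n f + residue k ε n g := by
  rw [((AnalyticAt.hasCoef hf).add (AnalyticAt.hasCoef hg)).residue_eq, residue, residue,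
    ← Finset.sum_add_distrib]
  exact Finset.sum_congr rfl fun b _ => by ring

theorem residue_const_mul {f : Plane → ℝ} (hf : AnalyticAt ℝ f 0) (t : ℝ) :
    residue k ε n (fun p => t * f p) = t * residue k ε n f := by
  rw [((AnalyticAt.hasCoef hf).const_mul t).residue_eq, residue, Finset.mul_sum]
  exact Finset.sum_congr rfl fun b _ => by ring

theorem residue_sub {f g : Plane → ℝ} (hf : AnalyticAt ℝ f 0) (hg : AnalyticAt ℝ g 0) :
    residue k ε n (fun p => f p - g p) = residue k ε n f - residue k ε n g := by
  rw [((AnalyticAt.hasCoef hf).sub (AnalyticAt.hasCoef hg)).residue_eq, residue, residue,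
    ← Finset.sum_sub_distrib]
  exact Finset.sum_congr rfl fun b _ => by ring

theorem cast_index {b : ℕ} (hb : b ∈ Finset.range (n / k + 1)) :
    k * b ≤ n ∧ ((n - k * b : ℕ) : ℝ) = n - k * b := by
  have h1 : k * b ≤ n := by
    rw [Finset.mem_range] at hb
    have h2 := Nat.mul_div_le n k
    exact (Nat.mul_le_mul_left k (by omega)).trans h2
  refine ⟨h1, ?_⟩
  push_cast [h1]
  ring

/-- The residue vanishes on `dα` if `dH ∧ α = 0`. -/
theorem residue_eq_zero (hk : 2 ≤ k) (hε : ε ≠ 0) (hn : ¬ k ∣ n + 1) {f g : Plane → ℝ}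
    (hf : AnalyticAt ℝ f 0) (hg : AnalyticAt ℝ g 0)
    (h : ∀ᶠ p in 𝓝 (0 : Plane), ε * k * p.1 ^ (k - 1) * g p = 2 * (p.2 * f p)) :
    residue k ε n (fun p => dx g p - dy f p) = 0 := by
  have hF := AnalyticAt.hasCoef hf
  have hG := AnalyticAt.hasCoef hg
  have hfg : ∀ i j, ε * k * (if i < k - 1 then 0 else coef (i - (k - 1)) j g) =
      2 * shiftY (fun i j => coef i j f) i j := by
    intro i j
    refine (((hG.mulX_pow (k - 1)).const_mul (ε * k)).coef_eq i j).symm.trans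
      (Eq.trans ?_ ((hF.mulY.const_mul 2).coef_eq i j))
    refine (((hF.mulY.const_mul 2).congr ?_).coef_eq i j).trans
      ((hF.mulY.const_mul 2).coef_eq i j).symm
    filter_upwards [h] with p hp
    rw [← hp]; ring
  have hf1 : ∀ i j, 2 * coef i j f =
      ε * k * (if i < k - 1 then 0 else coef (i - (k - 1)) (j + 1) g) := by
    intro i j
    rw [hfg i (j + 1)]; simp [shiftY]
  have hg0 : ε * k * coef (n + 1) 0 g = 0 := by
    have := hfg (n + 1 + (k - 1)) 0
    simpa [shiftY] using this
  set M := n / k with hM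
  -- Comparing coefficients in `dH ∧ α = 0` expresses each coefficient of `f` in the sum through the
  -- coefficient of `g` belonging to `b + 1`, so the sum telescopes. What remains is `t 0`, a
  -- multiple of the coefficient of `x^(n+1)` in `g`, which is zero by `hg0`.
  set t : ℕ → ℝ := fun b =>
    residueCoef k ε n b * (n - k * b + 1) * coef (n - k * b + 1) (2 * b) g with ht
  have hterm : ∀ b ∈ Finset.range (M + 1), residueCoef k ε n b *
      (((n - k * b : ℕ) + 1) * coef (n - k * b + 1) (2 * b) g -
        ((2 * b : ℕ) + 1) * coef (n - k * b) (2 * b + 1) f) =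
      t b - (if b < M then t (b + 1) else 0) := by
    intro b hb
    obtain ⟨h1, h2⟩ := cast_index hb
    have h3 := hf1 (n - k * b) (2 * b + 1)
    -- Here `k ∤ n + 1` matters: it excludes `n - k b = k - 1`, so the coefficient of `f` at the
    -- last index `b = M` vanishes and the telescoping stops there.
    have hlt : b < M ↔ ¬ (n - k * b < k - 1) := by
      rw [hM, Nat.lt_iff_add_one_le, Nat.le_div_iff_mul_le (by omega), mul_comm, mul_add, mul_one]
      constructor
      · omega
      · intro h4
        by_contra h5
        refine hn ⟨b + 1, ?_⟩
        rw [mul_add, mul_one]; omega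
    simp only [ht]
    rw [h2]
    by_cases hbM : b < M
    · rw [if_pos hbM]
      rw [if_neg (hlt.1 hbM)] at h3
      have h6 : k * (b + 1) ≤ n := by
        have := hlt.1 hbM
        by_contra h7
        refine hn ⟨b + 1, ?_⟩
        rw [mul_add, mul_one] at *; omega
      have h7 : n - k * b - (k - 1) = n - k * (b + 1) + 1 := by
        rw [mul_add, mul_one] at *; omega
      rw [h7] at h3
      have h8 : (0 : ℝ) < n - k * (b + 1) + 1 := by
        have : (k * (b + 1) : ℝ) ≤ n := by exact_mod_cast h6
        linarith
      have h9 : coef (n - k * b) (2 * b + 1) f =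
          ε * k / 2 * coef (n - k * (b + 1) + 1) (2 * (b + 1)) g := by
        rw [show 2 * (b + 1) = 2 * b + 1 + 1 by ring]; linarith
      rw [h9, residueCoef]
      push_cast
      field_simp
    · rw [if_neg hbM]
      rw [if_pos (not_not.1 ((not_congr hlt).1 hbM)), mul_zero] at h3
      have h9 : coef (n - k * b) (2 * b + 1) f = 0 := by linarith
      rw [h9]; ring
  rw [(hG.dx.sub hF.dy).residue_eq, Finset.sum_congr rfl hterm, Finset.sum_sub_distrib,
    Finset.sum_range_succ', Finset.sum_range_succ (fun b => if b < M then t (b + 1) else 0),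
    Finset.sum_congr rfl fun b hb => if_pos (Finset.mem_range.1 hb)]
  have h0 : t 0 = (n + 1) * coef (n + 1) 0 g := by simp [ht, residueCoef]
  have hk0 : (k : ℝ) ≠ 0 := by
    have : k ≠ 0 := by omega
    exact_mod_cast this
  rw [h0, (mul_eq_zero.1 hg0).resolve_left (mul_ne_zero hε hk0)]
  simp

/-- The derivative along the weighted Euler field together with its divergence. -/
noncomputable def euler (k : ℕ) (h : Plane → ℝ) (p : Plane) : ℝ :=
  2 * (p.1 * dx h p) + k * (p.2 * dy h p) + (2 + k) * h p

/-- All monomials `x^(n - kb) ξ^(2b)` entering the residue have weight `2n` for the Euler field,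
whose divergence is `2 + k`. -/
theorem residue_euler {h : Plane → ℝ} (hh : AnalyticAt ℝ h 0) :
    residue k ε n (euler k h) = (2 * n + 2 + k) * residue k ε n h := by
  have hc := AnalyticAt.hasCoef hh
  have h1 := ((hc.dx.mulX.const_mul 2).add (hc.dy.mulY.const_mul k)).add (hc.const_mul (2 + k))
  have h2 : residue k ε n (euler k h) = _ := h1.residue_eq
  rw [h2, residue, Finset.mul_sum]
  refine Finset.sum_congr rfl fun b hb => ?_
  obtain ⟨h3, h4⟩ := cast_index hb
  have e1 : shiftX (fun a b => ((a : ℝ) + 1) * coef (a + 1) b h) (n - k * b) (2 * b) =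
      (n - k * b) * coef (n - k * b) (2 * b) h := by
    rw [← h4]
    simp only [shiftX]
    split_ifs with h0
    · rw [h0]; simp
    · rw [Nat.sub_add_cancel (Nat.one_le_iff_ne_zero.2 h0)]
      congr 1
      exact_mod_cast Nat.sub_add_cancel (Nat.one_le_iff_ne_zero.2 h0)
  have e2 : shiftY (fun a b => ((b : ℝ) + 1) * coef a (b + 1) h) (n - k * b) (2 * b) =
      (2 * b) * coef (n - k * b) (2 * b) h := by
    simp only [shiftY]
    split_ifs with h0
    · have : b = 0 := by omega
      rw [this]; simp
    · rw [Nat.sub_add_cancel (Nat.one_le_iff_ne_zero.2 h0)]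
      congr 1
      exact_mod_cast Nat.sub_add_cancel (Nat.one_le_iff_ne_zero.2 h0)
  rw [e1, e2]; ring

theorem residueCoef_add (hk : 0 < k) {b : ℕ} (hb : k * b ≤ n) :
    residueCoef k ε (n + k) b * (n + 1) = residueCoef k ε n b * (n - k * b + 1) := by
  induction b with
  | zero => simp [residueCoef]
  | succ b ih =>
    have h1 : k * b ≤ n := (Nat.mul_le_mul_left k (Nat.le_succ b)).trans hb
    have h2 : (0 : ℝ) < n - k * b + 1 := by
      have : (k * b : ℝ) ≤ n := by exact_mod_cast h1
      linarith
    have h3 : (0 : ℝ) < n - k * (b + 1) + 1 := by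
      have : (k * (b + 1) : ℝ) ≤ n := by exact_mod_cast hb
      linarith
    have e1 : ((n + k : ℕ) : ℝ) - k * (b + 1) + 1 = n - k * b + 1 := by push_cast; ring
    have ih' := ih h1
    simp only [residueCoef]
    rw [e1]
    push_cast
    rw [mul_assoc, ih']
    field_simp

/-- The residue of `H h`. -/
theorem residue_model_mul (hk : 0 < k) {h : Plane → ℝ} (hh : AnalyticAt ℝ h 0) :
    2 * (n + 1) * residue k ε (n + k) (fun p => model k ε p * h p) =
      ε * (2 * n + 2 + k) * residue k ε n h := by
  have hc := AnalyticAt.hasCoef hh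
  have h1 := hc.mulY.mulY.add ((hc.mulX_pow k).const_mul ε)
  have h2 := (h1.congr (g := fun p => model k ε p * h p) (.of_forall fun p => by
    simp only [model]; ring)).residue_eq (k := k) (ε := ε) (n := n + k)
  set M := n / k with hM
  set c := fun b => coef (n - k * b) (2 * b) h with hcdef
  have hlast : n - k * M < k := by
    have h3 := Nat.mod_add_div n k
    have h4 := Nat.mod_lt n hk
    rw [hM]; omega
  -- In `H h = ξ² h + ε x^k h`, the factor `ξ²` moves the coefficient of index `b` of `h` to `b +
  -- 1`, while `x^k` keeps `b`. The two boundary terms are zero, and the identity reduces to one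
  -- between residue coefficients.
  have sum1 : ∑ b ∈ Finset.range (M + 1 + 1), residueCoef k ε (n + k) b *
      shiftY (shiftY fun i j => coef i j h) (n + k - k * b) (2 * b) =
      ∑ b ∈ Finset.range (M + 1), residueCoef k ε (n + k) (b + 1) * c b := by
    rw [Finset.sum_range_succ']
    simp only [shiftY]
    refine (add_eq_left.2 (by simp)).trans (Finset.sum_congr rfl fun b hb => ?_)
    obtain ⟨h3, -⟩ := cast_index hb
    have e1 : n + k - k * (b + 1) = n - k * b := by rw [mul_add, mul_one]; omega
    have e2 : 2 * (b + 1) - 1 - 1 = 2 * b := by omega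
    have e3 : ¬ (2 * (b + 1) = 0) := by omega
    have e4 : ¬ (2 * (b + 1) - 1 = 0) := by omega
    rw [if_neg e3, if_neg e4, e1, e2]
  have sum2 : ∑ b ∈ Finset.range (M + 1 + 1), residueCoef k ε (n + k) b *
      (ε * (if n + k - k * b < k then 0 else coef (n + k - k * b - k) (2 * b) h)) =
      ∑ b ∈ Finset.range (M + 1), residueCoef k ε (n + k) b * (ε * c b) := by
    have e0 : n + k - k * (M + 1) < k := by rw [mul_add, mul_one]; omega
    rw [Finset.sum_range_succ, if_pos e0]
    refine (add_eq_left.2 (by simp)).trans (Finset.sum_congr rfl fun b hb => ?_)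
    obtain ⟨h3, -⟩ := cast_index hb
    have e1 : n + k - k * b - k = n - k * b := by omega
    have e2 : ¬ (n + k - k * b < k) := by omega
    rw [if_neg e2, e1]
  rw [h2, residue, Nat.add_div_right _ hk]
  simp only [mul_add (residueCoef k ε (n + k) _), Finset.sum_add_distrib]
  rw [sum1, sum2, ← Finset.sum_add_distrib, Finset.mul_sum, Finset.mul_sum]
  refine Finset.sum_congr rfl fun b hb => ?_
  obtain ⟨h3, h4⟩ := cast_index hb
  have h5 := residueCoef_add (ε := ε) hk h3
  have h6 : (n : ℝ) - k * b + 1 ≠ 0 := by rw [← h4]; positivity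
  have h7 : (n : ℝ) + 1 ≠ 0 := by positivity
  have h8 : residueCoef k ε (n + k) b = residueCoef k ε n b * (n - k * b + 1) / (n + 1) := by
    field_simp; linarith
  have e1 : ((n + k : ℕ) : ℝ) - k * (b + 1) + 1 = n - k * b + 1 := by push_cast; ring
  rw [residueCoef, e1, h8]
  field_simp
  ring

end residue

/-! ### Action of the symmetries of the model on residues -/

/-- The Jacobian determinant of the map with components `X` and `Y`. -/
noncomputable def jac (X Y : Plane → ℝ) (p : Plane) : ℝ := dx X p * dy Y p - dy X p * dx Y p

/-- The density of the pull-back of `h dx ∧ dξ` by the map with components `X` and `Y`. -/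
noncomputable def transport (X Y : Plane → ℝ) (h : Plane → ℝ) (p : Plane) : ℝ :=
  h (X p, Y p) * jac X Y p

/-- `(X, Y)` is an analytic map germ fixing the origin. -/
structure IsMapGerm (X Y : Plane → ℝ) : Prop where
  anX : AnalyticAt ℝ X 0
  anY : AnalyticAt ℝ Y 0
  X0 : X 0 = 0
  Y0 : Y 0 = 0

theorem IsMapGerm.comp {X Y : Plane → ℝ} (hm : IsMapGerm X Y) {h : Plane → ℝ}
    (hh : AnalyticAt ℝ h 0) : AnalyticAt ℝ (fun p => h (X p, Y p)) 0 := by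
  refine AnalyticAt.fun_comp (f := fun p => (X p, Y p)) ?_ (hm.anX.prod hm.anY)
  simpa only [hm.X0, hm.Y0] using! hh

theorem IsMapGerm.tendsto {X Y : Plane → ℝ} (hm : IsMapGerm X Y) :
    Tendsto (fun p => (X p, Y p)) (𝓝 0) (𝓝 (0 : Plane)) := by
  have := (hm.anX.continuousAt.prodMk hm.anY.continuousAt).tendsto
  simpa only [hm.X0, hm.Y0] using! this

theorem IsMapGerm.eventually {X Y : Plane → ℝ} (hm : IsMapGerm X Y) {h : Plane → ℝ}
    (hh : AnalyticAt ℝ h 0) : ∀ᶠ p in 𝓝 0, AnalyticAt ℝ h (X p, Y p) :=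
  hm.tendsto.eventually hh.eventually_analyticAt

theorem IsMapGerm.analyticAt_jac {X Y : Plane → ℝ} (hm : IsMapGerm X Y) : AnalyticAt ℝ (jac X Y) 0 :=
  ((AnalyticAt.pd hm.anX _).mul (AnalyticAt.pd hm.anY _)).sub
    ((AnalyticAt.pd hm.anX _).mul (AnalyticAt.pd hm.anY _))

theorem IsMapGerm.analyticAt_transport {X Y : Plane → ℝ} (hm : IsMapGerm X Y) {h : Plane → ℝ}
    (hh : AnalyticAt ℝ h 0) : AnalyticAt ℝ (transport X Y h) 0 := (hm.comp hh).mul hm.analyticAt_jac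

theorem analyticAt_bracket {k : ℕ} {ε : ℝ} {g : Plane → ℝ} (hg : AnalyticAt ℝ g 0) :
    AnalyticAt ℝ (bracket k ε g) 0 := by
  have h1 := AnalyticAt.pd hg (1, 0)
  have h2 := AnalyticAt.pd hg (0, 1)
  exact ((analyticAt_const.mul (analyticAt_fst.pow _)).mul h2).sub
    ((analyticAt_const.mul analyticAt_snd).mul h1)

theorem analyticAt_euler {k : ℕ} {g : Plane → ℝ} (hg : AnalyticAt ℝ g 0) :
    AnalyticAt ℝ (euler k g) 0 := by
  have h1 := AnalyticAt.pd hg (1, 0)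
  have h2 := AnalyticAt.pd hg (0, 1)
  exact ((analyticAt_const.mul (analyticAt_fst.mul h1)).add
    (analyticAt_const.mul (analyticAt_snd.mul h2))).add (analyticAt_const.mul hg)

/-- Apply `residue_eq_zero` to `α = g dH`, for which `dα = -dH ∧ dg`. -/
theorem residue_bracket {k : ℕ} {ε : ℝ} {n : ℕ} (hk : 2 ≤ k) (hε : ε ≠ 0) (hn : ¬ k ∣ n + 1)
    {g : Plane → ℝ} (hg : AnalyticAt ℝ g 0) : residue k ε n (bracket k ε g) = 0 := by
  have h1 : AnalyticAt ℝ (fun p : Plane => ε * k * p.1 ^ (k - 1) * g p) 0 :=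
    (analyticAt_const.mul (analyticAt_fst.pow _)).mul hg
  have h2 : AnalyticAt ℝ (fun p : Plane => 2 * p.2 * g p) 0 :=
    (analyticAt_const.mul analyticAt_snd).mul hg
  have h3 := residue_eq_zero (ε := ε) hk hε hn h1 h2 (.of_forall fun p => by ring)
  have h4 : (fun p => dx (fun p : Plane => 2 * p.2 * g p) p -
      dy (fun p : Plane => ε * k * p.1 ^ (k - 1) * g p) p) =ᶠ[𝓝 0] fun p => -1 * bracket k ε g p := by
    filter_upwards [hg.eventually_analyticAt] with p hp
    have hd := hp.differentiableAt
    simp (disch := fun_prop) only [pd_mul, pd_const, pd_fst, pd_snd, pd_pow, bracket]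
    ring
  rw [residue_congr h4 ((AnalyticAt.pd h2 _).sub (AnalyticAt.pd h1 _)),
    residue_const_mul (analyticAt_bracket hg)] at h3
  linarith

section symmetry
variable {k : ℕ} {ε : ℝ} {X Y : Plane → ℝ}

/-- `(X, Y)` is a map germ preserving the model Hamiltonian. -/
structure IsModelSymmetry (k : ℕ) (ε : ℝ) (X Y : Plane → ℝ) : Prop extends IsMapGerm X Y where
  model_eq : ∀ᶠ p in 𝓝 (0 : Plane), Y p ^ 2 + ε * X p ^ k = p.2 ^ 2 + ε * p.1 ^ k

theorem IsModelSymmetry.deriv_eq (hs : IsModelSymmetry k ε X Y) :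
    ∀ᶠ p in 𝓝 (0 : Plane),
      (2 * Y p * dx Y p + ε * k * X p ^ (k - 1) * dx X p = ε * k * p.1 ^ (k - 1)) ∧
      (2 * Y p * dy Y p + ε * k * X p ^ (k - 1) * dy X p = 2 * p.2) := by
  have h1 := pd_congr hs.model_eq (1, 0)
  have h2 := pd_congr hs.model_eq (0, 1)
  filter_upwards [h1, h2, hs.anX.eventually_analyticAt, hs.anY.eventually_analyticAt]
    with p e1 e2 hX hY
  have hX := hX.differentiableAt
  have hY := hY.differentiableAt
  simp (disch := fun_prop) only [pd_add, pd_mul, pd_const, pd_fst, pd_snd, pd_pow] at e1 e2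
  constructor
  · simp at e1; linear_combination e1
  · simp at e2; linear_combination e2

/-- Write `ω = h dx ∧ dξ` and `Ψ = (X, Y)`. Since `E H = 2k H`, one has `dH ∧ i_E ω = 2k H ω`. As
`Ψ` preserves `H`, the form `α = Ψ^*(i_E ω) - i_E(Ψ^* ω)` satisfies `dH ∧ α = 0`, so the residues of
`dα = Ψ^*(L_E ω) - L_E(Ψ^* ω)` vanish. -/
theorem IsModelSymmetry.residue_transport_euler (hs : IsModelSymmetry k ε X Y) (hk : 2 ≤ k)
    (hε : ε ≠ 0) {n : ℕ} (hn : ¬ k ∣ n + 1) {h : Plane → ℝ} (hh : AnalyticAt ℝ h 0) :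
    residue k ε n (transport X Y (euler k h)) =
      (2 * n + 2 + k) * residue k ε n (transport X Y h) := by
  have hm := hs.toIsMapGerm
  have aX := hm.anX
  have aY := hm.anY
  have aXx := AnalyticAt.pd aX (1, 0)
  have aXy := AnalyticAt.pd aX (0, 1)
  have aYx := AnalyticAt.pd aY (1, 0)
  have aYy := AnalyticAt.pd aY (0, 1)
  have aH := hm.comp hh
  have aT := hm.analyticAt_transport hh
  -- The form `α` is `A dx + B dξ`, with `i_E(h dx ∧ dξ) = h (2x dξ - kξ dx)`.
  set A : Plane → ℝ := fun p => h (X p, Y p) * (2 * X p * dx Y p - k * Y p * dx X p) +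
    k * p.2 * (h (X p, Y p) * (dx X p * dy Y p - dy X p * dx Y p)) with hA
  set B : Plane → ℝ := fun p => h (X p, Y p) * (2 * X p * dy Y p - k * Y p * dy X p) -
    2 * p.1 * (h (X p, Y p) * (dx X p * dy Y p - dy X p * dx Y p)) with hB
  have aJ := aH.fun_mul ((aXx.fun_mul aYy).fun_sub (aXy.fun_mul aYx))
  have aA : AnalyticAt ℝ A 0 :=
    (aH.fun_mul (((analyticAt_const.fun_mul aX).fun_mul aYx).fun_sub
      ((analyticAt_const.fun_mul aY).fun_mul aXx))).fun_add
        ((analyticAt_const.fun_mul analyticAt_snd).fun_mul aJ)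
  have aB : AnalyticAt ℝ B 0 :=
    (aH.fun_mul (((analyticAt_const.fun_mul aX).fun_mul aYy).fun_sub
      ((analyticAt_const.fun_mul aY).fun_mul aXy))).fun_sub
        ((analyticAt_const.fun_mul analyticAt_fst).fun_mul aJ)
  have h0 := residue_eq_zero (ε := ε) hk hε hn aA aB (by
    filter_upwards [hs.deriv_eq, hs.model_eq] with p ⟨e1, e2⟩ e3
    obtain ⟨m, rfl⟩ : ∃ m, k = m + 1 := ⟨k - 1, by omega⟩
    simp only [Nat.add_sub_cancel, pow_succ _ m] at *
    simp only [hA, hB]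
    push_cast at *
    linear_combination (-(h (X p, Y p) * (2 * X p * dy Y p - (m + 1) * Y p * dy X p))) * e1 +
      (h (X p, Y p) * (2 * X p * dx Y p - (m + 1) * Y p * dx X p)) * e2 +
      2 * (m + 1) * (h (X p, Y p) * (dx X p * dy Y p - dy X p * dx Y p)) * e3)
  have hE : (fun p => dx B p - dy A p) =ᶠ[𝓝 0]
      fun p => transport X Y (euler k h) p - euler k (transport X Y h) p := by
    filter_upwards [aX.eventually_analyticAt, aY.eventually_analyticAt, hm.eventually hh,
      aH.eventually_analyticAt]
      with p hX hY hhp hH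
    have dH := hH.differentiableAt
    have dX := hX.differentiableAt
    have dY := hY.differentiableAt
    have dXx := (AnalyticAt.pd hX (1, 0)).differentiableAt
    have dXy := (AnalyticAt.pd hX (0, 1)).differentiableAt
    have dYx := (AnalyticAt.pd hY (1, 0)).differentiableAt
    have dYy := (AnalyticAt.pd hY (0, 1)).differentiableAt
    have cX := pd_comm hX (1, 0) (0, 1)
    have cY := pd_comm hY (1, 0) (0, 1)
    have ch := fun v => pd_comp hhp.differentiableAt dX dY v
    simp only [hA, hB, euler, transport, jac]
    change _ - _ = _ - (2 * (p.1 * dx (fun p => h (X p, Y p) * (dx X p * dy Y p - dy X p * dx Y p)) p) +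
      k * (p.2 * dy (fun p => h (X p, Y p) * (dx X p * dy Y p - dy X p * dx Y p)) p) +
      (2 + k) * (h (X p, Y p) * (dx X p * dy Y p - dy X p * dx Y p)))
    simp (disch := fun_prop) only [pd_add, pd_sub, pd_mul, pd_const, pd_fst, pd_snd, ch, cX, cY]
    ring
  rw [residue_congr hE ((AnalyticAt.pd aB _).sub (AnalyticAt.pd aA _)),
    residue_sub (hm.analyticAt_transport (analyticAt_euler hh)) (analyticAt_euler aT), residue_euler aT] at h0
  linarith

/-- This is `Ψ^*(dH ∧ dg) = dH ∧ d(g ∘ Ψ)`. -/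
theorem IsModelSymmetry.transport_bracket (hs : IsModelSymmetry k ε X Y)
    {g : Plane → ℝ} (hg : AnalyticAt ℝ g 0) :
    transport X Y (bracket k ε g) =ᶠ[𝓝 0] bracket k ε (fun p => g (X p, Y p)) := by
  have hm := hs.toIsMapGerm
  filter_upwards [hs.deriv_eq, hm.anX.eventually_analyticAt, hm.anY.eventually_analyticAt,
    hm.eventually hg] with p ⟨e1, e2⟩ hX hY hgp
  have ch := fun v => pd_comp hgp.differentiableAt hX.differentiableAt hY.differentiableAt v
  simp only [transport, bracket, jac, ch]
  linear_combination (pd (1, 0) g (X p, Y p) * dy X p + pd (0, 1) g (X p, Y p) * dy Y p) * e1 -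
    (pd (1, 0) g (X p, Y p) * dx X p + pd (0, 1) g (X p, Y p) * dx Y p) * e2

theorem IsMapGerm.residue_transport_add (hm : IsMapGerm X Y) {n : ℕ} {f g : Plane → ℝ}
    (hf : AnalyticAt ℝ f 0) (hg : AnalyticAt ℝ g 0) :
    residue k ε n (transport X Y (fun p => f p + g p)) =
      residue k ε n (transport X Y f) + residue k ε n (transport X Y g) := by
  rw [← residue_add (hm.analyticAt_transport hf) (hm.analyticAt_transport hg)]
  congr 1; ext p; simp only [transport]; ring

theorem IsMapGerm.residue_transport_const_mul (hm : IsMapGerm X Y) {n : ℕ} {f : Plane → ℝ}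
    (hf : AnalyticAt ℝ f 0) (t : ℝ) :
    residue k ε n (transport X Y (fun p => t * f p)) = t * residue k ε n (transport X Y f) := by
  rw [← residue_const_mul (hm.analyticAt_transport hf)]
  congr 1; ext p; simp only [transport]; ring

theorem analyticAt_fst_pow (m : ℕ) : AnalyticAt ℝ (fun p : Plane => p.1 ^ m) 0 :=
  analyticAt_fst.pow m

/-- The monomial `x^m` is an eigenvector of `euler` with eigenvalue `2m + 2 + k`, whereas the
residue of index `n` sees only the eigenvalue `2n + 2 + k`. -/
theorem IsModelSymmetry.residue_transport_pow_ne (hs : IsModelSymmetry k ε X Y) (hk : 2 ≤ k)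
    (hε : ε ≠ 0) {n m : ℕ} (hn : ¬ k ∣ n + 1) (hnm : m ≠ n) :
    residue k ε n (transport X Y (fun p => p.1 ^ m)) = 0 := by
  have h1 := hs.residue_transport_euler hk hε hn (analyticAt_fst_pow m)
  have h2 : euler k (fun p => p.1 ^ m) = fun p => (2 * m + 2 + k : ℝ) * p.1 ^ m := by
    ext p
    simp (disch := fun_prop) only [euler, pd_pow, pd_fst]
    rcases m with _ | m
    · simp
    · simp only [Nat.add_sub_cancel, pow_succ]; ring
  rw [h2, hs.residue_transport_const_mul (analyticAt_fst_pow m)] at h1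
  have h3 : ((m : ℝ) - n) ≠ 0 := sub_ne_zero.2 (by exact_mod_cast hnm)
  have h4 : ((m : ℝ) - n) * residue k ε n (transport X Y (fun p => p.1 ^ m)) = 0 := by linarith
  exact (mul_eq_zero.1 h4).resolve_left h3

/-- Multiplication by `H` commutes with `Ψ^*`, and `2(n + 1) H x^n = ε (2n + 2 + k) x^(n+k) -
bracket(x^(n+1) ξ)`. The same nonzero scalar occurs in `residue_model_mul` and cancels. -/
theorem IsModelSymmetry.residue_transport_pow_add (hs : IsModelSymmetry k ε X Y) (hk : 2 ≤ k)
    (hε : ε ≠ 0) {n : ℕ} (hn : ¬ k ∣ n + 1) :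
    residue k ε (n + k) (transport X Y (fun p => p.1 ^ (n + k))) =
      residue k ε n (transport X Y (fun p => p.1 ^ n)) := by
  have hn' : ¬ k ∣ n + k + 1 := by
    rw [show n + k + 1 = n + 1 + k by ring]; simpa using hn
  have hp := hs.analyticAt_transport (analyticAt_fst_pow n)
  have hg : AnalyticAt ℝ (fun p : Plane => p.1 ^ (n + 1) * p.2) 0 :=
    (analyticAt_fst_pow _).mul analyticAt_snd
  have hb := analyticAt_bracket (k := k) (ε := ε) hg
  have h1 := residue_model_mul (k := k) (ε := ε) (n := n) (by omega) hp
  have h2 : (fun p => (2 * (n + 1)) * (model k ε p * transport X Y (fun p => p.1 ^ n) p)) =ᶠ[𝓝 0]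
      transport X Y (fun p => (ε * (2 * n + 2 + k)) * p.1 ^ (n + k) +
        (-1) * bracket k ε (fun p : Plane => p.1 ^ (n + 1) * p.2) p) := by
    filter_upwards [hs.model_eq] with p hp
    obtain ⟨m, rfl⟩ : ∃ m, k = m + 1 := ⟨k - 1, by omega⟩
    simp (disch := fun_prop) only [model, transport, bracket, pd_mul, pd_pow, pd_fst, pd_snd]
    rw [← hp]
    simp only [Nat.add_sub_cancel]
    push_cast
    ring
  have hmodel : AnalyticAt ℝ (model k ε) 0 :=
    (analyticAt_snd.pow 2).add (analyticAt_const.mul (analyticAt_fst.pow k))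
  have h3 := residue_congr (k := k) (ε := ε) (n := n + k) h2
    (analyticAt_const.mul (hmodel.mul hp))
  rw [residue_const_mul (hmodel.fun_mul hp), hs.residue_transport_add
    (analyticAt_const.fun_mul (analyticAt_fst_pow _)) (analyticAt_const.fun_mul hb),
    hs.residue_transport_const_mul (analyticAt_fst_pow _), hs.residue_transport_const_mul hb,
    residue_congr (hs.transport_bracket hg) (hs.analyticAt_transport hb),
    residue_bracket hk hε hn' (hs.comp hg), h1, mul_zero, add_zero] at h3
  have h4 : ε * (2 * n + 2 + k) ≠ 0 := mul_ne_zero hε (by positivity)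
  exact (mul_left_cancel₀ h4 h3).symm

theorem coef_pow_mul_eq_zero {X : Plane → ℝ} (hX : AnalyticAt ℝ X 0) (hX0 : X 0 = 0) (N : ℕ) :
    ∀ (R : Plane → ℝ), AnalyticAt ℝ R 0 → ∀ i j, i + j < N →
      coef i j (fun p => X p ^ N * R p) = 0 := by
  induction N with
  | zero => intro R _ i j h; omega
  | succ N ih =>
    intro R hR i j hij
    have hc := AnalyticAt.hasCoef ((hX.fun_pow (N + 1)).fun_mul hR)
    have key : ∀ v : Plane, pd v (fun p => X p ^ (N + 1) * R p) =ᶠ[𝓝 0]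
        fun p => X p ^ N * ((N + 1) * pd v X p * R p + X p * pd v R p) := by
      intro v
      filter_upwards [hX.eventually_analyticAt, hR.eventually_analyticAt] with p h1 h2
      have := h1.differentiableAt
      have := h2.differentiableAt
      simp (disch := fun_prop) only [pd_mul, pd_pow]
      simp only [Nat.add_sub_cancel, pow_succ]; push_cast; ring
    have hR' : ∀ v : Plane, AnalyticAt ℝ (fun p => (N + 1) * pd v X p * R p + X p * pd v R p) 0 :=
      fun v => ((analyticAt_const.mul (AnalyticAt.pd hX v)).mul hR).add (hX.mul (AnalyticAt.pd hR v))
    rcases i with _ | i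
    · rcases j with _ | j
      · have := hc.apply_zero
        simpa [hX0] using! this.symm
      · have h1 := (hc.dy.congr (key (0, 1))).coef_eq 0 j
        rw [ih _ (hR' _) 0 j (by omega)] at h1
        have h2 : ((j : ℝ) + 1) ≠ 0 := by positivity
        exact (mul_eq_zero.1 h1.symm).resolve_left h2
    · have h1 := (hc.dx.congr (key (1, 0))).coef_eq i j
      rw [ih _ (hR' _) i j (by omega)] at h1
      have h2 : ((i : ℝ) + 1) ≠ 0 := by positivity
      exact (mul_eq_zero.1 h1.symm).resolve_left h2

theorem coef_pow_mul {X : Plane → ℝ} (hX : AnalyticAt ℝ X 0) (hX0 : X 0 = 0) (N : ℕ) :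
    ∀ (R : Plane → ℝ), AnalyticAt ℝ R 0 →
      coef N 0 (fun p => X p ^ N * R p) = dx X 0 ^ N * R 0 := by
  induction N with
  | zero =>
    intro R hR
    have := (AnalyticAt.hasCoef hR).apply_zero
    simpa using this.symm
  | succ N ih =>
    intro R hR
    have hc := AnalyticAt.hasCoef ((hX.fun_pow (N + 1)).fun_mul hR)
    have key : pd (1, 0) (fun p => X p ^ (N + 1) * R p) =ᶠ[𝓝 0]
        fun p => X p ^ N * ((N + 1) * pd (1, 0) X p * R p + X p * pd (1, 0) R p) := by
      filter_upwards [hX.eventually_analyticAt, hR.eventually_analyticAt] with p h1 h2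
      have := h1.differentiableAt
      have := h2.differentiableAt
      simp (disch := fun_prop) only [pd_mul, pd_pow]
      simp only [Nat.add_sub_cancel, pow_succ]; push_cast; ring
    have h1 := (hc.dx.congr key).coef_eq N 0
    rw [ih _ (((analyticAt_const.fun_mul (AnalyticAt.pd hX _)).fun_mul hR).fun_add
      (hX.fun_mul (AnalyticAt.pd hR _))), hX0] at h1
    have h2 : ((N : ℝ) + 1) ≠ 0 := by positivity
    refine mul_left_cancel₀ h2 (h1.symm.trans ?_)
    ring

/-- The residue of index `n` involves coefficients of total degree `n - kb + 2b ≤ n` only, because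
`k ≥ 2`. Hence finite Taylor polynomials suffice below and no infinite sum has to be transported. -/
theorem IsMapGerm.residue_transport_high (hm : IsMapGerm X Y) (hk : 2 ≤ k) {n N : ℕ} (hN : n < N)
    {R : Plane → ℝ} (hR : AnalyticAt ℝ R 0) :
    residue k ε n (transport X Y (fun p => p.1 ^ N * R p)) = 0 := by
  refine Finset.sum_eq_zero fun b hb => ?_
  obtain ⟨h1, -⟩ := cast_index hb
  have h2 : 2 * b ≤ k * b := Nat.mul_le_mul_right b hk
  have := coef_pow_mul_eq_zero hm.anX hm.X0 N _ ((hm.comp hR).mul hm.analyticAt_jac) (n - k * b) (2 * b)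
    (by omega)
  have e : transport X Y (fun p => p.1 ^ N * R p) =
    fun p => X p ^ N * (R (X p, Y p) * jac X Y p) := by ext p; simp only [transport]; ring
  rw [e]
  exact mul_eq_zero_of_right _ this

/-- For `n < k` the residue is the single Taylor coefficient of `x^n`, and in `X^n · jac` it comes
from the linear part of `X` and the value of the Jacobian. Larger `n` reduce to `n % k` in steps of
`k`. -/
theorem IsModelSymmetry.residue_transport_pow_eq (hs : IsModelSymmetry k ε X Y) (hk : 2 ≤ k)
    (hε : ε ≠ 0) {n : ℕ} (hn : ¬ k ∣ n + 1) :
    residue k ε n (transport X Y (fun p => p.1 ^ n)) = dx X 0 ^ (n % k) * jac X Y 0 := by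
  have hlow : ∀ n, n < k → residue k ε n (transport X Y (fun p => p.1 ^ n)) =
      dx X 0 ^ n * jac X Y 0 := by
    intro n hlt
    rw [residue, Nat.div_eq_of_lt hlt]
    simp only [zero_add, Finset.range_one, Finset.sum_singleton, residueCoef, mul_zero, one_mul,
      Nat.sub_zero]
    exact coef_pow_mul hs.anX hs.X0 n _ hs.analyticAt_jac
  have hstep : ∀ q, residue k ε (n % k + k * q) (transport X Y (fun p => p.1 ^ (n % k + k * q))) =
      dx X 0 ^ (n % k) * jac X Y 0 := by
    intro q
    induction q with
    | zero => exact hlow _ (Nat.mod_lt _ (by omega))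
    | succ q ih =>
      rw [mul_add, mul_one, ← add_assoc, hs.residue_transport_pow_add hk hε, ih]
      intro hd
      refine hn ?_
      have h1 := Nat.mod_add_div n k
      rw [show n % k + k * q + 1 = (n % k + 1) + k * q by ring] at hd
      rw [← h1, show n % k + k * (n / k) + 1 = (n % k + 1) + k * (n / k) by ring]
      exact (Nat.dvd_add_left (dvd_mul_right k _)).2
        ((Nat.dvd_add_left (dvd_mul_right k _)).1 hd)
  have := hstep (n / k)
  rwa [Nat.mod_add_div] at this

theorem exists_taylor {f : ℝ → ℝ} (hf : AnalyticAt ℝ f 0) (N : ℕ) :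
    ∃ (a : ℕ → ℝ) (R : ℝ → ℝ), AnalyticAt ℝ R 0 ∧
      ∀ᶠ t in 𝓝 (0 : ℝ), f t = ∑ m ∈ Finset.range N, a m * t ^ m + t ^ N * R t := by
  induction N with
  | zero => exact ⟨0, f, hf, .of_forall fun t => by simp⟩
  | succ N ih =>
    obtain ⟨a, R, hR, h⟩ := ih
    obtain ⟨p, hp⟩ := hR
    refine ⟨fun m => if m = N then R 0 else a m, dslope R 0, hp.has_fpower_series_dslope_fslope.analyticAt, ?_⟩
    filter_upwards [h] with t ht
    have h1 : t * dslope R 0 t = R t - R 0 := by simpa using sub_smul_dslope R 0 t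
    have h2 : ∑ m ∈ Finset.range N, (if m = N then R 0 else a m) * t ^ m =
        ∑ m ∈ Finset.range N, a m * t ^ m :=
      Finset.sum_congr rfl fun m hm => by rw [if_neg (Finset.mem_range.1 hm).ne]
    rw [ht, Finset.sum_range_succ, if_pos rfl, pow_succ, mul_assoc, h1, h2]
    ring

end symmetry

section symmetry
variable {k : ℕ} {ε : ℝ} {X Y : Plane → ℝ}

theorem isModelSymmetry_id (k : ℕ) (ε : ℝ) : IsModelSymmetry k ε (fun p => p.1) (fun p => p.2) where
  anX := analyticAt_fst
  anY := analyticAt_snd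
  X0 := rfl
  Y0 := rfl
  model_eq := .of_forall fun _ => rfl

theorem IsMapGerm.transport_congr (hm : IsMapGerm X Y) {f g : Plane → ℝ} (h : f =ᶠ[𝓝 0] g) :
    transport X Y f =ᶠ[𝓝 0] transport X Y g := by
  filter_upwards [hm.tendsto.eventually h] with p hp
  simp only [transport, hp]

theorem analyticAt_sum_pow (a : ℕ → ℝ) (N : ℕ) :
    AnalyticAt ℝ (fun p : Plane => ∑ m ∈ Finset.range N, a m * p.1 ^ m) 0 :=
  Finset.analyticAt_fun_sum _ fun m _ => analyticAt_const.fun_mul (analyticAt_fst_pow m)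

theorem IsModelSymmetry.residue_transport_taylor (hs : IsModelSymmetry k ε X Y) (hk : 2 ≤ k)
    (hε : ε ≠ 0) {n : ℕ} (hn : ¬ k ∣ n + 1) {f R : ℝ → ℝ} {a : ℕ → ℝ} (hf : AnalyticAt ℝ f 0)
    (hR : AnalyticAt ℝ R 0)
    (h : ∀ᶠ t in 𝓝 (0 : ℝ), f t = ∑ m ∈ Finset.range (n + 1), a m * t ^ m + t ^ (n + 1) * R t) :
    residue k ε n (transport X Y (fun p => f p.1)) = a n * (dx X 0 ^ (n % k) * jac X Y 0) := by
  have h1 : Tendsto (fun p : Plane => p.1) (𝓝 0) (𝓝 0) := continuous_fst.tendsto' _ _ rfl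
  have h2 : transport X Y (fun p => f p.1) =ᶠ[𝓝 0] transport X Y (fun p =>
      ∑ m ∈ Finset.range (n + 1), a m * p.1 ^ m + p.1 ^ (n + 1) * R p.1) :=
    hs.transport_congr (h1.eventually h)
  have h3 : ∀ N ≤ n, residue k ε n
      (transport X Y (fun p => ∑ m ∈ Finset.range N, a m * p.1 ^ m)) = 0 := by
    intro N
    induction N with
    | zero =>
      intro _
      have := hs.residue_transport_const_mul (k := k) (ε := ε) (n := n) (analyticAt_fst_pow 0) 0
      simpa using this
    | succ N ih =>
      intro hN
      simp only [Finset.sum_range_succ]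
      rw [hs.residue_transport_add (analyticAt_sum_pow a N)
        (analyticAt_const.fun_mul (analyticAt_fst_pow N)), ih (by omega),
        hs.residue_transport_const_mul (analyticAt_fst_pow N),
        hs.residue_transport_pow_ne hk hε hn (by omega)]
      ring
  rw [residue_congr h2 (hs.analyticAt_transport (analyticAt_comp_fst hf)),
    hs.residue_transport_add (analyticAt_sum_pow a (n + 1))
      ((analyticAt_fst_pow (n + 1)).fun_mul (analyticAt_comp_fst hR)),
    hs.residue_transport_high hk (Nat.lt_succ_self n) (analyticAt_comp_fst hR)]
  simp only [Finset.sum_range_succ]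
  rw [hs.residue_transport_add (analyticAt_sum_pow a n)
    (analyticAt_const.fun_mul (analyticAt_fst_pow n)), h3 n le_rfl,
    hs.residue_transport_const_mul (analyticAt_fst_pow n), hs.residue_transport_pow_eq hk hε hn]
  ring

theorem residue_fst {n : ℕ} {f : ℝ → ℝ} (hf : AnalyticAt ℝ f 0) :
    residue k ε n (fun p => f p.1) = coef1 n f := by
  rw [(hasCoef_fst hf).residue_eq, Finset.sum_range_succ', Finset.sum_eq_zero]
  · simp [residueCoef]
  · intro b _; simp

theorem IsModelSymmetry.residue_transport_fst (hs : IsModelSymmetry k ε X Y) (hk : 2 ≤ k)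
    (hε : ε ≠ 0) {n : ℕ} (hn : ¬ k ∣ n + 1) {f : ℝ → ℝ} (hf : AnalyticAt ℝ f 0) :
    residue k ε n (transport X Y (fun p => f p.1)) =
      coef1 n f * (dx X 0 ^ (n % k) * jac X Y 0) := by
  obtain ⟨a, R, hR, h⟩ := exists_taylor hf (n + 1)
  rw [hs.residue_transport_taylor hk hε hn hf hR h]
  -- Applying the same formula to the identity symmetry identifies `a n` with the Taylor coefficient
  -- `coef1 n f`.
  have h1 := (isModelSymmetry_id k ε).residue_transport_taylor hk hε hn hf hR h
  have h2 : transport (fun p => p.1) (fun p => p.2) (fun p : Plane => f p.1) = fun p => f p.1 := by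
    ext p; simp [transport, jac, pd_fst, pd_snd]
  rw [h2, residue_fst hf] at h1
  rw [h1]; simp [jac, pd_fst, pd_snd]

/-- The Taylor coefficients of two potentials related by a symmetry of the model. -/
theorem IsModelSymmetry.coef1_eq (hs : IsModelSymmetry k ε X Y) (hk : 2 ≤ k) (hε : ε ≠ 0)
    {f g : ℝ → ℝ} (hf : AnalyticAt ℝ f 0) (hg : AnalyticAt ℝ g 0)
    (h : ∀ᶠ p in 𝓝 (0 : Plane), g (X p) * jac X Y p = f p.1) {n : ℕ} (hn : ¬ k ∣ n + 1) :
    coef1 n f = coef1 n g * (dx X 0 ^ (n % k) * jac X Y 0) := by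
  rw [← hs.residue_transport_fst hk hε hn hg, ← residue_fst hf]
  exact (residue_congr h (hs.analyticAt_transport (analyticAt_comp_fst hg))).symm

/-! ### The linear part of a symmetry of the model -/

theorem tendsto_div_line {f : Plane → ℝ} (hf : AnalyticAt ℝ f 0) (hf0 : f 0 = 0) (a b : ℝ) :
    Tendsto (fun t : ℝ => f (t * a, t * b) / t) (𝓝[≠] 0) (𝓝 (dx f 0 * a + dy f 0 * b)) := by
  have h1 : HasDerivAt (fun t : ℝ => ((t * a, t * b) : Plane)) (a, b) 0 := by
    have h2 := (hasDerivAt_id (0 : ℝ)).mul_const a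
    have h3 := (hasDerivAt_id (0 : ℝ)).mul_const b
    simpa using! h2.prodMk h3
  have h2 := hf.differentiableAt.hasFDerivAt.comp_hasDerivAt_of_eq (0 : ℝ) h1
    (by ext <;> simp)
  have h3 : fderiv ℝ f 0 (a, b) = dx f 0 * a + dy f 0 * b := by
    have : ((a, b) : Plane) = a • ((1, 0) : Plane) + b • (0, 1) := by ext <;> simp
    rw [this, map_add, map_smul, map_smul]
    simp only [ASing.pd, smul_eq_mul]; ring
  rw [h3, hasDerivAt_iff_tendsto_slope] at h2
  refine h2.congr fun t => ?_
  have h00 : f (0, 0) = 0 := hf0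
  simp [slope_def_field, h00]

theorem tendsto_line (a b : ℝ) :
    Tendsto (fun t : ℝ => ((t * a, t * b) : Plane)) (𝓝[≠] 0) (𝓝 0) :=
  tendsto_nhdsWithin_of_tendsto_nhds
    ((by fun_prop : Continuous fun t : ℝ => ((t * a, t * b) : Plane)).tendsto' _ _ (by simp))

/-- Restrict `H ∘ Ψ = H` to the line through `(a, b)`, divide by `t²` and let `t → 0`. The factor
`0^(k-2)` is `1` for `k = 2` and `0` otherwise, which treats both cases at once. -/
theorem IsModelSymmetry.linear_eq (hs : IsModelSymmetry k ε X Y) (hk : 2 ≤ k) (a b : ℝ) :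
    (dx Y 0 * a + dy Y 0 * b) ^ 2 + ε * (0 : ℝ) ^ (k - 2) * (dx X 0 * a + dy X 0 * b) ^ k =
      b ^ 2 + ε * (0 : ℝ) ^ (k - 2) * a ^ k := by
  have h1 := tendsto_div_line hs.anX hs.X0 a b
  have h2 := tendsto_div_line hs.anY hs.Y0 a b
  have h3 : Tendsto (fun t : ℝ => t) (𝓝[≠] 0) (𝓝 0) := tendsto_nhdsWithin_of_tendsto_nhds tendsto_id
  have h4 := (h2.pow 2).add (((h3.pow (k - 2)).const_mul ε).mul (h1.pow k))
  have h5 : Tendsto (fun t : ℝ => b ^ 2 + ε * t ^ (k - 2) * a ^ k) (𝓝[≠] 0)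
      (𝓝 (b ^ 2 + ε * (0 : ℝ) ^ (k - 2) * a ^ k)) :=
    ((((h3.pow (k - 2)).const_mul ε).mul_const _).const_add _)
  refine tendsto_nhds_unique h4 (h5.congr' ?_)
  filter_upwards [(tendsto_line a b).eventually hs.model_eq, self_mem_nhdsWithin] with t ht ht0
  have ht0 : t ≠ 0 := ht0
  obtain ⟨m, rfl⟩ : ∃ m, k = m + 2 := ⟨k - 2, by omega⟩
  simp only [Nat.add_sub_cancel, div_pow]
  simp only [mul_pow, pow_add] at ht ⊢
  generalize X (t * a, t * b) = x at *
  generalize Y (t * a, t * b) = y at *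
  field_simp
  linear_combination -ht

theorem IsModelSymmetry.jac_sq (hs : IsModelSymmetry k ε X Y) (hk : k = 2) (hε : ε ≠ 0) :
    jac X Y 0 ^ 2 = 1 := by
  subst hk
  have h1 := hs.linear_eq le_rfl 1 0
  have h2 := hs.linear_eq le_rfl 0 1
  have h3 := hs.linear_eq le_rfl 1 1
  simp only [jac]
  generalize dx X 0 = α at *
  generalize dy X 0 = β at *
  generalize dx Y 0 = γ at *
  generalize dy Y 0 = δ at *
  simp at h1 h2 h3
  -- Polarisation: the linear part preserves the form `ξ² + ε x²`, hence also its bilinear form.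
  -- Comparing Gram determinants gives `ε det² = ε`.
  have h4 : γ * δ + ε * (α * β) = 0 := by linear_combination (h3 - h1 - h2) / 2
  refine mul_left_cancel₀ hε ?_
  linear_combination (δ ^ 2 + ε * β ^ 2) * h1 + ε * h2 - (γ * δ + ε * (α * β)) * h4

theorem IsModelSymmetry.linear_eq_of_three_le (hs : IsModelSymmetry k ε X Y) (hk : 3 ≤ k) :
    dx Y 0 = 0 ∧ dy Y 0 ^ 2 = 1 := by
  have h0 : (0 : ℝ) ^ (k - 2) = 0 := zero_pow (by omega)
  have h1 := hs.linear_eq (by omega) 1 0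
  have h2 := hs.linear_eq (by omega) 0 1
  simp [h0] at h1 h2
  exact ⟨h1, by simpa using h2⟩

/-- On the `x`-axis the `ξ`-derivative of `H ∘ Ψ = H` reads `2 Y Y_ξ + ε k X^(k-1) X_ξ = 0` with
`Y_ξ(0) ≠ 0`, so `Y = O(t^(k-1))`. For `k ≥ 3` this makes `Y² = o(t^k)`, and comparing terms of
order `t^k` leaves `ε X_x(0)^k = ε`. -/
theorem IsModelSymmetry.pow_eq_one (hs : IsModelSymmetry k ε X Y) (hk : 3 ≤ k) (hε : ε ≠ 0) :
    dx X 0 ^ k = 1 := by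
  obtain ⟨-, hδ⟩ := hs.linear_eq_of_three_le hk
  have hδ0 : dy Y 0 ≠ 0 := by rintro h; rw [h] at hδ; simp at hδ
  have hl := tendsto_line 1 0
  have h1 : Tendsto (fun t : ℝ => X (t * 1, t * 0) / t) (𝓝[≠] 0) (𝓝 (dx X 0)) := by
    simpa using tendsto_div_line hs.anX hs.X0 1 0
  have h2 : Tendsto (fun t : ℝ => dy Y (t * 1, t * 0)) (𝓝[≠] 0) (𝓝 (dy Y 0)) :=
    (AnalyticAt.pd hs.anY _).continuousAt.tendsto.comp hl
  have h3 : Tendsto (fun t : ℝ => dy X (t * 1, t * 0)) (𝓝[≠] 0) (𝓝 (dy X 0)) :=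
    (AnalyticAt.pd hs.anX _).continuousAt.tendsto.comp hl
  have h4 := (((h1.pow (k - 1)).const_mul (-(ε * k))).mul h3).div (h2.const_mul 2)
    (mul_ne_zero two_ne_zero hδ0)
  have h5 : Tendsto (fun t : ℝ => t) (𝓝[≠] 0) (𝓝 0) := tendsto_nhdsWithin_of_tendsto_nhds tendsto_id
  have h6 := ((h4.pow 2).mul (h5.pow (k - 2))).add ((h1.pow k).const_mul ε)
  have h7 := tendsto_nhds_unique h6 ((tendsto_const_nhds (x := ε)).congr' ?_)
  · rw [zero_pow (by omega), mul_zero, zero_add] at h7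
    exact mul_left_cancel₀ hε (by rw [h7, mul_one])
  · filter_upwards [hl.eventually hs.model_eq, hl.eventually hs.deriv_eq, self_mem_nhdsWithin,
      h2.eventually_ne hδ0] with t e1 e2 ht0 hY
    have ht0 : t ≠ 0 := ht0
    have e3 := e2.2
    set x := X (t * 1, t * 0)
    set y := Y (t * 1, t * 0)
    set yy := dy Y (t * 1, t * 0)
    set xy := dy X (t * 1, t * 0)
    have e4 : -(ε * k) * (x / t) ^ (k - 1) * xy / (2 * yy) = y / t ^ (k - 1) := by
      rw [div_pow]
      field_simp
      simp at e3
      linear_combination -e3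
    simp only [Pi.div_apply]
    change ε = (-(ε * k) * (x / t) ^ (k - 1) * xy / (2 * yy)) ^ 2 * t ^ (k - 2) + ε * (x / t) ^ k
    rw [e4]
    obtain ⟨m, rfl⟩ : ∃ m, k = m + 2 := ⟨k - 2, by omega⟩
    simp only [Nat.add_sub_cancel, div_pow, show m + 2 - 1 = m + 1 by omega]
    have e5 : y ^ 2 + ε * x ^ (m + 2) = ε * t ^ (m + 2) := by simpa using e1
    rw [← pow_mul, show (m + 1) * 2 = m + (m + 2) by ring, pow_add t m]
    field_simp
    linear_combination -e5

end symmetry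

/-! ### Analytic inverses and primitives -/

/-- The analytic inverse function theorem at a fixed point with identity derivative. -/
theorem exists_analytic_inverse {E : Type*} [NormedAddCommGroup E] [NormedSpace ℝ E]
    [CompleteSpace E] {F : E → E} (hF : AnalyticAt ℝ F 0) (hF0 : F 0 = 0)
    (hd : HasFDerivAt F (ContinuousLinearMap.id ℝ E) 0) :
    ∃ G : E → E, AnalyticAt ℝ G 0 ∧ G 0 = 0 ∧ (∀ᶠ y in 𝓝 0, F (G y) = y) ∧
      ∀ᶠ x in 𝓝 0, G (F x) = x := by
  have hc : ContDiffAt ℝ ⊤ F 0 := hF.contDiffAt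
  have hd' : HasFDerivAt F ((ContinuousLinearEquiv.refl ℝ E : E ≃L[ℝ] E) : E →L[ℝ] E) 0 := hd
  have hn : (⊤ : WithTop ℕ∞) ≠ 0 := by simp
  have hs := hc.hasStrictFDerivAt' hd' hn
  have h1 := hc.to_localInverse hd' hn
  have h2 := hs.eventually_right_inverse
  have h3 := hs.eventually_left_inverse
  rw [hF0] at h1 h2
  refine ⟨hs.localInverse F _ 0, ?_, ?_, h2, h3⟩
  · exact h1.analyticAt
  · have := hs.localInverse_apply_image
    rwa [hF0] at this

section primitive
variable {F : Type*} [NormedAddCommGroup F] [NormedSpace ℝ F]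

/-- Multiplication of the first coordinate by `θ`. -/
noncomputable def scaleFst (F : Type*) [NormedAddCommGroup F] [NormedSpace ℝ F] (θ : ℝ) :
    (ℝ × F) →L[ℝ] ℝ × F :=
  (θ • ContinuousLinearMap.fst ℝ ℝ F).prod (ContinuousLinearMap.snd ℝ ℝ F)

theorem scaleFst_apply (θ : ℝ) (y : ℝ × F) : scaleFst F θ y = (θ * y.1, y.2) := by
  simp [scaleFst]

theorem norm_scaleFst_apply_le {θ : ℝ} (hθ : θ ∈ Set.Icc (0 : ℝ) 1) (y : ℝ × F) :
    ‖scaleFst F θ y‖ ≤ ‖y‖ := by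
  rw [scaleFst_apply, Prod.norm_def, Prod.norm_def]
  refine max_le_max ?_ le_rfl
  rw [norm_mul, Real.norm_eq_abs, abs_of_nonneg hθ.1]
  exact mul_le_of_le_one_left (norm_nonneg _) hθ.2

theorem norm_scaleFst_le {θ : ℝ} (hθ : θ ∈ Set.Icc (0 : ℝ) 1) : ‖scaleFst F θ‖ ≤ 1 :=
  ContinuousLinearMap.opNorm_le_bound _ zero_le_one fun y => by
    simpa using norm_scaleFst_apply_le hθ y

theorem continuous_scaleFst : Continuous (scaleFst F) := by
  have : scaleFst F = fun θ => θ • ((ContinuousLinearMap.fst ℝ ℝ F).prod 0) +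
      ((0 : (ℝ × F) →L[ℝ] ℝ).prod (ContinuousLinearMap.snd ℝ ℝ F)) := by
    ext θ y <;> simp [scaleFst]
  rw [this]
  fun_prop

/-- Scaling the first coordinate by `θ ∈ [0, 1]` does not increase norms, so the power series of `M`
can be integrated in `θ` term by term on the same ball. -/
theorem analyticAt_integral_scaleFst {M : ℝ × F → ℝ} (hM : AnalyticAt ℝ M 0) :
    AnalyticAt ℝ (fun y : ℝ × F => ∫ θ in (0 : ℝ)..1, M (θ * y.1, y.2)) 0 := by
  obtain ⟨p, r, hp⟩ := hM
  let Q : (n : ℕ) → ℝ → ContinuousMultilinearMap ℝ (fun _ : Fin n => ℝ × F) ℝ := fun n θ =>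
    (p n).compContinuousLinearMap fun _ => scaleFst F θ
  have hQc : ∀ n, Continuous (Q n) := by
    intro n
    exact (ContinuousMultilinearMap.compContinuousLinearMapLRight
      (E := fun _ : Fin n => ℝ × F) (p n)).cont.comp (continuous_pi fun _ => continuous_scaleFst)
  have hQn : ∀ n, ∀ θ ∈ Set.Icc (0 : ℝ) 1, ‖Q n θ‖ ≤ ‖p n‖ := by
    intro n θ hθ
    refine ((p n).norm_compContinuousLinearMap_le _).trans ?_
    exact mul_le_of_le_one_right (norm_nonneg _)
      (Finset.prod_le_one (fun _ _ => norm_nonneg _) fun _ _ => norm_scaleFst_le hθ)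
  let q : FormalMultilinearSeries ℝ (ℝ × F) ℝ := fun n => ∫ θ in (0 : ℝ)..1, Q n θ
  have hq : ∀ n, ‖q n‖ ≤ ‖p n‖ := by
    intro n
    have := intervalIntegral.norm_integral_le_of_norm_le_const (a := (0 : ℝ)) (b := 1)
      (f := Q n) (C := ‖p n‖) fun θ hθ => hQn n θ (by
        rw [Set.uIoc_of_le zero_le_one] at hθ; exact Set.Ioc_subset_Icc_self hθ)
    simpa using this
  have hqy : ∀ n (y : ℝ × F), q n (fun _ => y) = ∫ θ in (0 : ℝ)..1, p n (fun _ => scaleFst F θ y) := by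
    intro n y
    have := (ContinuousMultilinearMap.apply ℝ (fun _ : Fin n => ℝ × F) ℝ
      (fun _ => y)).intervalIntegral_comp_comm ((hQc n).intervalIntegrable (μ := MeasureTheory.volume) 0 1)
    exact this.symm
  refine ⟨q, r, ?_, hp.r_pos, ?_⟩
  · exact hp.r_le.trans (FormalMultilinearSeries.radius_le_of_le (fun {n} => hq n))
  · intro y hy
    rw [zero_add]
    simp only [hqy]
    have hball : ∀ θ ∈ Set.Icc (0 : ℝ) 1, scaleFst F θ y ∈ Metric.eball (0 : ℝ × F) r := by
      intro θ hθ
      rw [Metric.mem_eball, edist_zero_right] at hy ⊢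
      refine lt_of_le_of_lt ?_ hy
      rw [← ofReal_norm, ← ofReal_norm]
      exact ENNReal.ofReal_le_ofReal (norm_scaleFst_apply_le hθ y)
    have hsum : Summable fun n => ‖p n‖ * ‖y‖ ^ n := by
      have := p.summable_norm_mul_pow (r := ‖y‖₊) (by
        rw [Metric.mem_eball, edist_zero_right] at hy
        exact lt_of_lt_of_le hy hp.r_le)
      simpa using this
    have h1 := intervalIntegral.hasSum_integral_of_dominated_convergence
      (μ := MeasureTheory.volume) (a := (0 : ℝ)) (b := 1)
      (F := fun n θ => p n (fun _ => scaleFst F θ y)) (f := fun θ => M (θ * y.1, y.2))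
      (bound := fun n _ => ‖p n‖ * ‖y‖ ^ n) ?_ ?_ ?_ ?_ ?_
    · exact h1
    · intro n
      have : Continuous fun θ => p n (fun _ => scaleFst F θ y) :=
        (p n).cont.comp (continuous_pi fun _ => by
          exact (continuous_scaleFst (F := F)).clm_apply continuous_const)
      exact this.aestronglyMeasurable
    · intro n
      refine .of_forall fun θ hθ => ?_
      rw [Set.uIoc_of_le zero_le_one] at hθ
      refine ((p n).le_opNorm _).trans ?_
      gcongr
      simp only [Finset.prod_const, Finset.card_univ, Fintype.card_fin]
      gcongr
      exact norm_scaleFst_apply_le (Set.Ioc_subset_Icc_self hθ) y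
    · exact .of_forall fun θ _ => hsum
    · exact intervalIntegrable_const
    · refine .of_forall fun θ hθ => ?_
      rw [Set.uIoc_of_le zero_le_one] at hθ
      have := hp.hasSum (hball θ (Set.Ioc_subset_Icc_self hθ))
      rwa [zero_add, scaleFst_apply] at this

/-- An analytic function has an analytic primitive in the first variable. -/
theorem exists_primitive {M : ℝ × F → ℝ} (hM : AnalyticAt ℝ M 0) :
    ∃ T : ℝ × F → ℝ, AnalyticAt ℝ T 0 ∧ (∀ w, T (0, w) = 0) ∧
      ∀ᶠ q in 𝓝 (0 : ℝ × F), pd (1, 0) T q = M q := by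
  have hK := analyticAt_integral_scaleFst hM
  -- The substitution `σ = θ y.1` turns the primitive into an integral over a fixed interval, where
  -- analyticity is already known.
  set T : ℝ × F → ℝ := fun y => y.1 * ∫ θ in (0 : ℝ)..1, M (θ * y.1, y.2) with hT
  have hTa : AnalyticAt ℝ T 0 := analyticAt_fst.mul hK
  refine ⟨T, hTa, fun w => by simp [hT], ?_⟩
  have hTi : ∀ y : ℝ × F, T y = ∫ σ in (0 : ℝ)..y.1, M (σ, y.2) := by
    intro y
    have := intervalIntegral.mul_integral_comp_mul_left (a := (0 : ℝ)) (b := 1)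
      (f := fun σ => M (σ, y.2)) y.1
    simp only [mul_zero, mul_one] at this
    rw [← this]
    simp only [hT, mul_comm]
  obtain ⟨δ, hδ, hball⟩ := Metric.eventually_nhds_iff_ball.1 (hM.eventually_analyticAt)
  filter_upwards [hTa.eventually_analyticAt, Metric.ball_mem_nhds (0 : ℝ × F) hδ] with y hy hyb
  have hyn : |y.1| < δ ∧ ‖y.2‖ < δ := by
    rw [mem_ball_zero_iff, Prod.norm_def, max_lt_iff] at hyb; exact hyb
  have hcont : ∀ σ ∈ Metric.ball (0 : ℝ) δ, ContinuousAt (fun σ => M (σ, y.2)) σ := by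
    intro σ hσ
    have h1 : ContinuousAt M (σ, y.2) := (hball _ (by
      rw [mem_ball_zero_iff, Prod.norm_def, max_lt_iff]
      exact ⟨by simpa using hσ, hyn.2⟩)).continuousAt
    exact h1.comp (f := fun σ => (σ, y.2)) (by fun_prop)
  have hy1 : y.1 ∈ Metric.ball (0 : ℝ) δ := by simpa using hyn.1
  have hseg : Set.uIcc 0 y.1 ⊆ Metric.ball (0 : ℝ) δ :=
    (convex_ball (0 : ℝ) δ).ordConnected.uIcc_subset (by simpa using hδ) hy1
  have hco : ContinuousOn (fun σ => M (σ, y.2)) (Metric.ball (0 : ℝ) δ) := fun σ hσ =>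
    (hcont σ hσ).continuousWithinAt
  have hd := intervalIntegral.integral_hasDerivAt_right (f := fun σ => M (σ, y.2)) (a := 0) (b := y.1)
    ((hco.mono hseg).intervalIntegrable)
    (hco.stronglyMeasurableAtFilter Metric.isOpen_ball _ hy1) (hcont _ hy1)
  have hline : HasDerivAt (fun t : ℝ => T (t, y.2)) (pd (1, 0) T y) y.1 := by
    have h3 : HasDerivAt (fun t : ℝ => ((t, y.2) : ℝ × F)) (1, 0) y.1 :=
      (hasDerivAt_id _).prodMk (hasDerivAt_const _ _)
    exact hy.differentiableAt.hasFDerivAt.comp_hasDerivAt_of_eq y.1 h3 rfl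
  simp only [hTi] at hline
  exact hline.unique hd

/-- A function with zero derivative in the first variable that vanishes on `{0} × F` vanishes. -/
theorem eventually_eq_zero_of_pd {Q : ℝ × F → ℝ} (hQ : AnalyticAt ℝ Q 0)
    (h0 : ∀ᶠ w in 𝓝 (0 : F), Q (0, w) = 0) (hd : ∀ᶠ q in 𝓝 (0 : ℝ × F), pd (1, 0) Q q = 0) :
    ∀ᶠ q in 𝓝 (0 : ℝ × F), Q q = 0 := by
  have h1 : ∀ᶠ q in 𝓝 (0 : ℝ × F), Q (0, q.2) = 0 :=
    (continuous_snd.tendsto' (0 : ℝ × F) (0 : F) rfl).eventually h0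
  obtain ⟨δ, hδ, hball⟩ := Metric.eventually_nhds_iff_ball.1
    ((hQ.eventually_analyticAt).and (hd.and h1))
  filter_upwards [Metric.ball_mem_nhds (0 : ℝ × F) hδ] with y hyb
  have hyn : |y.1| < δ ∧ ‖y.2‖ < δ := by
    rw [mem_ball_zero_iff, Prod.norm_def, max_lt_iff] at hyb; exact hyb
  have hmem : ∀ t ∈ Metric.ball (0 : ℝ) δ, (t, y.2) ∈ Metric.ball (0 : ℝ × F) δ := by
    intro t ht
    rw [mem_ball_zero_iff, Prod.norm_def, max_lt_iff]
    exact ⟨by simpa using ht, hyn.2⟩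
  have hder : ∀ t ∈ Metric.ball (0 : ℝ) δ, HasDerivAt (fun t : ℝ => Q (t, y.2)) 0 t := by
    intro t ht
    have h2 := hball _ (hmem t ht)
    have h3 : HasDerivAt (fun t : ℝ => ((t, y.2) : ℝ × F)) (1, 0) t :=
      (hasDerivAt_id _).prodMk (hasDerivAt_const _ _)
    have h4 := h2.1.differentiableAt.hasFDerivAt.comp_hasDerivAt_of_eq t h3 rfl
    rw [← h2.2.1]
    exact h4
  have hy1 : y.1 ∈ Metric.ball (0 : ℝ) δ := by simpa using hyn.1
  have h00 : (0 : ℝ) ∈ Metric.ball (0 : ℝ) δ := by simpa using hδ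
  have := Metric.isOpen_ball.is_const_of_deriv_eq_zero (convex_ball (0 : ℝ) δ).isPreconnected
    (fun t ht => (hder t ht).differentiableAt.differentiableWithinAt)
    (fun t ht => (hder t ht).deriv) hy1 h00
  exact this.trans (hball y hyb).2.2

end primitive

/-! ### An explicit analytic flow along the level curves -/

section coordinates
variable (q v : ℝ × Plane)

theorem pd_clm {E : Type*} [NormedAddCommGroup E] [NormedSpace ℝ E] (L : E →L[ℝ] ℝ) (p v : E) :
    pd v (fun q => L q) p = L v := by simp [ASing.pd]

theorem pd_time : pd v (fun q : ℝ × Plane => q.1) q = v.1 :=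
  pd_clm (ContinuousLinearMap.fst ℝ ℝ Plane) q v

theorem pd_posX : pd v (fun q : ℝ × Plane => q.2.1) q = v.2.1 :=
  pd_clm ((ContinuousLinearMap.fst ℝ ℝ ℝ).comp (ContinuousLinearMap.snd ℝ ℝ Plane)) q v

theorem pd_posY : pd v (fun q : ℝ × Plane => q.2.2) q = v.2.2 :=
  pd_clm ((ContinuousLinearMap.snd ℝ ℝ ℝ).comp (ContinuousLinearMap.snd ℝ ℝ Plane)) q v

end coordinates

/-- The divided difference `((x + u)^k - x^k) / u` as a polynomial in `(x, u)`. -/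
noncomputable def divDiff (k : ℕ) (q : Plane) : ℝ :=
  ∑ i ∈ Finset.range k, (q.1 + q.2) ^ i * q.1 ^ (k - 1 - i)

theorem mul_divDiff (k : ℕ) (q : Plane) : q.2 * divDiff k q = (q.1 + q.2) ^ k - q.1 ^ k := by
  have := (Commute.all (q.1 + q.2) q.1).geom_sum₂_mul k
  rw [← this, divDiff]; ring

theorem analyticAt_divDiff (k : ℕ) (q : Plane) : AnalyticAt ℝ (divDiff k) q :=
  Finset.analyticAt_fun_sum _ fun i _ =>
    ((analyticAt_fst.add analyticAt_snd).pow i).mul (analyticAt_fst.pow _)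

theorem divDiff_zero {k : ℕ} (hk : 2 ≤ k) : divDiff k 0 = 0 := by
  refine Finset.sum_eq_zero fun i _ => ?_
  rcases i with _ | i
  · simp; omega
  · simp

theorem dy_divDiff (k : ℕ) (q : Plane) :
    divDiff k q + q.2 * dy (divDiff k) q = k * (q.1 + q.2) ^ (k - 1) := by
  have h1 : (fun q : Plane => q.2 * divDiff k q) = fun q => (q.1 + q.2) ^ k - q.1 ^ k :=
    funext (mul_divDiff k)
  have h2 := congrArg (fun f => dy f q) h1
  have := (analyticAt_divDiff k q).differentiableAt
  simp (disch := fun_prop) only [pd_mul, pd_sub, pd_pow, pd_add, pd_fst, pd_snd] at h2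
  simp at h2
  linarith

theorem hasFDerivAt_mul_zero {E : Type*} [NormedAddCommGroup E] [NormedSpace ℝ E] {f g : E → ℝ}
    (hf : DifferentiableAt ℝ f 0) (hg : DifferentiableAt ℝ g 0) (hf0 : f 0 = 0) (hg0 : g 0 = 0) :
    HasFDerivAt (fun z => f z * g z) (0 : E →L[ℝ] ℝ) 0 := by
  have := hf.hasFDerivAt.mul hg.hasFDerivAt
  simpa [hf0, hg0] using! this

/-- A one-parameter family of maps preserving the model Hamiltonian, moving along its level curves
with speed `r` times the Hamiltonian field. -/
structure IsEnergyFlow (k : ℕ) (ε : ℝ) (X Y r : ℝ × Plane → ℝ) : Prop where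
  anX : AnalyticAt ℝ X 0
  anY : AnalyticAt ℝ Y 0
  anr : AnalyticAt ℝ r 0
  r0 : r 0 = 1
  initX : ∀ᶠ p in 𝓝 (0 : Plane), X (0, p) = p.1
  initY : ∀ᶠ p in 𝓝 (0 : Plane), Y (0, p) = p.2
  model_eq : ∀ᶠ q in 𝓝 (0 : ℝ × Plane), Y q ^ 2 + ε * X q ^ k = q.2.2 ^ 2 + ε * q.2.1 ^ k
  derivX : ∀ᶠ q in 𝓝 (0 : ℝ × Plane), pd (1, 0) X q = r q * (2 * Y q)
  derivY : ∀ᶠ q in 𝓝 (0 : ℝ × Plane), pd (1, 0) Y q = -(r q * (ε * k * X q ^ (k - 1)))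

/-- A discrete-gradient step for the Hamiltonian field: the derivatives of `ξ²` and `x^k` are
replaced by the divided differences `2ξ + V` and `divDiff`. The changes `V (2ξ + V)` and `ε U ·
divDiff` of the two terms of `H` then cancel exactly. -/
theorem exists_increments {k : ℕ} (hk : 2 ≤ k) (ε : ℝ) :
    ∃ U V : ℝ × Plane → ℝ, AnalyticAt ℝ U 0 ∧ AnalyticAt ℝ V 0 ∧ U 0 = 0 ∧ V 0 = 0 ∧
      ∀ᶠ q in 𝓝 (0 : ℝ × Plane), U q = q.1 * (2 * q.2.2 + V q) ∧
        V q = -(ε * q.1 * divDiff k (q.2.1, U q)) := by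
  -- The zeros of the last two components are the solutions `(U, V)`. The coupling terms are
  -- products of two functions vanishing at the origin, so `F` has identity derivative there.
  set F : (ℝ × Plane) × Plane → (ℝ × Plane) × Plane := fun z =>
    (z.1, (z.2.1 - z.1.1 * (2 * z.1.2.2 + z.2.2),
      z.2.2 + z.1.1 * (ε * divDiff k (z.1.2.1, z.2.1)))) with hF
  have hD : AnalyticAt ℝ (fun z : (ℝ × Plane) × Plane => divDiff k (z.1.2.1, z.2.1)) 0 :=
    AnalyticAt.fun_comp (g := divDiff k) (f := fun z : (ℝ × Plane) × Plane => (z.1.2.1, z.2.1))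
      (analyticAt_divDiff k _)
      ((analyticAt_fst.comp (analyticAt_snd.comp analyticAt_fst)).prod
        (analyticAt_fst.comp analyticAt_snd))
  have a1 : AnalyticAt ℝ (fun z : (ℝ × Plane) × Plane => z.1) 0 := analyticAt_fst
  have a11 : AnalyticAt ℝ (fun z : (ℝ × Plane) × Plane => z.1.1) 0 := analyticAt_fst.comp analyticAt_fst
  have a122 : AnalyticAt ℝ (fun z : (ℝ × Plane) × Plane => z.1.2.2) 0 :=
    analyticAt_snd.comp (analyticAt_snd.comp analyticAt_fst)
  have a21 : AnalyticAt ℝ (fun z : (ℝ × Plane) × Plane => z.2.1) 0 := analyticAt_fst.comp analyticAt_snd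
  have a22 : AnalyticAt ℝ (fun z : (ℝ × Plane) × Plane => z.2.2) 0 := analyticAt_snd.comp analyticAt_snd
  have g1 : AnalyticAt ℝ (fun z : (ℝ × Plane) × Plane => 2 * z.1.2.2 + z.2.2) 0 :=
    (analyticAt_const.mul a122).add a22
  have g2 : AnalyticAt ℝ (fun z : (ℝ × Plane) × Plane => ε * divDiff k (z.1.2.1, z.2.1)) 0 :=
    analyticAt_const.mul hD
  have hFa : AnalyticAt ℝ F 0 :=
    a1.prod ((a21.sub (a11.mul g1)).prod (a22.add (a11.mul g2)))
  have hD0 : divDiff k ((0 : ℝ), (0 : ℝ)) = 0 := divDiff_zero hk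
  have hF0 : F 0 = 0 := by simp [hF]
  have hd : HasFDerivAt F (ContinuousLinearMap.id ℝ _) 0 := by
    have e1 := hasFDerivAt_mul_zero a11.differentiableAt g1.differentiableAt (by simp) (by simp)
    have e2 := hasFDerivAt_mul_zero a11.differentiableAt g2.differentiableAt (by simp)
      (by simp [hD0])
    have e3 := (hasFDerivAt_id (𝕜 := ℝ) (0 : (ℝ × Plane) × Plane)).add
      ((hasFDerivAt_const (0 : ℝ × Plane) (0 : (ℝ × Plane) × Plane)).prodMk (e1.neg.prodMk e2))
    convert! e3 using 1
    · ext <;> simp [hF, sub_eq_add_neg]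
    · ext <;> simp
  obtain ⟨G, hG, hG0, hFG, -⟩ := exists_analytic_inverse hFa hF0 hd
  have hι : AnalyticAt ℝ (fun q : ℝ × Plane => (q, (0 : Plane))) 0 :=
    analyticAt_id.prod analyticAt_const
  have hGι : AnalyticAt ℝ (fun q : ℝ × Plane => G (q, 0)) 0 :=
    AnalyticAt.fun_comp (f := fun q : ℝ × Plane => (q, (0 : Plane))) hG hι
  have hG00 : G ((0 : ℝ × Plane), (0 : Plane)) = 0 := hG0
  refine ⟨fun q => (G (q, 0)).2.1, fun q => (G (q, 0)).2.2,
    analyticAt_fst.comp (analyticAt_snd.comp hGι), analyticAt_snd.comp (analyticAt_snd.comp hGι),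
    by simp [hG00], by simp [hG00], ?_⟩
  have ht : Tendsto (fun q : ℝ × Plane => (q, (0 : Plane))) (𝓝 0) (𝓝 0) := hι.continuousAt.tendsto
  filter_upwards [ht.eventually hFG] with q hq
  simp only [hF, Prod.mk.injEq, Prod.mk_eq_zero] at hq
  obtain ⟨h1, h2, h3⟩ := hq
  rw [h1] at h2 h3
  exact ⟨by linarith, by linarith⟩

/-- Since the step preserves `H` exactly, its velocity in `t` is tangent to the level curves;
differentiating the two implicit equations in `t` shows that it is `1/m` times the Hamiltonian field
at the moved point. -/
theorem exists_energyFlow {k : ℕ} (hk : 2 ≤ k) (ε : ℝ) :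
    ∃ X Y r : ℝ × Plane → ℝ, IsEnergyFlow k ε X Y r := by
  obtain ⟨U, V, hU, hV, hU0, hV0, h⟩ := exists_increments hk ε
  have a1 : AnalyticAt ℝ (fun q : ℝ × Plane => q.1) 0 := analyticAt_fst
  have a21 : AnalyticAt ℝ (fun q : ℝ × Plane => q.2.1) 0 := analyticAt_fst.comp analyticAt_snd
  have a22 : AnalyticAt ℝ (fun q : ℝ × Plane => q.2.2) 0 := analyticAt_snd.comp analyticAt_snd
  have hP : AnalyticAt ℝ (fun q : ℝ × Plane => dy (divDiff k) (q.2.1, U q)) 0 :=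
    AnalyticAt.fun_comp (f := fun q : ℝ × Plane => (q.2.1, U q))
      (AnalyticAt.pd (analyticAt_divDiff k _) _) (a21.prod hU)
  -- The determinant of the linear system for `(∂_t U, ∂_t V)`.
  set m : ℝ × Plane → ℝ := fun q => 1 + ε * q.1 ^ 2 * dy (divDiff k) (q.2.1, U q) with hm
  have hma : AnalyticAt ℝ m 0 := analyticAt_const.add ((analyticAt_const.mul (a1.pow 2)).mul hP)
  have hm0 : m 0 = 1 := by simp [hm]
  have hinit : ∀ᶠ p in 𝓝 (0 : Plane), U (0, p) = 0 ∧ V (0, p) = 0 := by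
    have ht : Tendsto (fun p : Plane => ((0 : ℝ), p)) (𝓝 0) (𝓝 0) :=
      (by fun_prop : Continuous fun p : Plane => ((0 : ℝ), p)).tendsto' _ _ rfl
    filter_upwards [ht.eventually h] with p hp
    constructor
    · simpa using hp.1
    · simpa using hp.2
  have hder : ∀ᶠ q in 𝓝 (0 : ℝ × Plane),
      m q ≠ 0 ∧ m q * pd (1, 0) U q = 2 * (q.2.2 + V q) ∧
        m q * pd (1, 0) V q = -(ε * k * (q.2.1 + U q) ^ (k - 1)) := by
    filter_upwards [h, pd_congr (h.mono fun q hq => hq.1) (1, 0),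
      pd_congr (h.mono fun q hq => hq.2) (1, 0), hU.eventually_analyticAt,
      hV.eventually_analyticAt, hma.continuousAt.eventually_ne (hm0.trans_ne one_ne_zero)]
      with q ⟨h1, h2⟩ e1 e2 dU dV hne
    have dU := dU.differentiableAt
    have dV := dV.differentiableAt
    have c1 : DifferentiableAt ℝ (fun q : ℝ × Plane => q.1) q := by fun_prop
    have c22 : DifferentiableAt ℝ (fun q : ℝ × Plane => q.2.2) q := by fun_prop
    have c21 : DifferentiableAt ℝ (fun q : ℝ × Plane => q.2.1) q := by fun_prop
    have z1 : pd (1, 0) (fun q : ℝ × Plane => q.1) q = 1 := pd_time q _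
    have z22 : pd (1, 0) (fun q : ℝ × Plane => q.2.2) q = 0 := pd_posY q _
    have z21 : pd (1, 0) (fun q : ℝ × Plane => q.2.1) q = 0 := pd_posX q _
    have dP : DifferentiableAt ℝ (fun q : ℝ × Plane => divDiff k (q.2.1, U q)) q :=
      DifferentiableAt.comp (g := divDiff k) (f := fun q : ℝ × Plane => (q.2.1, U q)) q
        (analyticAt_divDiff k (q.2.1, U q)).differentiableAt (c21.prodMk dU)
    have zP := pd_comp (analyticAt_divDiff k (q.2.1, U q)).differentiableAt c21 dU (1, 0)
    have key := dy_divDiff k (q.2.1, U q)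
    have e2' : pd (1, 0) V q = -(ε * divDiff k (q.2.1, U q) +
        ε * q.1 * (dy (divDiff k) (q.2.1, U q) * pd (1, 0) U q)) := by
      have : (fun q : ℝ × Plane => -(ε * q.1 * divDiff k (q.2.1, U q))) =
        fun q => (-ε) * q.1 * divDiff k (q.2.1, U q) := by ext q; ring
      rw [e2, this]
      simp (disch := fun_prop) only [pd_mul, pd_const, z1, zP, z21]
      ring
    simp (disch := fun_prop) only [pd_mul, pd_add, pd_const, z1, z22] at e1
    refine ⟨hne, ?_, ?_⟩
    · simp only [hm]
      linear_combination e1 + q.1 * e2' - h2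
    · simp only [hm]
      simp only at key
      linear_combination e2' - (ε * q.1 * dy (divDiff k) (q.2.1, U q)) * e1 -
        ε * key + (ε * dy (divDiff k) (q.2.1, U q)) * h1
  refine ⟨fun q => q.2.1 + U q, fun q => q.2.2 + V q, fun q => (m q)⁻¹,
    a21.add hU, a22.add hV, hma.inv (by rw [hm0]; norm_num), by simp [hm0], ?_, ?_, ?_, ?_, ?_⟩
  · filter_upwards [hinit] with p hp
    simp [hp.1]
  · filter_upwards [hinit] with p hp
    simp [hp.2]
  · filter_upwards [h] with q hq
    have := mul_divDiff k (q.2.1, U q)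
    simp only at this
    linear_combination (-ε) * this + (2 * q.2.2 + V q) * hq.2 +
      (ε * divDiff k (q.2.1, U q)) * hq.1
  · filter_upwards [hder, hU.eventually_analyticAt] with q ⟨h0, h1, h2⟩ dU
    have z21 : pd (1, 0) (fun q : ℝ × Plane => q.2.1) q = 0 := pd_posX q _
    rw [pd_add (by fun_prop) dU.differentiableAt, z21, ← h1]
    field_simp; ring
  · filter_upwards [hder, hV.eventually_analyticAt] with q ⟨h0, h1, h2⟩ dV
    have z22 : pd (1, 0) (fun q : ℝ × Plane => q.2.2) q = 0 := pd_posY q _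
    rw [pd_add (by fun_prop) dV.differentiableAt, z22, ← mul_neg, ← h2]
    field_simp; ring

theorem tendsto_zero_prod : Tendsto (fun p : Plane => ((0 : ℝ), p)) (𝓝 0) (𝓝 0) :=
  (by fun_prop : Continuous fun p : Plane => ((0 : ℝ), p)).tendsto' _ _ rfl

/-- The chain rule along the graph of a function. -/
theorem pd_graph {g : ℝ × Plane → ℝ} {σ : Plane → ℝ} {p : Plane}
    (hg : DifferentiableAt ℝ g (σ p, p)) (hσ : DifferentiableAt ℝ σ p) (v : Plane) :
    pd v (fun p => g (σ p, p)) p = pd (1, 0) g (σ p, p) * pd v σ p + pd (0, v) g (σ p, p) := by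
  have h1 := (HasFDerivAt.comp (f := fun p => (σ p, p)) (g := g) p hg.hasFDerivAt
    (hσ.hasFDerivAt.prodMk (hasFDerivAt_id p))).fderiv
  have h2 : pd v (fun p => g (σ p, p)) p = fderiv ℝ g (σ p, p) (pd v σ p, v) := by
    simp only [ASing.pd]
    erw [h1]; rfl
  have h3 : ((pd v σ p, v) : ℝ × Plane) = pd v σ p • ((1, 0) : ℝ × Plane) + (0, v) := by
    ext <;> simp
  rw [h2, h3, map_add, map_smul]
  simp only [ASing.pd, smul_eq_mul]
  ring

theorem pd_zero_prod {g : ℝ × Plane → ℝ} {p : Plane} (hg : DifferentiableAt ℝ g (0, p))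
    (v : Plane) : pd (0, v) g (0, p) = pd v (fun p => g (0, p)) p := by
  rw [pd_graph (σ := fun _ => 0) hg (differentiableAt_const _), pd_const]; ring

/-! ### Realising a change of density by a symmetry -/

section flow
variable {k : ℕ} {ε : ℝ} {X Y r : ℝ × Plane → ℝ}

theorem IsEnergyFlow.X0 (hf : IsEnergyFlow k ε X Y r) : X 0 = 0 := hf.initX.self_of_nhds
theorem IsEnergyFlow.Y0 (hf : IsEnergyFlow k ε X Y r) : Y 0 = 0 := hf.initY.self_of_nhds

theorem IsEnergyFlow.spatial_deriv (hf : IsEnergyFlow k ε X Y r) :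
    ∀ᶠ q in 𝓝 (0 : ℝ × Plane),
      (2 * Y q * pd (0, 1, 0) Y q + ε * k * X q ^ (k - 1) * pd (0, 1, 0) X q =
        ε * k * q.2.1 ^ (k - 1)) ∧
      (2 * Y q * pd (0, 0, 1) Y q + ε * k * X q ^ (k - 1) * pd (0, 0, 1) X q = 2 * q.2.2) := by
  filter_upwards [pd_congr hf.model_eq (0, 1, 0), pd_congr hf.model_eq (0, 0, 1),
    hf.anX.eventually_analyticAt, hf.anY.eventually_analyticAt] with q e1 e2 hX hY
  have hX := hX.differentiableAt
  have hY := hY.differentiableAt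
  simp (disch := fun_prop) only [pd_add, pd_mul, pd_const, pd_posX, pd_posY, pd_pow] at e1 e2
  constructor
  · simp at e1; linear_combination e1
  · simp at e2; linear_combination e2

variable {h : Plane → ℝ}

theorem IsEnergyFlow.analyticAt_comp (hf : IsEnergyFlow k ε X Y r) (hh : AnalyticAt ℝ h 0) :
    AnalyticAt ℝ (fun q => h (X q, Y q)) 0 := by
  refine AnalyticAt.fun_comp (f := fun p => (X p, Y p)) ?_ (hf.anX.prod hf.anY)
  simpa only [hf.X0, hf.Y0] using! hh

theorem IsEnergyFlow.tendsto (hf : IsEnergyFlow k ε X Y r) :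
    Tendsto (fun p => (X p, Y p)) (𝓝 0) (𝓝 (0 : Plane)) := by
  have := (hf.anX.continuousAt.prodMk hf.anY.continuousAt).tendsto
  simpa only [hf.X0, hf.Y0] using! this

/-- The density of the pull-back of `h dx ∧ dξ` by the maps of the flow. -/
theorem IsEnergyFlow.density (hf : IsEnergyFlow k ε X Y r) (hh : AnalyticAt ℝ h 0)
    {T : ℝ × Plane → ℝ} (hT : AnalyticAt ℝ T 0) (hT0 : ∀ p, T (0, p) = 0)
    (hTM : ∀ᶠ q in 𝓝 (0 : ℝ × Plane), pd (1, 0) T q = r q * h (X q, Y q)) :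
    ∀ᶠ q in 𝓝 (0 : ℝ × Plane),
      h (X q, Y q) * (pd (0, 1, 0) X q * pd (0, 0, 1) Y q - pd (0, 0, 1) X q * pd (0, 1, 0) Y q) =
        h q.2 + (pd (0, 1, 0) T q * (2 * q.2.2) -
          pd (0, 0, 1) T q * (ε * k * q.2.1 ^ (k - 1))) := by
  have aX := hf.anX
  have aY := hf.anY
  have aXx := AnalyticAt.pd aX (0, 1, 0)
  have aXy := AnalyticAt.pd aX (0, 0, 1)
  have aYx := AnalyticAt.pd aY (0, 1, 0)
  have aYy := AnalyticAt.pd aY (0, 0, 1)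
  have aTx := AnalyticAt.pd hT (0, 1, 0)
  have aTy := AnalyticAt.pd hT (0, 0, 1)
  have aH := hf.analyticAt_comp hh
  have aH2 : AnalyticAt ℝ (fun q : ℝ × Plane => h q.2) 0 :=
    AnalyticAt.fun_comp (f := fun q : ℝ × Plane => q.2) hh analyticAt_snd
  have a21 : AnalyticAt ℝ (fun q : ℝ × Plane => q.2.1) 0 := analyticAt_fst.comp analyticAt_snd
  have a22 : AnalyticAt ℝ (fun q : ℝ × Plane => q.2.2) 0 := analyticAt_snd.comp analyticAt_snd
  -- `Q` is the defect of the identity. It vanishes at time `0`, where the map is the identity and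
  -- `T = 0`. Its time derivative vanishes by Cartan's formula: contracting `h dx ∧ dξ` with the
  -- velocity gives `r h dH`, and `dH` is preserved, so the pull-back changes at the rate `d(∂_t T)
  -- ∧ dH`.
  set Q : ℝ × Plane → ℝ := fun q => h (X q, Y q) *
      (pd (0, 1, 0) X q * pd (0, 0, 1) Y q - pd (0, 0, 1) X q * pd (0, 1, 0) Y q) -
    h q.2 - (pd (0, 1, 0) T q * (2 * q.2.2) - pd (0, 0, 1) T q * (ε * k * q.2.1 ^ (k - 1))) with hQ
  have aQ : AnalyticAt ℝ Q 0 :=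
    ((aH.fun_mul ((aXx.fun_mul aYy).fun_sub (aXy.fun_mul aYx))).fun_sub aH2).fun_sub
      ((aTx.fun_mul (analyticAt_const.fun_mul a22)).fun_sub
        (aTy.fun_mul (analyticAt_const.fun_mul (a21.fun_pow _))))
  have hQ0 : ∀ᶠ p in 𝓝 (0 : Plane), Q (0, p) = 0 := by
    filter_upwards [tendsto_zero_prod.eventually aX.eventually_analyticAt,
      tendsto_zero_prod.eventually aY.eventually_analyticAt,
      tendsto_zero_prod.eventually hT.eventually_analyticAt,
      hf.initX, hf.initY, pd_congr hf.initX (1, 0), pd_congr hf.initX (0, 1),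
      pd_congr hf.initY (1, 0), pd_congr hf.initY (0, 1)] with p dX dY dT i1 i2 j1 j2 j3 j4
    simp only [hQ]
    rw [pd_zero_prod dX.differentiableAt, pd_zero_prod dX.differentiableAt,
      pd_zero_prod dY.differentiableAt, pd_zero_prod dY.differentiableAt,
      pd_zero_prod dT.differentiableAt, pd_zero_prod dT.differentiableAt, j1, j2, j3, j4, i1, i2]
    simp only [hT0, pd_const, pd_fst, pd_snd]
    ring
  have hQs : ∀ᶠ q in 𝓝 (0 : ℝ × Plane), pd (1, 0) Q q = 0 := by
    filter_upwards [aX.eventually_analyticAt, aY.eventually_analyticAt, hT.eventually_analyticAt,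
      hf.anr.eventually_analyticAt, aH2.eventually_analyticAt,
      aH.eventually_analyticAt, hf.tendsto.eventually hh.eventually_analyticAt, hf.spatial_deriv,
      hf.derivX, hf.derivY,
      pd_congr hf.derivX (0, 1, 0), pd_congr hf.derivX (0, 0, 1),
      pd_congr hf.derivY (0, 1, 0), pd_congr hf.derivY (0, 0, 1),
      pd_congr hTM (0, 1, 0), pd_congr hTM (0, 0, 1)]
      with q hX hY hTq hr hH2 hH hhq ⟨e1, e2⟩ sX sY sXx sXy sYx sYy sTx sTy
    have dX := hX.differentiableAt
    have dY := hY.differentiableAt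
    have dT := hTq.differentiableAt
    have dr := hr.differentiableAt
    have dH := hH.differentiableAt
    have dH2 := hH2.differentiableAt
    have dXx := (AnalyticAt.pd hX (0, 1, 0)).differentiableAt
    have dXy := (AnalyticAt.pd hX (0, 0, 1)).differentiableAt
    have dYx := (AnalyticAt.pd hY (0, 1, 0)).differentiableAt
    have dYy := (AnalyticAt.pd hY (0, 0, 1)).differentiableAt
    have dTx := (AnalyticAt.pd hTq (0, 1, 0)).differentiableAt
    have dTy := (AnalyticAt.pd hTq (0, 0, 1)).differentiableAt
    have ch := fun v => pd_comp hhq.differentiableAt dX dY v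
    have dh := hhq.differentiableAt
    have hd : DifferentiableAt ℝ h q.2 :=
      DifferentiableAt.comp (f := fun p : Plane => (q.1, p)) (g := fun q : ℝ × Plane => h q.2)
        q.2 dH2 (by fun_prop)
    have z : pd (1, 0) (fun q : ℝ × Plane => h q.2) q = 0 := by
      simp only [ASing.pd]
      have := (hd.hasFDerivAt.comp q (hasFDerivAt_snd (p := q) (𝕜 := ℝ))).fderiv
      erw [this]
      simp
    have cXx := pd_comm hX (1, 0) (0, 1, 0)
    have cXy := pd_comm hX (1, 0) (0, 0, 1)
    have cYx := pd_comm hY (1, 0) (0, 1, 0)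
    have cYy := pd_comm hY (1, 0) (0, 0, 1)
    have cTx := pd_comm hTq (1, 0) (0, 1, 0)
    have cTy := pd_comm hTq (1, 0) (0, 0, 1)
    have sYx' : pd (0, 1, 0) (pd (1, 0) Y) q = pd (0, 1, 0) (fun q => (-1) * (r q * (ε * k * X q ^ (k - 1)))) q := by
      rw [sYx]; congr 1; ext q; ring
    have sYy' : pd (0, 0, 1) (pd (1, 0) Y) q = pd (0, 0, 1) (fun q => (-1) * (r q * (ε * k * X q ^ (k - 1)))) q := by
      rw [sYy]; congr 1; ext q; ring
    simp (disch := fun_prop) only [pd_mul, pd_const, pd_pow, ch] at sXx sXy sYx' sYy' sTx sTy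
    simp only [hQ]
    simp (disch := fun_prop) only [pd_mul, pd_sub, pd_const, pd_pow, ch, pd_posX, pd_posY, z,
      cXx, cXy, cYx, cYy, cTx, cTy, sXx, sXy, sYx', sYy', sTx, sTy, sX, sY, Prod.fst_zero,
      Prod.snd_zero]
    linear_combination (pd (0, 1, 0) r q * h (X q, Y q) + r q *
      (pd (1, 0) h (X q, Y q) * pd (0, 1, 0) X q + pd (0, 1) h (X q, Y q) * pd (0, 1, 0) Y q)) * e2 -
      (pd (0, 0, 1) r q * h (X q, Y q) + r q *
      (pd (1, 0) h (X q, Y q) * pd (0, 0, 1) X q + pd (0, 1) h (X q, Y q) * pd (0, 0, 1) Y q)) * e1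
  filter_upwards [eventually_eq_zero_of_pd aQ hQ0 hQs] with q hq
  simp only [hQ] at hq
  linarith

/-- Solution `σ` of `T (σ p, p) = τ p`. -/
theorem exists_implicit {T : ℝ × Plane → ℝ} (hT : AnalyticAt ℝ T 0) (hT0 : ∀ p, T (0, p) = 0)
    (hTs : pd (1, 0) T 0 ≠ 0) {τ : Plane → ℝ} (hτ : AnalyticAt ℝ τ 0) (hτ0 : τ 0 = 0) :
    ∃ σ : Plane → ℝ, AnalyticAt ℝ σ 0 ∧ σ 0 = 0 ∧ ∀ᶠ p in 𝓝 (0 : Plane), T (σ p, p) = τ p := by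
  set c := pd (1, 0) T 0 with hc
  -- As `T` vanishes at time `0`, only its time derivative `c` survives at the origin; the factor
  -- `c⁻¹` makes the derivative of `F` the identity.
  set F : ℝ × Plane → ℝ × Plane := fun q => (c⁻¹ * T q, q.2) with hF
  have hFa : AnalyticAt ℝ F 0 := (analyticAt_const.mul hT).prod analyticAt_snd
  have hT00 : T 0 = 0 := hT0 0
  have hF0 : F 0 = 0 := by simp [hF, hT00]
  have hd : HasFDerivAt F (ContinuousLinearMap.id ℝ _) 0 := by
    have e1 := (hT.differentiableAt.hasFDerivAt.const_mul c⁻¹).prodMk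
      (hasFDerivAt_snd (𝕜 := ℝ) (p := (0 : ℝ × Plane)))
    convert! e1 using 1
    refine ContinuousLinearMap.ext fun q => ?_
    have h1 : fderiv ℝ T 0 q = c * q.1 := by
      have h2 : q = q.1 • ((1, 0) : ℝ × Plane) + (0, q.2) := by ext <;> simp
      have h3 : fderiv ℝ T 0 (0, q.2) = 0 := by
        have := pd_zero_prod (p := 0) (g := T) hT.differentiableAt q.2
        simp only [hT0, pd_const] at this
        exact this
      conv_lhs => rw [h2, map_add, map_smul, h3]
      rw [hc, ASing.pd, smul_eq_mul]; ring
    ext <;> simp [h1, hTs]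
  obtain ⟨G, hG, hG0, hFG, -⟩ := exists_analytic_inverse hFa hF0 hd
  have hι : AnalyticAt ℝ (fun p : Plane => (c⁻¹ * τ p, p)) 0 :=
    (analyticAt_const.mul hτ).prod analyticAt_id
  have hι0 : ((c⁻¹ * τ 0, (0 : Plane)) : ℝ × Plane) = 0 := by simp [hτ0]
  have hGι : AnalyticAt ℝ (fun p : Plane => G (c⁻¹ * τ p, p)) 0 :=
    AnalyticAt.fun_comp (f := fun p : Plane => (c⁻¹ * τ p, p)) (by rw [hι0]; exact hG) hι
  refine ⟨fun p => (G (c⁻¹ * τ p, p)).1, analyticAt_fst.comp hGι, by simp [hι0, hG0], ?_⟩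
  have ht : Tendsto (fun p : Plane => (c⁻¹ * τ p, p)) (𝓝 0) (𝓝 0) := by
    have := hι.continuousAt.tendsto; rwa [hι0] at this
  filter_upwards [ht.eventually hFG] with p hp
  simp only [hF, Prod.mk.injEq] at hp
  have h1 : ((G (c⁻¹ * τ p, p)).1, p) = G (c⁻¹ * τ p, p) := by
    ext1
    · rfl
    · exact hp.2.symm
  rw [h1]
  exact mul_left_cancel₀ (inv_ne_zero hTs) hp.1

/-- Densities differing by a bracket are related by a symmetry of the model tangent to the
identity. -/
theorem exists_symmetry (hk : 2 ≤ k) (ε : ℝ) (hh : AnalyticAt ℝ h 0) (hh0 : h 0 ≠ 0)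
    {τ : Plane → ℝ} (hτ : AnalyticAt ℝ τ 0) :
    ∃ X Y : Plane → ℝ, IsModelSymmetry k ε X Y ∧
      HasFDerivAt (fun p => (X p, Y p)) (ContinuousLinearMap.id ℝ Plane) 0 ∧
      ∀ᶠ p in 𝓝 (0 : Plane), transport X Y h p = h p - bracket k ε τ p := by
  obtain ⟨X, Y, r, hf⟩ := exists_energyFlow hk ε
  have aM : AnalyticAt ℝ (fun q => r q * h (X q, Y q)) 0 := hf.anr.mul (hf.analyticAt_comp hh)
  obtain ⟨T, hT, hT0, hTM⟩ := exists_primitive aM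
  have hTs : pd (1, 0) T 0 ≠ 0 := by
    rw [hTM.self_of_nhds, hf.r0, hf.X0, hf.Y0, one_mul]; exact hh0
  -- Subtracting `τ 0` gives `σ 0 = 0` and does not change the bracket. Solvability uses `∂_t T(0) =
  -- h(0) ≠ 0`.
  obtain ⟨σ, hσ, hσ0, hσT⟩ := exists_implicit hT hT0 hTs (hτ.fun_sub analyticAt_const)
    (sub_self (τ 0))
  have hι : AnalyticAt ℝ (fun p : Plane => (σ p, p)) 0 := hσ.prod analyticAt_id
  have hι0 : ((σ 0, (0 : Plane)) : ℝ × Plane) = 0 := by simp [hσ0]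
  have ht : Tendsto (fun p : Plane => (σ p, p)) (𝓝 0) (𝓝 0) := by
    have := hι.continuousAt.tendsto; rwa [hι0] at this
  have hcomp : ∀ {g : ℝ × Plane → ℝ}, AnalyticAt ℝ g 0 → AnalyticAt ℝ (fun p => g (σ p, p)) 0 :=
    fun hg => AnalyticAt.fun_comp (f := fun p : Plane => (σ p, p)) (by rw [hι0]; exact hg) hι
  have aX := hcomp hf.anX
  have aY := hcomp hf.anY
  refine ⟨fun p => X (σ p, p), fun p => Y (σ p, p),
    ⟨⟨aX, aY, by rw [hι0, hf.X0], by rw [hι0, hf.Y0]⟩, ht.eventually hf.model_eq⟩, ?_, ?_⟩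
  -- The Hamiltonian field vanishes at the origin, so the derivative of `σ` does not contribute and
  -- only the identity at time `0` remains.
  · have e1 := aX.differentiableAt.hasFDerivAt.prodMk aY.differentiableAt.hasFDerivAt
    convert! e1 using 1
    have hX : ∀ v : Plane, fderiv ℝ (fun p => X (σ p, p)) 0 v = v.1 := by
      intro v
      have := pd_graph (g := X) (σ := σ) (p := 0) (by rw [hι0]; exact hf.anX.differentiableAt)
        hσ.differentiableAt v
      rw [hι0, hf.derivX.self_of_nhds, hf.Y0] at this
      have h2 := pd_zero_prod (g := X) (p := 0) hf.anX.differentiableAt v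
      rw [(pd_congr hf.initX v).self_of_nhds, pd_fst] at h2
      have h3 : pd (0, v) X 0 = v.1 := h2
      rw [h3] at this
      simpa using! this
    have hY : ∀ v : Plane, fderiv ℝ (fun p => Y (σ p, p)) 0 v = v.2 := by
      intro v
      have := pd_graph (g := Y) (σ := σ) (p := 0) (by rw [hι0]; exact hf.anY.differentiableAt)
        hσ.differentiableAt v
      rw [hι0, hf.derivY.self_of_nhds, hf.X0, zero_pow (by omega)] at this
      have h2 := pd_zero_prod (g := Y) (p := 0) hf.anY.differentiableAt v
      rw [(pd_congr hf.initY v).self_of_nhds, pd_snd] at h2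
      have h3 : pd (0, v) Y 0 = v.2 := h2
      rw [h3] at this
      simpa using! this
    refine ContinuousLinearMap.ext fun v => ?_
    ext
    · simp [hX]
    · simp [hY]
  -- Substituting the time `σ(p)` adds `r h dσ ∧ dH`. Together with the spatial part of `dT ∧ dH`
  -- this is `d(T(σ p, p)) ∧ dH = dτ ∧ dH`, whose density is `-bracket τ`.
  · have hd := hf.density hh hT hT0 hTM
    filter_upwards [ht.eventually hd, ht.eventually hf.spatial_deriv, ht.eventually hf.derivX,
      ht.eventually hf.derivY, ht.eventually hTM, pd_congr hσT (1, 0), pd_congr hσT (0, 1),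
      ht.eventually hf.anX.eventually_analyticAt, ht.eventually hf.anY.eventually_analyticAt,
      ht.eventually hT.eventually_analyticAt, hσ.eventually_analyticAt, hτ.eventually_analyticAt]
      with p e0 ⟨e1, e2⟩ sX sY sT t1 t2 dX dY dT dσ dτ
    have dσ := dσ.differentiableAt
    have gX := fun v => pd_graph dX.differentiableAt dσ v
    have gY := fun v => pd_graph dY.differentiableAt dσ v
    have gT := fun v => pd_graph dT.differentiableAt dσ v
    have t1' : dx τ p = pd (1, 0) T (σ p, p) * pd (1, 0) σ p + pd (0, (1, 0)) T (σ p, p) := by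
      have := (pd_sub dτ.differentiableAt (differentiableAt_const (τ 0)) (1, 0)).symm.trans
        (t1.symm.trans (gT (1, 0)))
      rwa [pd_const, sub_zero] at this
    have t2' : dy τ p = pd (1, 0) T (σ p, p) * pd (0, 1) σ p + pd (0, (0, 1)) T (σ p, p) := by
      have := (pd_sub dτ.differentiableAt (differentiableAt_const (τ 0)) (0, 1)).symm.trans
        (t2.symm.trans (gT (0, 1)))
      rwa [pd_const, sub_zero] at this
    simp only [transport, jac, bracket, dx, dy] at t1' t2' ⊢
    rw [t1', t2', gX, gX, gY, gY, sX, sY, sT]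
    linear_combination e0 + (r (σ p, p) * h (X (σ p, p), Y (σ p, p)) * pd (1, 0) σ p) * e2 -
      (r (σ p, p) * h (X (σ p, p), Y (σ p, p)) * pd (0, 1) σ p) * e1

end flow

/-! ### Two-forms, densities and the normal form -/

/-- The coefficient of a 2-form with respect to `dx ∧ dξ`. -/
noncomputable def density (ω : TwoForm) (p : Plane) : ℝ := ω p ![(1, 0), (0, 1)]

theorem twoForm_apply (f : Plane [⋀^Fin 2]→L[ℝ] ℝ) (v w : Plane) :
    f ![v, w] = f ![(1, 0), (0, 1)] * (v.1 * w.2 - v.2 * w.1) := by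
  have hs : ∀ a b : Plane, f ![a, b] = -f ![b, a] := by
    intro a b
    have h := f.toAlternatingMap.map_swap ![b, a] (i := 0) (j := 1) (by decide)
    have e : (![b, a] ∘ Equiv.swap (0 : Fin 2) 1 : Fin 2 → Plane) = ![a, b] := by
      ext i <;> fin_cases i <;> simp
    rw [e] at h
    exact h
  have hz : ∀ a : Plane, f ![a, a] = 0 := fun a =>
    f.map_eq_zero_of_eq _ (i := 0) (j := 1) rfl (by decide)
  have hl : ∀ a u : Plane, f ![a, u] = a.1 * f ![(1, 0), u] + a.2 * f ![(0, 1), u] := by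
    intro a u
    have : a = a.1 • ((1, 0) : Plane) + a.2 • (0, 1) := by ext <;> simp
    conv_lhs => rw [this]
    rw [f.vecCons_add, f.vecCons_smul, f.vecCons_smul]; rfl
  rw [hl v w, hs _ w, hs _ w, hl w, hl w, hz, hz, hs (0, 1) (1, 0)]
  ring

theorem twoForm_ext {f g : Plane [⋀^Fin 2]→L[ℝ] ℝ}
    (h : f ![(1, 0), (0, 1)] = g ![(1, 0), (0, 1)]) : f = g := by
  ext v
  have hv : v = ![v 0, v 1] := by ext i <;> fin_cases i <;> rfl
  rw [hv, twoForm_apply f, twoForm_apply g, h]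

theorem fderiv_plane {ψ : Plane → Plane} {p : Plane} (hψ : DifferentiableAt ℝ ψ p) (v : Plane) :
    fderiv ℝ ψ p v = (pd v (fun q => (ψ q).1) p, pd v (fun q => (ψ q).2) p) := by
  have h1 : HasFDerivAt (fun q => (ψ q).1) _ p := hψ.hasFDerivAt.fst
  have h2 : HasFDerivAt (fun q => (ψ q).2) _ p := hψ.hasFDerivAt.snd
  simp only [ASing.pd]
  rw [h1.fderiv, h2.fderiv]; rfl

/-- The Jacobian determinant of a map of the plane. -/
noncomputable abbrev jacobian (ψ : Plane → Plane) : Plane → ℝ :=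
  jac (fun q => (ψ q).1) (fun q => (ψ q).2)

theorem density_pullback {ψ : Plane → Plane} {p : Plane} (hψ : DifferentiableAt ℝ ψ p)
    (ω : TwoForm) : density (pullback ψ ω) p = density ω (ψ p) * jacobian ψ p := by
  have e : density (pullback ψ ω) p =
      ω (ψ p) ![fderiv ℝ ψ p (1, 0), fderiv ℝ ψ p (0, 1)] := by
    simp only [density, pullback, ContinuousAlternatingMap.compContinuousLinearMap_apply]
    congr 1; ext i <;> fin_cases i <;> rfl
  rw [e, twoForm_apply, fderiv_plane hψ, fderiv_plane hψ]
  simp only [density, jacobian, jac]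
  ring

theorem det_fderiv {ψ : Plane → Plane} {p : Plane} (hψ : DifferentiableAt ℝ ψ p) :
    (fderiv ℝ ψ p).det = jacobian ψ p := by
  rw [ContinuousLinearMap.det, ← LinearMap.det_toMatrix (Module.Basis.finTwoProd ℝ),
    Matrix.det_fin_two]
  simp only [LinearMap.toMatrix_apply, Module.Basis.finTwoProd_zero, Module.Basis.finTwoProd_one,
    ContinuousLinearMap.coe_coe, fderiv_plane hψ]
  simp [jac]

theorem analyticAt_density {ω : TwoForm} {p : Plane} (hω : AnalyticAt ℝ ω p) :
    AnalyticAt ℝ (density ω) p :=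
  ((ContinuousAlternatingMap.apply ℝ Plane ℝ ![(1, 0), (0, 1)]).analyticAt _).comp hω

theorem IsSymplecticGerm.density_ne_zero {ω : TwoForm} (hω : IsSymplecticGerm ω) :
    density ω 0 ≠ 0 := by
  intro h
  have h1 := hω.2.2.self_of_nhds (1, 0) fun w => by
    rw [twoForm_apply]; exact mul_eq_zero_of_left h _
  simpa using congrArg Prod.fst h1

section normalForm
variable {k : ℕ} {f : ℕ → ℝ → ℝ}

theorem analyticAt_potential (hk : 2 ≤ k) (hf : ∀ i ∈ Finset.Ico 1 k, AnalyticAt ℝ (f i) 0) :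
    AnalyticAt ℝ (potential k f) 0 := by
  refine Finset.analyticAt_fun_sum _ fun i hi => (analyticAt_id.pow i).mul ?_
  refine AnalyticAt.fun_comp (f := fun x : ℝ => x ^ k) ?_ (analyticAt_id.pow k)
  rw [zero_pow (by omega)]; exact hf i hi

theorem analyticAt_potential_fst (hk : 2 ≤ k)
    (hf : ∀ i ∈ Finset.Ico 1 k, AnalyticAt ℝ (f i) 0) :
    AnalyticAt ℝ (fun p : Plane => potential k f p.1) 0 :=
  analyticAt_comp_fst (analyticAt_potential hk hf)

theorem analyticAt_potential_smul (hk : 2 ≤ k)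
    (hf : ∀ i ∈ Finset.Ico 1 k, AnalyticAt ℝ (f i) 0) :
    AnalyticAt ℝ (fun p : Plane => potential k f p.1 • dXi) 0 :=
  (analyticAt_potential_fst hk hf).smul analyticAt_const

theorem density_normalForm (hk : 2 ≤ k) (hf : ∀ i ∈ Finset.Ico 1 k, AnalyticAt ℝ (f i) 0) :
    density (normalForm k f) =ᶠ[𝓝 0] dx (fun p => potential k f p.1) := by
  filter_upwards [(analyticAt_potential_fst hk hf).eventually_analyticAt,
    (analyticAt_potential_smul hk hf).eventually_analyticAt] with p h1 h2
  have d1 := h1.differentiableAt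
  rw [density, normalForm, extDeriv_apply h2.differentiableAt, Fin.sum_univ_two]
  simp only [ContinuousAlternatingMap.smul_apply]
  have e1 : dXi (Fin.removeNth (0 : Fin 2) ![((1 : ℝ), (0 : ℝ)), (0, 1)]) = 1 := by
    simp [dXi]
  have e2 : dXi (Fin.removeNth (1 : Fin 2) ![((1 : ℝ), (0 : ℝ)), (0, 1)]) = 0 := by
    simp [dXi, Fin.removeNth]
  erw [e1, e2]
  simp [ASing.pd]

theorem dx_potential_zero (hk : 2 ≤ k) (hf : ∀ i ∈ Finset.Ico 1 k, AnalyticAt ℝ (f i) 0) :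
    dx (fun p : Plane => potential k f p.1) 0 = f 1 0 := by
  have h := (hasCoef_potential (by omega) hf).dx.apply_zero
  rw [h, zero_add, Nat.mod_eq_of_lt (by omega), Nat.div_eq_of_lt (by omega)]
  simp [coef1, coef]

theorem dx_potential (hk : 2 ≤ k) (hf : ∀ i ∈ Finset.Ico 1 k, AnalyticAt ℝ (f i) 0) :
    dx (fun p : Plane => potential k f p.1) =ᶠ[𝓝 0] fun p => deriv (potential k f) p.1 := by
  have h : Tendsto (fun p : Plane => p.1) (𝓝 0) (𝓝 0) := continuous_fst.tendsto' _ _ rfl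
  filter_upwards [h.eventually (analyticAt_potential hk hf).eventually_analyticAt] with p hp
  have h1 := hp.differentiableAt.hasDerivAt.comp_hasFDerivAt p (hasFDerivAt_fst (p := p) (𝕜 := ℝ))
  simp only [ASing.pd]
  erw [h1.fderiv]
  simp

theorem coef1_deriv_potential (hk : 2 ≤ k) (hf : ∀ i ∈ Finset.Ico 1 k, AnalyticAt ℝ (f i) 0)
    (n : ℕ) : coef1 n (deriv (potential k f)) =
      (n + 1) * if (n + 1) % k ≠ 0 then coef1 ((n + 1) / k) (f ((n + 1) % k)) else 0 := by
  have h := ((hasCoef_potential (by omega) hf).dx.congr (dx_potential hk hf)).coef_eq n 0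
  simpa [coef1] using h

theorem isSymplecticGerm_normalForm (hk : 2 ≤ k) (hf : Admissible k f) :
    IsSymplecticGerm (normalForm k f) := by
  have ha := analyticAt_potential_smul hk hf.1
  have hω : AnalyticAt ℝ (normalForm k f) 0 := by
    let L : (Plane →L[ℝ] Plane [⋀^Fin 1]→L[ℝ] ℝ) →L[ℝ] (Plane [⋀^Fin 2]→L[ℝ] ℝ) :=
      ContinuousAlternatingMap.alternatizeUncurryFinCLM ℝ Plane ℝ
    exact (L.analyticAt _).comp ha.fderiv
  refine ⟨hω, ?_, ?_⟩
  · filter_upwards [ha.eventually_analyticAt] with p hp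
    exact extDeriv_extDeriv_apply (hp.contDiffAt (n := ⊤)) (by simp)
  · have h0 : density (normalForm k f) 0 ≠ 0 := by
      rw [(density_normalForm hk hf.1).self_of_nhds, dx_potential_zero hk hf.1]; exact hf.2
    filter_upwards [(analyticAt_density hω).continuousAt.eventually_ne h0] with p hp v hv
    have h1 := hv (0, 1)
    have h2 := hv (1, 0)
    rw [twoForm_apply] at h1 h2
    have h3 := (mul_eq_zero.1 h1).resolve_left hp
    have h4 := (mul_eq_zero.1 h2).resolve_left hp
    ext
    · simpa using h3
    · simpa using h4

end normalForm

/-! ### Diffeomorphism germs and equivalence of pairs -/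

section diffeo
variable {ψ θ : Plane → Plane}

theorem IsDiffeoGerm.tendsto (hψ : IsDiffeoGerm ψ) : Tendsto ψ (𝓝 0) (𝓝 0) := by
  have := hψ.1.continuousAt.tendsto
  rwa [hψ.2.1] at this

theorem IsDiffeoGerm.comp (hψ : IsDiffeoGerm ψ) (hθ : IsDiffeoGerm θ) :
    IsDiffeoGerm (fun p => ψ (θ p)) := by
  obtain ⟨ψ', a1, z1, l1, r1⟩ := hψ.2.2
  obtain ⟨θ', a2, z2, l2, r2⟩ := hθ.2.2
  have t1 : Tendsto ψ' (𝓝 0) (𝓝 0) := by have := a1.continuousAt.tendsto; rwa [z1] at this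
  refine ⟨AnalyticAt.fun_comp (f := θ) (by rw [hθ.2.1]; exact hψ.1) hθ.1, by simp only [hθ.2.1, hψ.2.1],
    fun p => θ' (ψ' p), AnalyticAt.fun_comp (f := ψ') (by rw [z1]; exact a2) a1, by simp only [z1, z2],
    ?_, ?_⟩
  · filter_upwards [hθ.tendsto.eventually l1, l2] with p h1 h2
    rw [h1, h2]
  · filter_upwards [t1.eventually r2, r1] with p h1 h2
    rw [h1, h2]

theorem IsDiffeoGerm.exists_inverse (hψ : IsDiffeoGerm ψ) :
    ∃ θ, IsDiffeoGerm θ ∧ (∀ᶠ p in 𝓝 (0 : Plane), θ (ψ p) = p) ∧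
      ∀ᶠ p in 𝓝 (0 : Plane), ψ (θ p) = p := by
  obtain ⟨θ, a, z, l, r⟩ := hψ.2.2
  exact ⟨θ, ⟨a, z, ψ, hψ.1, hψ.2.1, r, l⟩, l, r⟩

theorem IsDiffeoGerm.det_comp (hψ : IsDiffeoGerm ψ) (hθ : IsDiffeoGerm θ) :
    (fderiv ℝ (fun p => ψ (θ p)) 0).det = (fderiv ℝ ψ 0).det * (fderiv ℝ θ 0).det := by
  have h := fderiv_comp (𝕜 := ℝ) (0 : Plane) (g := ψ) (f := θ)
    (by rw [hθ.2.1]; exact hψ.1.differentiableAt) hθ.1.differentiableAt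
  rw [hθ.2.1] at h
  change (fderiv ℝ (ψ ∘ θ) 0).det = _
  rw [h]
  exact LinearMap.det_comp _ _

theorem det_fderiv_eq_one (h : ∀ᶠ p in 𝓝 (0 : Plane), ψ p = p) : (fderiv ℝ ψ 0).det = 1 := by
  have h1 : ψ =ᶠ[𝓝 0] id := h
  rw [h1.fderiv_eq, fderiv_id, ContinuousLinearMap.det]
  simp

theorem IsDiffeoGerm.det_mul_det (hψ : IsDiffeoGerm ψ) (hθ : IsDiffeoGerm θ)
    (h : ∀ᶠ p in 𝓝 (0 : Plane), ψ (θ p) = p) :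
    (fderiv ℝ ψ 0).det * (fderiv ℝ θ 0).det = 1 := by
  rw [← hψ.det_comp hθ, det_fderiv_eq_one h]

theorem IsDiffeoGerm.det_ne_zero (hψ : IsDiffeoGerm ψ) : (fderiv ℝ ψ 0).det ≠ 0 := by
  obtain ⟨θ, hθ, -, r⟩ := hψ.exists_inverse
  exact left_ne_zero_of_mul_eq_one (hψ.det_mul_det hθ r)

theorem PreservesOrientation.comp (oψ : PreservesOrientation ψ) (oθ : PreservesOrientation θ)
    (hψ : IsDiffeoGerm ψ) (hθ : IsDiffeoGerm θ) : PreservesOrientation (fun p => ψ (θ p)) := by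
  rw [PreservesOrientation, hψ.det_comp hθ]
  exact mul_pos oψ oθ

theorem IsDiffeoGerm.isMapGerm (hψ : IsDiffeoGerm ψ) :
    IsMapGerm (fun p => (ψ p).1) (fun p => (ψ p).2) where
  anX := analyticAt_fst.comp hψ.1
  anY := analyticAt_snd.comp hψ.1
  X0 := by rw [hψ.2.1]; rfl
  Y0 := by rw [hψ.2.1]; rfl

theorem IsDiffeoGerm.jacobian_eq (hψ : IsDiffeoGerm ψ) : jacobian ψ 0 = (fderiv ℝ ψ 0).det :=
  (det_fderiv hψ.1.differentiableAt).symm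

theorem IsDiffeoGerm.density_pullback (hψ : IsDiffeoGerm ψ) (ω : TwoForm) :
    ∀ᶠ p in 𝓝 (0 : Plane), density (pullback ψ ω) p = density ω (ψ p) * jacobian ψ p :=
  hψ.1.eventually_analyticAt.mono fun _ hp => ASing.density_pullback hp.differentiableAt ω

theorem pullback_comp {p : Plane} (hψ : DifferentiableAt ℝ ψ (θ p)) (hθ : DifferentiableAt ℝ θ p)
    (ω : TwoForm) : pullback (fun p => ψ (θ p)) ω p = pullback θ (pullback ψ ω) p := by
  have h := fderiv_comp p (g := ψ) (f := θ) hψ hθ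
  have h' : fderiv ℝ (fun p => ψ (θ p)) p = (fderiv ℝ ψ (θ p)).comp (fderiv ℝ θ p) := h
  simp only [pullback, h']
  rfl

theorem PullsBack.comp {H₀ H₁ H₂ : Plane → ℝ} {ω₀ ω₁ ω₂ : TwoForm} (hψ : IsDiffeoGerm ψ)
    (hθ : IsDiffeoGerm θ) (h₂ : PullsBack ψ H₂ ω₂ H₁ ω₁) (h₁ : PullsBack θ H₁ ω₁ H₀ ω₀) :
    PullsBack (fun p => ψ (θ p)) H₂ ω₂ H₀ ω₀ := by
  constructor
  · filter_upwards [hθ.tendsto.eventually h₂.1, h₁.1] with p e1 e2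
    rw [e1, e2]
  · filter_upwards [hθ.tendsto.eventually h₂.2, h₁.2, hθ.1.eventually_analyticAt,
      hθ.tendsto.eventually hψ.1.eventually_analyticAt] with p e1 e2 d1 d2
    rw [pullback_comp d2.differentiableAt d1.differentiableAt, ← e2]
    simp only [pullback] at e1 ⊢
    rw [e1]

theorem PullsBack.inverse {H₀ H₁ : Plane → ℝ} {ω₀ ω₁ : TwoForm} (hψ : IsDiffeoGerm ψ)
    (hθ : IsDiffeoGerm θ) (hr : ∀ᶠ p in 𝓝 (0 : Plane), ψ (θ p) = p)
    (h : PullsBack ψ H₁ ω₁ H₀ ω₀) : PullsBack θ H₀ ω₀ H₁ ω₁ := by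
  constructor
  · filter_upwards [hθ.tendsto.eventually h.1, hr] with p e1 e2
    rw [← e1, e2]
  · have hid : (fun p => ψ (θ p)) =ᶠ[𝓝 0] (id : Plane → Plane) := hr
    filter_upwards [hθ.tendsto.eventually h.2, hr, hid.fderiv (𝕜 := ℝ), hθ.1.eventually_analyticAt,
      hθ.tendsto.eventually hψ.1.eventually_analyticAt] with p e1 e2 e3 d1 d2
    have e4 := pullback_comp d2.differentiableAt d1.differentiableAt ω₁
    have e5 : pullback θ ω₀ p = pullback θ (pullback ψ ω₁) p := by
      simp only [pullback] at e1 ⊢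
      rw [e1]
    rw [e5, ← e4]
    simp only [pullback]
    rw [e3, e2, fderiv_id]
    rfl

end diffeo

section equivalence
variable {H₀ H₁ H₂ : Plane → ℝ} {ω₀ ω₁ ω₂ : TwoForm}

theorem OrientedEquivalent.equivalent (h : OrientedEquivalent H₀ ω₀ H₁ ω₁) :
    Equivalent H₀ ω₀ H₁ ω₁ := by
  obtain ⟨ψ, h1, -, h2⟩ := h
  exact ⟨ψ, h1, h2⟩

theorem Equivalent.symm (h : Equivalent H₀ ω₀ H₁ ω₁) : Equivalent H₁ ω₁ H₀ ω₀ := by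
  obtain ⟨ψ, h1, h2⟩ := h
  obtain ⟨θ, hθ, -, r⟩ := h1.exists_inverse
  exact ⟨θ, hθ, h2.inverse h1 hθ r⟩

theorem Equivalent.trans (h : Equivalent H₀ ω₀ H₁ ω₁) (h' : Equivalent H₁ ω₁ H₂ ω₂) :
    Equivalent H₀ ω₀ H₂ ω₂ := by
  obtain ⟨θ, h1, h2⟩ := h
  obtain ⟨ψ, h3, h4⟩ := h'
  exact ⟨_, h3.comp h1, h4.comp h3 h1 h2⟩

theorem OrientedEquivalent.symm (h : OrientedEquivalent H₀ ω₀ H₁ ω₁) :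
    OrientedEquivalent H₁ ω₁ H₀ ω₀ := by
  obtain ⟨ψ, h1, o, h2⟩ := h
  obtain ⟨θ, hθ, -, r⟩ := h1.exists_inverse
  exact ⟨θ, hθ, pos_of_mul_pos_right (by rw [h1.det_mul_det hθ r]; exact one_pos) o.le,
    h2.inverse h1 hθ r⟩

theorem OrientedEquivalent.trans (h : OrientedEquivalent H₀ ω₀ H₁ ω₁)
    (h' : OrientedEquivalent H₁ ω₁ H₂ ω₂) : OrientedEquivalent H₀ ω₀ H₂ ω₂ := by
  obtain ⟨θ, h1, o1, h2⟩ := h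
  obtain ⟨ψ, h3, o3, h4⟩ := h'
  exact ⟨_, h3.comp h1, o3.comp o1 h3 h1, h4.comp h3 h1 h2⟩

end equivalence

/-! ### Sign changes of the coordinates -/

/-- The linear map `(x, ξ) ↦ (a x, b ξ)`. -/
def diag (a b : ℝ) (p : Plane) : Plane := (a * p.1, b * p.2)

section diag
variable {a b : ℝ}

theorem analyticAt_diag (a b : ℝ) (p : Plane) : AnalyticAt ℝ (diag a b) p :=
  (analyticAt_const.mul analyticAt_fst).prod (analyticAt_const.mul analyticAt_snd)

theorem isDiffeoGerm_diag (ha : a * a = 1) (hb : b * b = 1) : IsDiffeoGerm (diag a b) := by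
  have h : ∀ p, diag a b (diag a b p) = p := fun p => by
    ext
    · simp [diag, ← mul_assoc, ha]
    · simp [diag, ← mul_assoc, hb]
  have h0 : diag a b 0 = 0 := by simp [diag]
  exact ⟨analyticAt_diag a b 0, h0, diag a b, analyticAt_diag a b 0, h0, .of_forall h, .of_forall h⟩

theorem jacobian_diag (a b : ℝ) (p : Plane) : jacobian (diag a b) p = a * b := by
  simp (disch := fun_prop) only [jacobian, jac, diag, dx, dy, pd_const_mul, pd_fst, pd_snd]
  ring

theorem det_diag (a b : ℝ) : (fderiv ℝ (diag a b) 0).det = a * b := by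
  rw [det_fderiv (analyticAt_diag a b 0).differentiableAt, jacobian_diag]

theorem pullsBack_diag {k : ℕ} {ε : ℝ} {f g : ℕ → ℝ → ℝ} (hk : 2 ≤ k) (ha : a * a = 1)
    (hb : b * b = 1) (hak : a ^ k = 1) (hf : ∀ i ∈ Finset.Ico 1 k, AnalyticAt ℝ (f i) 0)
    (hg : ∀ i ∈ Finset.Ico 1 k, AnalyticAt ℝ (g i) 0)
    (h : ∀ᶠ x in 𝓝 (0 : ℝ), potential k f x = b * potential k g (a * x)) :
    PullsBack (diag a b) (model k ε) (normalForm k g) (model k ε) (normalForm k f) := by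
  have hd := isDiffeoGerm_diag ha hb
  refine ⟨.of_forall fun p => ?_, ?_⟩
  · simp only [model, diag, mul_pow, hak, pow_two b, hb, one_mul]
  · have ht : Tendsto (fun p : Plane => p.1) (𝓝 0) (𝓝 0) := continuous_fst.tendsto' _ _ rfl
    have h1 : (fun p : Plane => potential k f p.1) =ᶠ[𝓝 0]
        fun p => b * potential k g ((diag a b p).1) := ht.eventually h
    filter_upwards [hd.density_pullback (normalForm k g), density_normalForm hk hf,
      hd.tendsto.eventually (density_normalForm hk hg), pd_congr h1 (1, 0),
      hd.tendsto.eventually (analyticAt_potential_fst hk hg).eventually_analyticAt]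
      with p e1 e2 e3 e4 d1
    refine twoForm_ext ?_
    change density _ p = density _ p
    rw [e1, e2, e3, jacobian_diag]
    have hX : DifferentiableAt ℝ (fun p : Plane => a * p.1) p := by fun_prop
    have hY : DifferentiableAt ℝ (fun p : Plane => b * p.2) p := by fun_prop
    have ch := pd_comp (f := fun p => potential k g p.1) d1.differentiableAt hX hY (1, 0)
    have dc : DifferentiableAt ℝ (fun p => potential k g (diag a b p).1) p :=
      DifferentiableAt.comp (g := fun p : Plane => potential k g p.1) p d1.differentiableAt
        (analyticAt_diag a b p).differentiableAt
    simp (disch := fun_prop) only [pd_const_mul, pd_fst, pd_snd] at ch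
    rw [dx, dx, e4, pd_const_mul dc]
    change _ = b * pd (1, 0) (fun q : Plane => potential k g (a * q.1)) p
    rw [ch]
    simp only [diag]
    ring

end diag

/-! ### Uniqueness of the normal form -/

section rigidity
variable {k : ℕ} {ε : ℝ} {f g : ℕ → ℝ → ℝ} {ψ : Plane → Plane}

theorem isModelSymmetry_of_pullsBack {ω₀ ω₁ : TwoForm} (hψ : IsDiffeoGerm ψ)
    (h : PullsBack ψ (model k ε) ω₁ (model k ε) ω₀) :
    IsModelSymmetry k ε (fun p => (ψ p).1) (fun p => (ψ p).2) :=
  ⟨hψ.isMapGerm, h.1⟩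

/-- The eigenvalues of a symmetry of the model. -/
theorem IsModelSymmetry.eigenvalue_cases {X Y : Plane → ℝ} (hs : IsModelSymmetry k ε X Y)
    (hk : 2 ≤ k) (hε : ε ≠ 0) : jac X Y 0 ^ 2 = 1 ∧
      ∃ a : ℝ, (a = 1 ∨ a = -1 ∧ Even k) ∧ ∀ i ∈ Finset.Ico 1 k, dx X 0 ^ (i - 1) = a ^ (i - 1) := by
  obtain rfl | hk3 := hk.eq_or_lt
  -- For `k = 2` the number `X_x(0)` need not be `±1`, but the only index is `i = 1` and its power
  -- is the zeroth one.
  · refine ⟨hs.jac_sq rfl hε, 1, Or.inl rfl, fun i hi => ?_⟩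
    obtain rfl : i = 1 := by rw [Finset.mem_Ico] at hi; omega
    simp
  · obtain ⟨h1, h2⟩ := hs.linear_eq_of_three_le hk3
    have h3 := hs.pow_eq_one hk3 hε
    have h4 : dx X 0 = 1 ∨ dx X 0 = -1 ∧ Even k := pow_eq_one_iff_cases.1 h3 |>.resolve_left (by omega)
    refine ⟨?_, dx X 0, h4, fun _ _ => rfl⟩
    have h5 : dx X 0 ^ 2 = 1 := by rcases h4 with h | ⟨h, -⟩ <;> rw [h] <;> norm_num
    rw [jac, h1, mul_zero, sub_zero, mul_pow, h5, h2, one_mul]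

theorem coef1_const_mul {φ : ℝ → ℝ} (hφ : AnalyticAt ℝ φ 0) (c : ℝ) (m : ℕ) :
    coef1 m (fun t => c * φ t) = c * coef1 m φ := by
  have h := ((hasCoef_fst hφ).const_mul c).coef_eq m 0
  simpa [coef1] using h

/-- The `m`-th coefficient of `f_i` sits in the derivative of the potential at `x^n` with `n = i - 1
+ k m`. The eigenvalue of the symmetry there depends only on `n % k = i - 1`, so one factor serves
for the whole germ `f_i`. -/
theorem coef1_invariant_eq (hk : 2 ≤ k) (hε : ε ≠ 0)
    (hf : ∀ i ∈ Finset.Ico 1 k, AnalyticAt ℝ (f i) 0)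
    (hg : ∀ i ∈ Finset.Ico 1 k, AnalyticAt ℝ (g i) 0) (hψ : IsDiffeoGerm ψ)
    (h : PullsBack ψ (model k ε) (normalForm k g) (model k ε) (normalForm k f))
    {i : ℕ} (hi : i ∈ Finset.Ico 1 k) (m : ℕ) :
    coef1 m (f i) = dx (fun p => (ψ p).1) 0 ^ (i - 1) * jacobian ψ 0 * coef1 m (g i) := by
  have hs := isModelSymmetry_of_pullsBack hψ h
  have hd : ∀ᶠ p in 𝓝 (0 : Plane), deriv (potential k g) (ψ p).1 * jacobian ψ p =
      deriv (potential k f) p.1 := by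
    filter_upwards [h.2, hψ.density_pullback (normalForm k g), density_normalForm hk hf,
      dx_potential hk hf, hψ.tendsto.eventually (density_normalForm hk hg),
      hψ.tendsto.eventually (dx_potential hk hg)] with p e1 e2 e3 e4 e5 e6
    rw [← e6, ← e5, ← e2, ← e4, ← e3, density, density, e1]
  rw [Finset.mem_Ico] at hi
  have hn : i - 1 + k * m + 1 = i + k * m := by omega
  have hmod : (i + k * m) % k = i := by rw [Nat.add_mul_mod_self_left, Nat.mod_eq_of_lt hi.2]
  have hdiv : (i + k * m) / k = m := by
    rw [Nat.add_mul_div_left _ _ (by omega), Nat.div_eq_of_lt hi.2, zero_add]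
  have hmod' : (i - 1 + k * m) % k = i - 1 := by
    rw [Nat.add_mul_mod_self_left, Nat.mod_eq_of_lt (by omega)]
  have key := hs.coef1_eq hk hε (analyticAt_potential hk hf).deriv
    (analyticAt_potential hk hg).deriv hd (n := i - 1 + k * m) (by
      rw [hn, Nat.dvd_iff_mod_eq_zero, hmod]; omega)
  rw [coef1_deriv_potential hk hf, coef1_deriv_potential hk hg, hn, hmod, hdiv, hmod',
    if_pos (by omega), if_pos (by omega)] at key
  refine mul_left_cancel₀ (a := ((i - 1 + k * m : ℕ) : ℝ) + 1) (by positivity) (key.trans ?_)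
  ring

theorem invariant_eventuallyEq (hk : 2 ≤ k) (hε : ε ≠ 0)
    (hf : ∀ i ∈ Finset.Ico 1 k, AnalyticAt ℝ (f i) 0)
    (hg : ∀ i ∈ Finset.Ico 1 k, AnalyticAt ℝ (g i) 0) (hψ : IsDiffeoGerm ψ)
    (h : PullsBack ψ (model k ε) (normalForm k g) (model k ε) (normalForm k f)) :
    jacobian ψ 0 ^ 2 = 1 ∧ ∃ a : ℝ, (a = 1 ∨ a = -1 ∧ Even k) ∧ ∀ i ∈ Finset.Ico 1 k,
      ∀ᶠ t in 𝓝 (0 : ℝ), f i t = a ^ (i - 1) * jacobian ψ 0 * g i t := by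
  obtain ⟨hJ, a, ha, hai⟩ := (isModelSymmetry_of_pullsBack hψ h).eigenvalue_cases hk hε
  refine ⟨hJ, a, ha, fun i hi => eventuallyEq_of_coef1 (hf i hi)
    (analyticAt_const.mul (hg i hi)) fun m => ?_⟩
  rw [coef1_const_mul (hg i hi), coef1_invariant_eq hk hε hf hg hψ h hi, hai i hi]

theorem related_of_eventuallyEq {a : ℝ} (ha : a = 1 ∨ a = -1 ∧ Even k)
    (h : ∀ i ∈ Finset.Ico 1 k, ∀ᶠ t in 𝓝 (0 : ℝ), f i t = a ^ (i - 1) * g i t) :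
    Related k f g := by
  rcases ha with rfl | ⟨rfl, hk⟩
  · exact Or.inl fun i hi => (h i hi).mono fun t ht => by simpa using ht
  · refine Or.inr ⟨hk, fun i hi => (h i hi).mono fun t ht => ?_⟩
    obtain ⟨j, rfl⟩ : ∃ j, i = j + 1 := ⟨i - 1, by rw [Finset.mem_Ico] at hi; omega⟩
    rw [Nat.add_sub_cancel] at ht
    by_cases hj : Even j
    · have : ¬ Even (j + 1) := by rwa [Nat.even_add_one, not_not]
      rw [flipEven, if_neg this, ht, hj.neg_one_pow, one_mul]
    · rw [flipEven, if_pos (Nat.even_add_one.2 hj), ht, (Nat.not_even_iff_odd.1 hj).neg_one_pow]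
      ring

/-- The Jacobian at the origin is `±1`, and its sign both decides orientation and multiplies every
`f_i`. -/
theorem related_of_pullsBack (hk : 2 ≤ k) (hε : ε ≠ 0) (hf : Admissible k f)
    (hg : Admissible k g) (hψ : IsDiffeoGerm ψ)
    (h : PullsBack ψ (model k ε) (normalForm k g) (model k ε) (normalForm k f)) :
    (PreservesOrientation ψ ∧ Related k f g) ∨ (¬ PreservesOrientation ψ ∧ Related k (-f) g) := by
  obtain ⟨hJ, a, ha, hfg⟩ := invariant_eventuallyEq hk hε hf.1 hg.1 hψ h
  rw [PreservesOrientation, ← hψ.jacobian_eq]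
  rcases (sq_eq_sq_iff_eq_or_eq_neg.1 (hJ.trans (one_pow 2).symm)) with h1 | h1
  · rw [h1] at hfg ⊢
    exact Or.inl ⟨one_pos, related_of_eventuallyEq ha fun i hi =>
      (hfg i hi).mono fun t ht => by rw [ht]; ring⟩
  · rw [h1] at hfg ⊢
    exact Or.inr ⟨by norm_num, related_of_eventuallyEq ha fun i hi =>
      (hfg i hi).mono fun t ht => by rw [Pi.neg_apply, Pi.neg_apply, ht]; ring⟩

theorem SameGerms.potential_eventuallyEq (hk : 2 ≤ k) (h : SameGerms k f g) :
    potential k f =ᶠ[𝓝 0] potential k g := by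
  have ht : Tendsto (fun x : ℝ => x ^ k) (𝓝 0) (𝓝 0) :=
    (continuous_pow k).tendsto' _ _ (zero_pow (by omega))
  have h1 : ∀ᶠ x in 𝓝 (0 : ℝ), ∀ i ∈ Finset.Ico 1 k, f i (x ^ k) = g i (x ^ k) :=
    (Finset.eventually_all _).2 fun i hi => ht.eventually (h i hi)
  filter_upwards [h1] with x hx
  exact Finset.sum_congr rfl fun i hi => by rw [hx i hi]

theorem potential_flipEven (hk : Even k) (f : ℕ → ℝ → ℝ) (x : ℝ) :
    potential k (flipEven f) (-x) = -potential k f x := by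
  simp only [potential, flipEven, ← Finset.sum_neg_distrib, hk.neg_pow]
  refine Finset.sum_congr rfl fun i _ => ?_
  by_cases hi : Even i
  · rw [if_pos hi, hi.neg_pow]; ring
  · rw [if_neg hi, (Nat.not_even_iff_odd.1 hi).neg_pow]; ring

theorem potential_neg (f : ℕ → ℝ → ℝ) (x : ℝ) : potential k (-f) x = -potential k f x := by
  simp [potential]

theorem Admissible.neg (hf : Admissible k f) : Admissible k (-f) :=
  ⟨fun i hi => (hf.1 i hi).neg, neg_ne_zero.2 hf.2⟩

/-- For even `k` the half-turn `(x, ξ) ↦ (-x, -ξ)` preserves the model and the orientation, and it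
changes the sign of exactly the even powers in the potential. -/
theorem Related.orientedEquivalent (hk : 2 ≤ k) (hf : Admissible k f) (hg : Admissible k g)
    (h : Related k f g) (ε : ℝ) :
    OrientedEquivalent (model k ε) (normalForm k f) (model k ε) (normalForm k g) := by
  rcases h with h | ⟨he, h⟩
  · refine ⟨diag 1 1, isDiffeoGerm_diag (by norm_num) (by norm_num), ?_,
      pullsBack_diag hk (by norm_num) (by norm_num) (one_pow _) hf.1 hg.1 ?_⟩
    · rw [PreservesOrientation, det_diag]; norm_num
    · filter_upwards [h.potential_eventuallyEq hk] with x hx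
      rw [hx]; simp
  · refine ⟨diag (-1) (-1), isDiffeoGerm_diag (by norm_num) (by norm_num), ?_,
      pullsBack_diag hk (by norm_num) (by norm_num) he.neg_one_pow hf.1 hg.1 ?_⟩
    · rw [PreservesOrientation, det_diag]; norm_num
    · have ht : Tendsto (fun x : ℝ => -x) (𝓝 0) (𝓝 0) := continuous_neg.tendsto' _ _ neg_zero
      filter_upwards [ht.eventually (h.potential_eventuallyEq hk)] with x hx
      rw [neg_one_mul, neg_one_mul, ← hx, potential_flipEven he, neg_neg]

/-- The reflection `ξ ↦ -ξ` preserves the model and changes the sign of `dξ`. -/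
theorem equivalent_neg (hk : 2 ≤ k) (hf : Admissible k f) (ε : ℝ) :
    Equivalent (model k ε) (normalForm k f) (model k ε) (normalForm k (-f)) :=
  ⟨diag 1 (-1), isDiffeoGerm_diag (by norm_num) (by norm_num),
    pullsBack_diag hk (by norm_num) (by norm_num) (one_pow _) hf.1 hf.neg.1
      (.of_forall fun x => by rw [potential_neg]; simp)⟩

theorem orientedEquivalent_normalForm_iff (hk : 2 ≤ k) (hε : ε ≠ 0) (hf : Admissible k f)
    (hg : Admissible k g) :
    OrientedEquivalent (model k ε) (normalForm k f) (model k ε) (normalForm k g) ↔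
      Related k f g := by
  refine ⟨fun ⟨ψ, hψ, ho, h⟩ => ?_, fun h => h.orientedEquivalent hk hf hg ε⟩
  exact ((related_of_pullsBack hk hε hf hg hψ h).resolve_right fun h' => h'.1 ho).2

theorem equivalent_normalForm_iff (hk : 2 ≤ k) (hε : ε ≠ 0) (hf : Admissible k f)
    (hg : Admissible k g) :
    Equivalent (model k ε) (normalForm k f) (model k ε) (normalForm k g) ↔
      Related k f g ∨ Related k (-f) g := by
  refine ⟨fun ⟨ψ, hψ, h⟩ => ?_, fun h => ?_⟩
  · exact (related_of_pullsBack hk hε hf hg hψ h).imp And.right And.right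
  · rcases h with h | h
    · exact (h.orientedEquivalent hk hf hg ε).equivalent
    · exact (equivalent_neg hk hf ε).trans (h.orientedEquivalent hk hf.neg hg ε).equivalent

end rigidity

/-! ### Existence of the normal form -/

section existence
variable {k : ℕ} {ε : ℝ} {H : Plane → ℝ} {ω : TwoForm}

/-- Adapted coordinates can be chosen compatible with the orientation. -/
theorem HasASingularity.exists_oriented (hH : HasASingularity k ε H) :
    ∃ φ, IsDiffeoGerm φ ∧ PreservesOrientation φ ∧ ∀ᶠ p in 𝓝 (0 : Plane), H (φ p) = model k ε p := by
  obtain ⟨-, φ, hφ, h⟩ := hH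
  rcases hφ.det_ne_zero.lt_or_gt with hd | hd
  · have hr := isDiffeoGerm_diag (a := 1) (b := -1) (by norm_num) (by norm_num)
    refine ⟨fun p => φ (diag 1 (-1) p), hφ.comp hr, ?_, ?_⟩
    · rw [PreservesOrientation, hφ.det_comp hr, det_diag]; linarith
    · filter_upwards [hr.tendsto.eventually h] with p hp
      rw [hp]; simp [model, diag]
  · exact ⟨φ, hφ, hd, h⟩

theorem isDiffeoGerm_of_hasFDerivAt_id {ψ : Plane → Plane} (hψ : AnalyticAt ℝ ψ 0) (h0 : ψ 0 = 0)
    (hd : HasFDerivAt ψ (ContinuousLinearMap.id ℝ Plane) 0) :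
    IsDiffeoGerm ψ ∧ PreservesOrientation ψ := by
  obtain ⟨θ, a, z, r, l⟩ := exists_analytic_inverse hψ h0 hd
  refine ⟨⟨hψ, h0, θ, a, z, l, r⟩, ?_⟩
  rw [PreservesOrientation, hd.fderiv, ContinuousLinearMap.det]
  simp

/-- After adapted coordinates `φ`, the density of `φ^* ω` is a derivative of a potential plus
`bracket η`. The symmetry built from `η` removes the bracket; being tangent to the identity, it
preserves orientation. -/
theorem exists_normalForm (hk : 2 ≤ k) (hε : |ε| = 1) (h : IsASingularPair k ε H ω) :
    ∃ f, Admissible k f ∧ OrientedEquivalent (model k ε) (normalForm k f) H ω := by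
  obtain ⟨hH, hω⟩ := h
  obtain ⟨φ, hφ, oφ, hφH⟩ := hH.exists_oriented
  have hρ : AnalyticAt ℝ (fun p => density ω (φ p) * jacobian φ p) 0 :=
    hφ.isMapGerm.analyticAt_transport (analyticAt_density hω.1)
  have hρ0 : density ω (φ 0) * jacobian φ 0 ≠ 0 := by
    rw [hφ.2.1, hφ.jacobian_eq]
    exact mul_ne_zero hω.density_ne_zero hφ.det_ne_zero
  obtain ⟨f, hf, η, hη, hfη⟩ := exists_potential hk hε hρ
  -- Brackets vanish at the origin, a critical point of `H`, so `f_1(0)` is the value there of the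
  -- nonzero density.
  have hf1 : f 1 0 ≠ 0 := by
    have h0 := hfη.self_of_nhds
    rw [dx_potential_zero hk hf] at h0
    have : bracket k ε η 0 = 0 := by
      simp [bracket, zero_pow (show k - 1 ≠ 0 by omega)]
    rw [this, add_zero] at h0
    rwa [← h0]
  obtain ⟨X, Y, hs, hd, hXY⟩ := exists_symmetry hk ε hρ hρ0 hη
  obtain ⟨hψ, oψ⟩ := isDiffeoGerm_of_hasFDerivAt_id (hs.anX.prod hs.anY)
    (Prod.ext hs.X0 hs.Y0) hd
  have e1 : OrientedEquivalent (model k ε) (pullback φ ω) H ω :=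
    ⟨φ, hφ, oφ, hφH, .of_forall fun _ => rfl⟩
  have e2 : OrientedEquivalent (model k ε) (normalForm k f) (model k ε) (pullback φ ω) := by
    refine ⟨_, hψ, oψ, hs.model_eq, ?_⟩
    filter_upwards [hψ.density_pullback (pullback φ ω), density_normalForm hk hf, hfη, hXY,
      hψ.tendsto.eventually (hφ.density_pullback ω)] with p h1 h2 h3 h4 h5
    refine twoForm_ext ?_
    change density _ p = density _ p
    rw [h1, h2, h5]
    refine h4.trans ?_
    rw [h3]; ring
  exact ⟨f, ⟨hf, hf1⟩, e2.trans e1⟩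

theorem hasASingularity_model (k : ℕ) (ε : ℝ) : HasASingularity k ε (model k ε) :=
  ⟨(analyticAt_snd.pow 2).add (analyticAt_const.mul (analyticAt_fst.pow k)), id,
    ⟨analyticAt_id, rfl, id, analyticAt_id, rfl, .of_forall fun _ => rfl, .of_forall fun _ => rfl⟩,
    .of_forall fun _ => rfl⟩

end existence

end ASing

/-! ### The classification theorem -/

theorem mainTheorem2 (k : ℕ) (hk : 2 ≤ k) (ε : ℝ) (hε : ε = 1 ∨ ε = -1) :
    -- existence of the normal form, and all normal forms of a given pair
    (∀ (H : ASing.Plane → ℝ) (ω : ASing.TwoForm), ASing.IsASingularPair k ε H ω →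
      ∃ f : ℕ → ℝ → ℝ, ASing.Admissible k f ∧
        ASing.OrientedEquivalent (ASing.model k ε) (ASing.normalForm k f) H ω ∧
        ∀ g : ℕ → ℝ → ℝ, ASing.Admissible k g →
          (ASing.OrientedEquivalent (ASing.model k ε) (ASing.normalForm k g) H ω ↔
            ASing.Related k f g) ∧
          (ASing.Equivalent (ASing.model k ε) (ASing.normalForm k g) H ω ↔
            ASing.Related k f g ∨ ASing.Related k (-f) g)) ∧
    -- the normal forms classify the pairs
    (∀ (H₀ H₁ : ASing.Plane → ℝ) (ω₀ ω₁ : ASing.TwoForm) (f g : ℕ → ℝ → ℝ),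
      ASing.IsASingularPair k ε H₀ ω₀ → ASing.IsASingularPair k ε H₁ ω₁ →
      ASing.Admissible k f → ASing.Admissible k g →
      ASing.OrientedEquivalent (ASing.model k ε) (ASing.normalForm k f) H₀ ω₀ →
      ASing.OrientedEquivalent (ASing.model k ε) (ASing.normalForm k g) H₁ ω₁ →
        (ASing.OrientedEquivalent H₀ ω₀ H₁ ω₁ ↔ ASing.Related k f g) ∧
        (ASing.Equivalent H₀ ω₀ H₁ ω₁ ↔
          ASing.Related k f g ∨ ASing.Related k (-f) g)) ∧
    -- every admissible family occurs
    (∀ f : ℕ → ℝ → ℝ, ASing.Admissible k f →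
      ASing.IsASingularPair k ε (ASing.model k ε) (ASing.normalForm k f)) := by
  have hε0 : ε ≠ 0 := by rcases hε with rfl | rfl <;> norm_num
  have hε1 : |ε| = 1 := by rcases hε with rfl | rfl <;> norm_num
  refine ⟨fun H ω h => ?_, fun H₀ H₁ ω₀ ω₁ f g _ _ hf hg h₀ h₁ => ⟨?_, ?_⟩, fun f hf =>
    ⟨ASing.hasASingularity_model k ε, ASing.isSymplecticGerm_normalForm hk hf⟩⟩
  · obtain ⟨f, hf, h₀⟩ := ASing.exists_normalForm hk hε1 h
    refine ⟨f, hf, h₀, fun g hg => ⟨?_, ?_⟩⟩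
    · rw [← ASing.orientedEquivalent_normalForm_iff hk hε0 hf hg]
      exact ⟨fun h₁ => h₀.trans h₁.symm, fun h₁ => h₁.symm.trans h₀⟩
    · rw [← ASing.equivalent_normalForm_iff hk hε0 hf hg]
      exact ⟨fun h₁ => h₀.equivalent.trans h₁.symm, fun h₁ => h₁.symm.trans h₀.equivalent⟩
  · rw [← ASing.orientedEquivalent_normalForm_iff hk hε0 hf hg]
    exact ⟨fun h => (h₀.trans h).trans h₁.symm, fun h => (h₀.symm.trans h).trans h₁⟩
  · rw [← ASing.equivalent_normalForm_iff hk hε0 hf hg]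
    exact ⟨fun h => (h₀.equivalent.trans h).trans h₁.equivalent.symm,
      fun h => (h₀.equivalent.symm.trans h).trans h₁.equivalent⟩
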